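/- Let $R$ be a complete discrete valuation ring with field of fractions $K$ and uniformizer $\pi$. Let $A$ be an associative unital $R$-algebra, flat as an $R$-module, with an increasing exhaustive filtration $F_0A\subseteq F_1A\subseteq F_2A\subseteq\cdots$ by $R$-submodules such that $1\in F_0A$ and $F_iA\cdot F_jA\subseteq F_{i+j}A$ for all $i,j\ge 0$. Assume: (1) $F_iA\cdot F_jA=F_jA\cdot F_iA$ for all $i,j$; (2) $F_0A$ is a commutative noetherian integral domain, and $F_0A/\pi F_0A$ is a regular integral domain (all its localizations at prime ideals are regular local rings) of finite global dimension; (3) the associated graded ring $\mathrm{gr}^F_\bullet A=\bigoplus_{i\ge 0}F_iA/F_{i-1}A$ (with $F_{-1}A=0$) is isomorphic, as a graded ring, to a polynomial ring over $F_0A$ in $r$ variables, graded by total degree with $F_0A$ in degree $0$ and the variables in degree $1$; in particular it is commutative. For $n\ge 0$ let $A_n\subseteq A$ be the image of the Rees ring $\bigoplus_{i\geq 0}(F_iA)X^i\subseteq A[X]$ under the evaluation homomorphism $A[X]\to A$, $X\mapsto\pi^n$. Let $\hat A_n=\varprojlim_m A_n/\pi^mA_n$ be its $\pi$-adic completion and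 put $\hat A_{n,K}:=\hat A_n\otimes_RK$. Let $d:=\mathrm{gld}(F_0A/\pi F_0A)+r$. Then for every $n\ge 0$ the ring $\hat A_{n,K}$ is Auslander regular, and its left and right global dimensions are at most $d$. Here, for a ring $S$ and an $S$-module $N$, the grade $j_S(N)$ is the smallest $k\geq 0$ with $\mathrm{Ext}^k_S(N,S)\neq 0$, or $\infty$ if there is none. The ring $S$ is called Auslander regular if it is left and right noetherian, has finite left and right global dimension, and if for every finitely generated left (respectively right) $S$-module $N$, every $k\ge 0$ and every right (respectively left) $S$-submodule $L\subseteq\mathrm{Ext}^k_S(N,S)$ one has $j_S(L)\ge k$. -/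

import Mathlib

open CategoryTheory CategoryTheory.Abelian
open scoped DirectSum TensorProduct Polynomial MulOpposite IsMulCommutative

universe u

noncomputable section

/-! ### Homological notions over a (not necessarily commutative) ring -/

namespace AuslanderReg

/-- The left global dimension of `S`: the supremum of the projective dimensions of all
left `S`-modules.  The right global dimension is `globalDimension Sᵐᵒᵖ`. -/
def globalDimension (S : Type u) [Ring S] : WithBot ℕ∞ :=
  ⨆ M : ModuleCat.{u} S, projectiveDimension M

/-- The group `Ext_S^k(N, S)` for a left `S`-module `N`. -/
abbrev ExtSelf (S : Type u) [Ring S] (N : ModuleCat.{u} S) (k : ℕ) : Type u :=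
  Ext.{u} N (ModuleCat.of S S) k

/-- Right multiplication by `s`, as an endomorphism of the left `S`-module `S`. -/
def rightMul (S : Type u) [Ring S] (s : S) : ModuleCat.of S S ⟶ ModuleCat.of S S :=
  ModuleCat.ofHom (LinearMap.toSpanSingleton S S s)

/-- The right `S`-module structure on `Ext_S^k(N, S)` coming from the right `S`-module structure
of the coefficients: `x · s` is the image of `x` under the map induced by `t ↦ t * s`. -/
instance extSelfModule (S : Type u) [Ring S] (N : ModuleCat.{u} S) (k : ℕ) :
    Module Sᵐᵒᵖ (ExtSelf S N k) where
  smul s x := x.comp (Ext.mk₀ (rightMul S s.unop)) (add_zero k)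
  one_smul x := by
    change x.comp (Ext.mk₀ (rightMul S 1)) (add_zero k) = x
    have : rightMul S 1 = 𝟙 _ := by ext; simp [rightMul]
    rw [this, Ext.comp_mk₀_id]
  mul_smul s t x := by
    change x.comp (Ext.mk₀ (rightMul S (t.unop * s.unop))) (add_zero k) =
      (x.comp (Ext.mk₀ (rightMul S t.unop)) (add_zero k)).comp
        (Ext.mk₀ (rightMul S s.unop)) (add_zero k)
    have : rightMul S (t.unop * s.unop) = rightMul S t.unop ≫ rightMul S s.unop := by
      ext; simp [rightMul]
    rw [this, Ext.comp_assoc_of_third_deg_zero, Ext.mk₀_comp_mk₀]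
  smul_zero s := Ext.zero_comp _ _ _ _ _
  smul_add s x y := Ext.add_comp _ _ _ _
  add_smul s t x := by
    change x.comp (Ext.mk₀ (rightMul S (s.unop + t.unop))) (add_zero k) =
      x.comp (Ext.mk₀ (rightMul S s.unop)) (add_zero k) +
        x.comp (Ext.mk₀ (rightMul S t.unop)) (add_zero k)
    have : rightMul S (s.unop + t.unop) = rightMul S s.unop + rightMul S t.unop := by
      ext; simp [rightMul]
    rw [this, Ext.mk₀_add, Ext.comp_add]
  zero_smul x := by
    change x.comp (Ext.mk₀ (rightMul S 0)) (add_zero k) = 0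
    have : rightMul S 0 = 0 := by ext; simp [rightMul]
    rw [this, Ext.mk₀_zero, Ext.comp_zero]

/-- The grade `j_S(N)`: the smallest `k` with `Ext_S^k(N, S) ≠ 0`, or `∞` if there is none. -/
def moduleGrade (S : Type u) [Ring S] (N : ModuleCat.{u} S) : ℕ∞ :=
  ⨅ (k : ℕ) (_ : Nontrivial (ExtSelf S N k)), (k : ℕ∞)

/-- Auslander's condition for all finitely generated left `S`-modules `N`: every right submodule
`L` of `Ext_S^k(N, S)` has grade at least `k`. -/
def AuslanderCondition (S : Type u) [Ring S] : Prop :=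
  ∀ N : ModuleCat.{u} S, Module.Finite S N →
    ∀ (k : ℕ) (L : Submodule Sᵐᵒᵖ (ExtSelf S N k)),
      (k : ℕ∞) ≤ moduleGrade Sᵐᵒᵖ (ModuleCat.of Sᵐᵒᵖ L)

/-- Auslander regular rings: left and right noetherian, of finite left and right global dimension,
with Auslander's condition for left modules and for right modules. -/
structure IsAuslanderRegular (S : Type u) [Ring S] : Prop where
  left_noetherian : IsNoetherianRing S
  right_noetherian : IsNoetherianRing Sᵐᵒᵖ
  left_globalDimension : globalDimension S < ⊤
  right_globalDimension : globalDimension Sᵐᵒᵖ < ⊤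
  left_condition : AuslanderCondition S
  right_condition : AuslanderCondition Sᵐᵒᵖ

/-! ### Filtered algebras and their associated graded rings -/

section Filtration

variable {R A : Type*} [CommRing R] [Ring A] [Algebra R A]

/-- `F_{i-1}`, with the convention `F_{-1} = 0`. -/
def pred (F : ℕ → Submodule R A) : ℕ → Submodule R A
  | 0 => ⊥
  | i + 1 => F i

/-- The degree zero part `F_0 A`, as an `R`-subalgebra of `A`. -/
abbrev degZero (F : ℕ → Submodule R A) [SetLike.GradedMonoid F] : Subalgebra R A :=
  SetLike.GradeZero.subalgebra F

variable (F : ℕ → Submodule R A)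

/-- The graded piece `gr_i A = F_i A / F_{i-1} A`. -/
def GrPiece (i : ℕ) : Type _ := F i ⧸ (pred F i).submoduleOf (F i)

instance grPieceAddCommGroup (i : ℕ) : AddCommGroup (GrPiece F i) :=
  inferInstanceAs (AddCommGroup (F i ⧸ (pred F i).submoduleOf (F i)))

variable {F} in
/-- The symbol in `gr_i A` of an element of `F_i A`. -/
def symb (i : ℕ) (x : A) (hx : x ∈ F i) : GrPiece F i :=
  Submodule.Quotient.mk ⟨x, hx⟩

variable {F} in
lemma symb_eq_iff {i : ℕ} {x y : A} (hx : x ∈ F i) (hy : y ∈ F i) :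
    symb i x hx = symb i y hy ↔ x - y ∈ pred F i := by
  exact Submodule.Quotient.eq _

variable {F} in
lemma symb_surj {i : ℕ} (q : GrPiece F i) : ∃ x hx, symb (F := F) i x hx = q := by
  obtain ⟨⟨x, hx⟩, rfl⟩ := Submodule.Quotient.mk_surjective _ q
  exact ⟨x, hx, rfl⟩

variable {F} in
lemma mk_symb_congr {i j : ℕ} (hij : i = j) {x y : A} (hxy : x = y) (hx : x ∈ F i)
    (hy : y ∈ F j) :
    GradedMonoid.mk (A := GrPiece F) i (symb i x hx) = GradedMonoid.mk j (symb j y hy) := by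
  subst hij; subst hxy; rfl

variable [IsRingFiltration F (pred F)]

variable {F} in
lemma mul_mem_pred_left {i j : ℕ} {x y : A} (hx : x ∈ pred F i) (hy : y ∈ F j) :
    x * y ∈ pred F (i + j) := by
  cases i with
  | zero => simp only [pred, Submodule.mem_bot] at hx; simp [hx]
  | succ i =>
    rw [Nat.succ_add]
    exact SetLike.GradedMul.mul_mem (A := F) hx hy

variable {F} in
lemma mul_mem_pred_right {i j : ℕ} {x y : A} (hx : x ∈ F i) (hy : y ∈ pred F j) :
    x * y ∈ pred F (i + j) := by
  cases j with
  | zero => simp only [pred, Submodule.mem_bot] at hy; simp [hy]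
  | succ j => exact SetLike.GradedMul.mul_mem (A := F) hx hy

/-- Multiplication `gr_i A × gr_j A → gr_{i+j} A`, induced by the multiplication of `A`. -/
def grMul {i j : ℕ} (p : GrPiece F i) (q : GrPiece F j) : GrPiece F (i + j) :=
  Quotient.liftOn₂' p q
    (fun x y ↦ symb (i + j) ((x : A) * y) (SetLike.GradedMul.mul_mem (A := F) x.2 y.2))
    (by
      intro x y x' y' hx hy
      have hx' : (x : A) - x' ∈ pred F i := (symb_eq_iff x.2 x'.2).1 (Quotient.sound' hx)
      have hy' : (y : A) - y' ∈ pred F j := (symb_eq_iff y.2 y'.2).1 (Quotient.sound' hy)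
      rw [symb_eq_iff]
      have : (x : A) * y - x' * y' = (x - x') * y + x' * (y - y') := by noncomm_ring
      rw [this]
      exact add_mem (mul_mem_pred_left hx' y.2) (mul_mem_pred_right x'.2 hy'))

lemma grMul_symb {i j : ℕ} {x y : A} (hx : x ∈ F i) (hy : y ∈ F j) :
    grMul F (symb i x hx) (symb j y hy) =
      symb (i + j) (x * y) (SetLike.GradedMul.mul_mem (A := F) hx hy) := rfl

instance grOne : GradedMonoid.GOne (GrPiece F) where
  one := symb 0 1 (SetLike.GradedOne.one_mem (A := F))

instance grGMul : GradedMonoid.GMul (GrPiece F) where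
  mul := grMul F

/-- The graded ring structure on `gr A`. -/
instance grRing : DirectSum.GRing (GrPiece F) where
  mul_zero := by
    intro i j a
    obtain ⟨x, hx, rfl⟩ := symb_surj a
    exact (symb_eq_iff _ (zero_mem _)).2 (by simp)
  zero_mul := by
    intro i j a
    obtain ⟨x, hx, rfl⟩ := symb_surj a
    exact (symb_eq_iff _ (zero_mem _)).2 (by simp)
  mul_add := by
    intro i j a b c
    obtain ⟨x, hx, rfl⟩ := symb_surj a
    obtain ⟨y, hy, rfl⟩ := symb_surj b
    obtain ⟨z, hz, rfl⟩ := symb_surj c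
    refine (symb_eq_iff (SetLike.GradedMul.mul_mem (A := F) hx (add_mem hy hz))
      (add_mem (SetLike.GradedMul.mul_mem (A := F) hx hy)
        (SetLike.GradedMul.mul_mem (A := F) hx hz))).2 ?_
    simp [mul_add]
  add_mul := by
    intro i j a b c
    obtain ⟨x, hx, rfl⟩ := symb_surj a
    obtain ⟨y, hy, rfl⟩ := symb_surj b
    obtain ⟨z, hz, rfl⟩ := symb_surj c
    refine (symb_eq_iff (SetLike.GradedMul.mul_mem (A := F) (add_mem hx hy) hz)
      (add_mem (SetLike.GradedMul.mul_mem (A := F) hx hz)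
        (SetLike.GradedMul.mul_mem (A := F) hy hz))).2 ?_
    simp [add_mul]
  one_mul := by
    rintro ⟨i, a⟩
    obtain ⟨x, hx, rfl⟩ := symb_surj a
    exact mk_symb_congr (zero_add i) (one_mul x) _ _
  mul_one := by
    rintro ⟨i, a⟩
    obtain ⟨x, hx, rfl⟩ := symb_surj a
    exact mk_symb_congr (add_zero i) (mul_one x) _ _
  mul_assoc := by
    rintro ⟨i, a⟩ ⟨j, b⟩ ⟨k, c⟩
    obtain ⟨x, hx, rfl⟩ := symb_surj a
    obtain ⟨y, hy, rfl⟩ := symb_surj b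
    obtain ⟨z, hz, rfl⟩ := symb_surj c
    exact mk_symb_congr (add_assoc i j k) (mul_assoc x y z) _ _
  natCast n := n • symb 0 1 (SetLike.GradedOne.one_mem (A := F))
  natCast_zero := zero_smul _ _
  natCast_succ n := succ_nsmul _ _
  intCast n := n • symb 0 1 (SetLike.GradedOne.one_mem (A := F))
  intCast_ofNat n := natCast_zsmul _ _
  intCast_negSucc_ofNat n := negSucc_zsmul _ _

/-- The associated graded ring `gr A = ⨁ F_i A / F_{i-1} A`. -/
abbrev Gr : Type _ := ⨁ i, GrPiece F i

/-- `gr A` is isomorphic, as a graded ring, to the polynomial ring in `r` variables over `F_0 A`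
graded by total degree.  (In particular `gr A` is commutative.) -/
def IsGrPolynomial [IsMulCommutative (degZero F)] (r : ℕ) : Prop :=
  ∃ e : Gr F ≃+* MvPolynomial (Fin r) (degZero F),
    ∀ (i : ℕ) (x : GrPiece F i), (e (DirectSum.of (GrPiece F) i x)).IsHomogeneous i

/-- The ring `F_0 A / π F_0 A`. -/
abbrev SpecialFibre (π : R) [IsMulCommutative (degZero F)] : Type _ :=
  degZero F ⧸ Ideal.span {algebraMap R (degZero F) π}

/-! ### The Rees ring and the deformations `A_n` -/

/-- The Rees ring `⨁ (F_i A) X^i`, as a subring of `A[X]`. -/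
def reesRing : Subalgebra R A[X] where
  carrier := {p | ∀ i, p.coeff i ∈ F i}
  mul_mem' {p q} hp hq i := by
    rw [Polynomial.coeff_mul]
    refine sum_mem fun ij hij ↦ ?_
    rw [← Finset.HasAntidiagonal.mem_antidiagonal.1 hij]
    exact SetLike.GradedMul.mul_mem (A := F) (hp _) (hq _)
  add_mem' {p q} hp hq i := by
    rw [Polynomial.coeff_add]
    exact add_mem (hp i) (hq i)
  algebraMap_mem' c i := by
    rw [Polynomial.algebraMap_apply, Polynomial.coeff_C]
    split_ifs with h
    · subst h
      exact SetLike.algebraMap_mem_graded F c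
    · exact zero_mem _

/-- The evaluation homomorphism `A[X] → A`, `X ↦ c`, at a scalar `c`. -/
def evalScalar (A : Type*) [Ring A] [Algebra R A] (c : R) : A[X] →ₐ[R] A :=
  Polynomial.eval₂AlgHom (AlgHom.id R A) (algebraMap R A c)
    fun a ↦ (Algebra.commutes c a).symm

/-- `A_n`, the image of the Rees ring under `X ↦ π ^ n`. -/
def deformation (π : R) (n : ℕ) : Subalgebra R A :=
  (reesRing F).map (evalScalar A (π ^ n))

end Filtration

/-! ### Completion -/

section Completion

variable {R : Type*} [CommRing R] (π : R) (B : Type*) [Ring B] [Algebra R B]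

/-- The two-sided ideal `π ^ m B` of the `R`-algebra `B`. -/
def powIdeal (m : ℕ) : Ideal B := Ideal.span {algebraMap R B (π ^ m)}

instance powIdeal_isTwoSided (m : ℕ) : (powIdeal π B m).IsTwoSided where
  mul_mem_of_left {a} b ha := by
    obtain ⟨c, rfl⟩ := Ideal.mem_span_singleton'.1 ha
    refine Ideal.mem_span_singleton'.2 ⟨c * b, ?_⟩
    rw [mul_assoc, mul_assoc, ← Algebra.commutes]

lemma powIdeal_succ_le (m : ℕ) : powIdeal π B (m + 1) ≤ powIdeal π B m := by
  refine (Ideal.span_singleton_le_iff_mem _).2 (Ideal.mem_span_singleton'.2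
    ⟨algebraMap R B π, ?_⟩)
  rw [pow_succ', map_mul]

/-- The `π`-adic completion `lim B / π ^ m B`, as a subalgebra of the product. -/
def piCompletion : Subalgebra R (∀ m : ℕ, B ⧸ powIdeal π B m) where
  carrier := {x | ∀ m, Ideal.Quotient.factor (powIdeal_succ_le π B m) (x (m + 1)) = x m}
  mul_mem' {x y} hx hy m := by
    rw [Pi.mul_apply, Pi.mul_apply, map_mul, hx, hy]
  add_mem' {x y} hx hy m := by
    rw [Pi.add_apply, Pi.add_apply, map_add, hx, hy]
  algebraMap_mem' c m := rfl

end Completion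

/-- `Â_{n,K}`: the `π`-adic completion of `A_n`, tensored over `R` with `K`. -/
abbrev CompletedDeformation {R A : Type*} (K : Type*) [CommRing R] [Field K] [Algebra R K]
    [Ring A] [Algebra R A] (π : R) (F : ℕ → Submodule R A) [IsRingFiltration F (pred F)]
    (n : ℕ) : Type _ :=
  piCompletion π (deformation F π n) ⊗[R] K

end AuslanderReg

end

/-! Let `S` be the completion of `A_n` and `B = A_n / π A_n`. Then `S` is `π`-adically complete and
separated without `π`-torsion, `S / π S = B`, and inverting `π` gives the ring of the theorem. The
proof relates these rings to the commutative ring `gr B` by two transfer principles.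

Complete deformations (`IsCompleteDeformation`): if `t` is central and regular in `S` and `S` is
`t`-adically complete, then Auslander regularity and bounds on global dimension pass from `S / t S`
to `S[1/t]`. A finitely generated `S[1/t]`-module contains a lattice `M` without `t`-torsion.
Syzygies of `M` reduce to syzygies of `M / t M`, so vanishing of `Ext` and projectivity lift from `M
/ t M` by successive approximation. A submodule of an `Ext` group over `S[1/t]` has a lattice whose
reduction is a subquotient of the corresponding `Ext` group over `S / t S`, and grade bounds for
submodules give grade bounds for subquotients.

Flat descent (`IsFlatRetract`): the same properties pass from `E` to a left and right noetherian
ring `B` if `E` is flat over `B` on both sides and has a `B`-bimodule retraction onto `B`. Solve the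
problem over `E` and apply the retraction.

The ring `B` is filtered by the images of `∑_{k ≤ i} π^{nk} F_k`. A symbol of degree `i` in `A`
coming from this lattice is divisible by `π^{ni}`; the quotients identify `gr B` with the polynomial
ring in `r` variables over `F_0 A / π F_0 A`. It is commutative noetherian of global dimension at
most `d`, hence Auslander regular (`isAuslanderRegular_of_comm`). Deforming `gr B` with parameter
`X` gives the completed Rees ring of `B`. Inverting `X` gives a ring of Laurent series, from which
the properties descend to `B` (`IsSymbolMap.isAuslanderRegular`). Deforming `B` with parameter `π`
then gives the theorem. No step increases the bound on the global dimension. -/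

noncomputable section

namespace AuslanderReg

/-! ### `Ext` groups with values in the ring, by dimension shifting -/

section ExtSelf

variable {S : Type u} [Ring S] {M P X Y Z : Type u} [AddCommGroup M] [Module S M]
  [AddCommGroup P] [Module S P] [AddCommGroup X] [Module S X] [AddCommGroup Y] [Module S Y]
  [AddCommGroup Z] [Module S Z]

variable (S M) in
/-- The group `Ext_S^j(M, S)` vanishes. -/
def ExtVanishes (j : ℕ) : Prop := Subsingleton (ExtSelf S (ModuleCat.of S M) j)

/-- Precomposition with a linear map, as a map between the duals (right modules). -/
def opDual (f : X →ₗ[S] Y) : (Y →ₗ[S] S) →ₗ[Sᵐᵒᵖ] (X →ₗ[S] S) where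
  toFun h := h ∘ₗ f
  map_add' _ _ := rfl
  map_smul' _ _ := rfl

@[simp] lemma opDual_apply (f : X →ₗ[S] Y) (h : Y →ₗ[S] S) (x : X) :
    opDual f h x = h (f x) := rfl

lemma extSelf_smul_def (N : ModuleCat.{u} S) (k : ℕ) (s : Sᵐᵒᵖ) (x : ExtSelf S N k) :
    s • x = x.comp (Ext.mk₀ (rightMul S s.unop)) (add_zero k) := rfl

lemma ExtVanishes.of_linearEquiv {j : ℕ} (e : X ≃ₗ[S] Y) (h : ExtVanishes S X j) :
    ExtVanishes S Y j := by
  refine ⟨fun a b ↦ ?_⟩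
  have key : ∀ a : ExtSelf S (ModuleCat.of S Y) j, a = 0 := fun a ↦ by
    have h1 : (Ext.mk₀ e.toModuleIso.hom).comp a (zero_add j) = 0 := h.elim _ _
    have h2 : (Ext.mk₀ e.toModuleIso.inv).comp
        ((Ext.mk₀ e.toModuleIso.hom).comp a (zero_add j)) (zero_add j) = a := by
      rw [Ext.mk₀_comp_mk₀_assoc, Iso.inv_hom_id, Ext.mk₀_id_comp]
    rw [← h2, h1, Ext.comp_zero]
  rw [key a, key b]

lemma extVanishes_zero_iff : ExtVanishes S M 0 ↔ ∀ f : M →ₗ[S] S, f = 0 := by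
  have e : ExtSelf S (ModuleCat.of S M) 0 ≃ (M →ₗ[S] S) :=
    Ext.homEquiv₀.trans ModuleCat.homAddEquiv.toEquiv
  rw [ExtVanishes, e.subsingleton_congr]
  exact ⟨fun h f ↦ h.elim _ _, fun h ↦ ⟨fun a b ↦ by rw [h a, h b]⟩⟩

section Shift

variable {f : P →ₗ[S] M}

/-- The connecting map `Ext^j(ker f, S) → Ext^{j+1}(M, S)`. -/
def extConn (hf : Function.Surjective f) (j : ℕ) :
    ExtSelf S (ModuleCat.of S (LinearMap.ker f)) j →ₗ[Sᵐᵒᵖ]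
      ExtSelf S (ModuleCat.of S M) (j + 1) where
  toFun x := (LinearMap.shortExact_shortComplexKer hf).extClass.comp x (add_comm 1 j)
  map_add' x y := Ext.comp_add _ _ _ _
  map_smul' s x := by
    rw [extSelf_smul_def, RingHom.id_apply, extSelf_smul_def,
      Ext.comp_assoc_of_third_deg_zero]

lemma extConn_surjective [Module.Projective S P] (hf : Function.Surjective f) (j : ℕ) :
    Function.Surjective (extConn hf j) := by
  have : Projective (LinearMap.shortComplexKer f).X₂ :=
    (IsProjective.iff_projective P).1 inferInstance
  exact precomp_extClass_surjective_of_projective_X₂ _ (LinearMap.shortExact_shortComplexKer hf) j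

lemma extConn_injective [Module.Projective S P] (hf : Function.Surjective f) (j : ℕ) :
    Function.Injective (extConn hf (j + 1)) := by
  have : Projective (LinearMap.shortComplexKer f).X₂ :=
    (IsProjective.iff_projective P).1 inferInstance
  refine (injective_iff_map_eq_zero _).2 fun x hx ↦ ?_
  obtain ⟨y, rfl⟩ := Ext.contravariant_sequence_exact₁
    (LinearMap.shortExact_shortComplexKer hf) _ x (add_comm 1 (j + 1)) hx
  rw [Ext.eq_zero_of_projective y, Ext.comp_zero]

/-- Dimension shifting: `Ext^{j+2}(M, S) ≃ Ext^{j+1}(ker f, S)` as right modules. -/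
def extShift [Module.Projective S P] (hf : Function.Surjective f) (j : ℕ) :
    ExtSelf S (ModuleCat.of S (LinearMap.ker f)) (j + 1) ≃ₗ[Sᵐᵒᵖ]
      ExtSelf S (ModuleCat.of S M) (j + 2) :=
  LinearEquiv.ofBijective (extConn hf (j + 1)) ⟨extConn_injective hf j, extConn_surjective hf _⟩

/-- The identification of `Ext^0` with `Hom`, as right modules. -/
def extZero : (M →ₗ[S] S) ≃ₗ[Sᵐᵒᵖ] ExtSelf S (ModuleCat.of S M) 0 :=
  LinearEquiv.ofBijective
    { toFun h := Ext.mk₀ (ModuleCat.ofHom h)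
      map_add' h h' := by rw [ModuleCat.ofHom_add, Ext.mk₀_add]
      map_smul' s h := by
        rw [extSelf_smul_def, RingHom.id_apply, Ext.mk₀_comp_mk₀]
        rfl }
    ((Ext.mk₀_bijective _ _).comp 
      (ModuleCat.homEquiv (M := ModuleCat.of S M) (N := ModuleCat.of S S)).symm.bijective)

lemma extZero_apply (h : M →ₗ[S] S) : extZero h = Ext.mk₀ (ModuleCat.ofHom h) := rfl

lemma extZero_opDual (h : Y →ₗ[S] S) (g : X →ₗ[S] Y) : extZero (opDual g h) =
    (Ext.mk₀ (ModuleCat.ofHom g)).comp (extZero h) (zero_add 0) := by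
  rw [extZero_apply, extZero_apply, Ext.mk₀_comp_mk₀]
  rfl

lemma extConn_apply (hf : Function.Surjective f) (j : ℕ)
    (x : ExtSelf S (ModuleCat.of S (LinearMap.ker f)) j) : extConn hf j x =
    (LinearMap.shortExact_shortComplexKer hf).extClass.comp x (add_comm 1 j) := rfl

lemma extConn_extZero_eq_zero_iff (hf : Function.Surjective f) (h : LinearMap.ker f →ₗ[S] S) :
    extConn hf 0 (extZero h) = 0 ↔ ∃ g, opDual (LinearMap.ker f).subtype g = h := by
  constructor
  · intro hh
    rw [extConn_apply] at hh
    obtain ⟨y, hy⟩ := Ext.contravariant_sequence_exact₁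
      (LinearMap.shortExact_shortComplexKer hf) _ (extZero h) (add_comm 1 0) hh
    obtain ⟨g, rfl⟩ := (extZero (S := S) (M := P)).surjective y
    refine ⟨g, extZero.injective ?_⟩
    rw [← hy, extZero_opDual]
  · rintro ⟨g, rfl⟩
    rw [extZero_opDual, extConn_apply]
    exact (LinearMap.shortExact_shortComplexKer hf).extClass_comp_assoc _

lemma extConn_zero_ker (hf : Function.Surjective f) :
    LinearMap.ker (extConn hf 0 ∘ₗ extZero.toLinearMap) =
      LinearMap.range (opDual (LinearMap.ker f).subtype) := by
  ext h
  exact extConn_extZero_eq_zero_iff hf h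

variable (f) in
/-- The cokernel of restriction `Hom(P, S) → Hom(ker f, S)`. -/
abbrev ExtOneModel : Type u :=
  (LinearMap.ker f →ₗ[S] S) ⧸ LinearMap.range (opDual (LinearMap.ker f).subtype)

/-- `Ext^1(M, S)` is the cokernel of the restriction map `Hom(P, S) → Hom(ker f, S)`. -/
def extOne [Module.Projective S P] (hf : Function.Surjective f) :
    ExtOneModel f ≃ₗ[Sᵐᵒᵖ] ExtSelf S (ModuleCat.of S M) 1 :=
  (Submodule.quotEquivOfEq _ _ (extConn_zero_ker hf).symm).trans
    (LinearMap.quotKerEquivOfSurjective (extConn hf 0 ∘ₗ extZero.toLinearMap)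
      ((extConn_surjective hf 0).comp extZero.surjective))

/-- An extension problem for functionals is the form of `Ext^1` that can be lifted along a reduction
or descended along a retraction. -/
lemma extVanishes_one_iff [Module.Projective S P] (hf : Function.Surjective f) :
    ExtVanishes S M 1 ↔
      ∀ g : LinearMap.ker f →ₗ[S] S, ∃ h : P →ₗ[S] S, ∀ x : LinearMap.ker f, h x = g x := by
  rw [ExtVanishes, ← (extOne hf).toEquiv.subsingleton_congr,
    Submodule.Quotient.subsingleton_iff,
    LinearMap.range_eq_top]
  exact forall_congr' fun g ↦ exists_congr fun h ↦ LinearMap.ext_iff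

lemma extVanishes_add_two_iff [Module.Projective S P] (hf : Function.Surjective f) (j : ℕ) :
    ExtVanishes S M (j + 2) ↔ ExtVanishes S (LinearMap.ker f) (j + 1) :=
  (extShift hf j).toEquiv.subsingleton_congr.symm

end Shift

/-- The long exact sequence of `Y' → Y → Y ⧸ Y'`. It carries grade bounds from submodules to
subquotients; for `j = 0` nothing is asked of `Y'`. -/
lemma ExtVanishes.quotient {j : ℕ} {Y' : Submodule S Y}
    (h : ExtVanishes S Y j) (h' : ∀ i, i + 1 = j → ExtVanishes S Y' i) :
    ExtVanishes S (Y ⧸ Y') j := by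
  have hS := ModuleCat.shortComplex_shortExact
    (ModuleCat.shortComplexOfCompEqZero Y'.subtype Y'.mkQ
      (by ext x; simp)) (fun x ↦ by simp) Y'.injective_subtype Y'.mkQ_surjective
  have key : ∀ a : ExtSelf S (ModuleCat.of S (Y ⧸ Y')) j, a = 0 := fun a ↦ by
    cases j with
    | zero =>
      refine Ext.precomp_mk₀_injective_of_epi (ModuleCat.of S S)
        (ModuleCat.ofHom Y'.mkQ) (hg := (ModuleCat.epi_iff_surjective _).2 Y'.mkQ_surjective)
        (h.elim _ _)
    | succ j =>
      obtain ⟨b, rfl⟩ := Ext.contravariant_sequence_exact₃ hS _ a (h.elim _ _) (add_comm 1 j)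
      rw [(h' j rfl).elim b 0, Ext.comp_zero]
  exact ⟨fun a b ↦ by rw [key a, key b]⟩

lemma le_moduleGrade_iff {k : ℕ} : (k : ℕ∞) ≤ moduleGrade S (ModuleCat.of S M) ↔
    ∀ j < k, ExtVanishes S M j := by
  simp only [moduleGrade, le_iInf_iff, ExtVanishes]
  refine forall_congr' fun j ↦ ⟨fun h hj ↦ ?_, fun h hj ↦ ?_⟩
  · rw [← not_nontrivial_iff_subsingleton]
    intro hn
    exact absurd (h hn) (by simpa using hj)
  · by_contra hlt
    have := h (by simpa using hlt)
    exact not_subsingleton _ this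

variable (S M) in
/-- All right submodules of `Ext_S^k(M, S)` have grade at least `c`. -/
def SubExtVanishes (k c : ℕ) : Prop :=
  ∀ L : Submodule Sᵐᵒᵖ (ExtSelf S (ModuleCat.of S M) k), ∀ j < c, ExtVanishes Sᵐᵒᵖ L j

/-- The bound is empty in degree `0`. In positive degrees, dimension shifting reduces everything to
`Ext^1`, a cokernel of duals. -/
lemma auslanderCondition_iff : AuslanderCondition S ↔
    ∀ (M : Type u) [AddCommGroup M] [Module S M], Module.Finite S M →
      ∀ k, SubExtVanishes S M (k + 1) (k + 1) := by
  constructor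
  · intro h M _ _ hM k L
    exact le_moduleGrade_iff.1 (h (ModuleCat.of S M) hM (k + 1) L)
  · intro h N hN k L
    rw [le_moduleGrade_iff]
    cases k with
    | zero => simp
    | succ k => exact h N hN k L

lemma forall_submodule_extVanishes_of_linearEquiv {c : ℕ} (e : X ≃ₗ[S] Y)
    (h : ∀ L : Submodule S X, ∀ j < c, ExtVanishes S L j) :
    ∀ L : Submodule S Y, ∀ j < c, ExtVanishes S L j := fun L j hj ↦ by
  refine (h (L.comap e.toLinearMap) j hj).of_linearEquiv
    ((e.submoduleMap _).trans (LinearEquiv.ofEq _ _ ?_))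
  exact Submodule.map_comap_eq_of_surjective e.surjective L

lemma subExtVanishes_add_two_iff [Module.Projective S P] {f : P →ₗ[S] M}
    (hf : Function.Surjective f) (k c : ℕ) :
    SubExtVanishes S M (k + 2) c ↔ SubExtVanishes S (LinearMap.ker f) (k + 1) c :=
  ⟨forall_submodule_extVanishes_of_linearEquiv (extShift hf k).symm,
    forall_submodule_extVanishes_of_linearEquiv (extShift hf k)⟩

lemma subExtVanishes_one_iff [Module.Projective S P] {f : P →ₗ[S] M}
    (hf : Function.Surjective f) (c : ℕ) :
    SubExtVanishes S M 1 c ↔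
      ∀ L : Submodule Sᵐᵒᵖ (ExtOneModel f), ∀ j < c, ExtVanishes Sᵐᵒᵖ L j :=
  ⟨forall_submodule_extVanishes_of_linearEquiv (extOne hf).symm,
    forall_submodule_extVanishes_of_linearEquiv (extOne hf)⟩

lemma hasProjectiveDimensionLT_add_two_iff [Module.Projective S P] {f : P →ₗ[S] M}
    (hf : Function.Surjective f) (d : ℕ) :
    HasProjectiveDimensionLT (ModuleCat.of S M) (d + 2) ↔
      HasProjectiveDimensionLT (ModuleCat.of S (LinearMap.ker f)) (d + 1) :=
  (LinearMap.shortExact_shortComplexKer hf).hasProjectiveDimensionLT_X₃_iff d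
    ((IsProjective.iff_projective P).1 inferInstance)

lemma hasProjectiveDimensionLT_one_iff :
    HasProjectiveDimensionLT (ModuleCat.of S M) 1 ↔ Module.Projective S M := by
  rw [← projective_iff_hasProjectiveDimensionLT_one, IsProjective.iff_projective]

end ExtSelf

end AuslanderReg

end

noncomputable section

namespace AuslanderReg

/-! ### Global dimension -/

section GlobalDimension

variable {S : Type u} [Ring S]

lemma globalDimension_le_iff {d : ℕ} : globalDimension S ≤ d ↔
    ∀ (M : Type u) [AddCommGroup M] [Module S M],
      HasProjectiveDimensionLT (ModuleCat.of S M) (d + 1) := by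
  rw [globalDimension, iSup_le_iff]
  exact ⟨fun h M _ _ ↦ (projectiveDimension_le_iff _ d).1 (h (ModuleCat.of S M)),
    fun h M ↦ (projectiveDimension_le_iff _ d).2 (h M)⟩

lemma baer_of_ext_one (Y : ModuleCat.{u} S)
    (h : ∀ I : Ideal S, Subsingleton (Ext.{u} (ModuleCat.of S (S ⧸ I)) Y 1)) :
    Module.Baer S Y := fun I g ↦ by
  have hS := ModuleCat.shortComplex_shortExact
    (ModuleCat.shortComplexOfCompEqZero (Submodule.subtype I) (Submodule.mkQ I)
      (by ext x; simp)) (fun x ↦ by simp) (Submodule.injective_subtype I)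
      (Submodule.mkQ_surjective I)
  obtain ⟨y, hy⟩ := Ext.contravariant_sequence_exact₁ hS Y (Ext.mk₀ (ModuleCat.ofHom g))
    (add_comm 1 0) ((h I).elim _ _)
  obtain ⟨k, rfl⟩ := (Ext.mk₀_bijective _ _).2 y
  rw [Ext.mk₀_comp_mk₀] at hy
  have hk := (Ext.mk₀_bijective _ _).1 hy
  refine ⟨k.hom, fun x hx ↦ ?_⟩
  exact DFunLike.congr_fun (congrArg ModuleCat.Hom.hom hk) (⟨x, hx⟩ : I)

/-- Baer's criterion settles `d = 0`. Otherwise the cokernel of an embedding of `Y` into an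
injective satisfies the hypothesis one degree lower. -/
lemma hasInjectiveDimensionLT_of_cyclic (d : ℕ) (Y : ModuleCat.{u} S)
    (h : ∀ I : Ideal S, Subsingleton (Ext.{u} (ModuleCat.of S (S ⧸ I)) Y (d + 1))) :
    HasInjectiveDimensionLT Y (d + 1) := by
  induction d generalizing Y with
  | zero =>
    rw [zero_add, ← injective_iff_hasInjectiveDimensionLT_one]
    have := (baer_of_ext_one Y h).injective
    exact Module.injective_object_of_injective_module S Y
  | succ d ih =>
    let ⟨J, _, f, _⟩ := EnoughInjectives.presentation Y
    have hS : (ShortComplex.mk _ _ (Limits.cokernel.condition f)).ShortExact :=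
      { exact := ShortComplex.exact_cokernel f }
    refine (hS.hasInjectiveDimensionLT_X₃_iff d inferInstance).1 (ih _ fun I ↦ ?_)
    have key : ∀ a : Ext.{u} (ModuleCat.of S (S ⧸ I)) (Limits.cokernel f) (d + 1), a = 0 := by
      intro a
      obtain ⟨b, rfl⟩ := Ext.covariant_sequence_exact₃ _ hS a (n₁ := d + 2) rfl ((h I).elim _ _)
      rw [show b = 0 from Ext.eq_zero_of_injective (I := J) b, Ext.zero_comp]
    exact ⟨fun a b ↦ by rw [key a, key b]⟩

/-- The global dimension is detected on finitely generated modules. -/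
lemma globalDimension_le_of_finite {d : ℕ}
    (h : ∀ (M : Type u) [AddCommGroup M] [Module S M], Module.Finite S M →
      HasProjectiveDimensionLT (ModuleCat.of S M) (d + 1)) : globalDimension S ≤ d := by
  rw [globalDimension_le_iff]
  intro M _ _
  refine HasProjectiveDimensionLT.mk fun i hi Y e ↦ ?_
  have : HasInjectiveDimensionLT Y (d + 1) := hasInjectiveDimensionLT_of_cyclic d Y fun I ↦
    (h (S ⧸ I) inferInstance).subsingleton _ _ _ le_rfl _
  exact Ext.eq_zero_of_hasInjectiveDimensionLT e (d + 1) hi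

lemma exists_globalDimension_le_of_lt_top (h : globalDimension S < ⊤) :
    ∃ d : ℕ, globalDimension S ≤ d := by
  generalize globalDimension S = x at h
  induction x with
  | bot => exact ⟨0, bot_le⟩
  | coe x =>
    induction x with
    | top => exact absurd h (lt_irrefl _)
    | coe d => exact ⟨d, le_rfl⟩

lemma globalDimension_lt_top {d : ℕ} (h : globalDimension S ≤ d) : globalDimension S < ⊤ :=
  h.trans_lt (WithBot.coe_lt_coe.2 (ENat.natCast_lt_top d))

end GlobalDimension

section RingEquiv

universe v w

variable {S : Type v} {T : Type w} [Ring S] [Ring T]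

/-- The global dimension is invariant under ring isomorphisms, across universes. -/
lemma globalDimension_le_of_ringEquiv (e : S ≃+* T) {d : ℕ}
    (h : globalDimension S ≤ d) : globalDimension T ≤ d := by
  let := RingHomInvPair.of_ringEquiv e
  let := (RingHomInvPair.of_ringEquiv e).symm
  refine globalDimension_le_of_finite fun M _ _ hM ↦ ?_
  obtain ⟨n, f, hf⟩ := Module.Finite.exists_fin' T M
  let g : (Fin n → S) ≃ₛₗ[(e : S →+* T)] (Fin n → T) :=
    { toFun x i := e (x i)
      invFun x i := e.symm (x i)
      left_inv x := by simp
      right_inv x := by simp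
      map_add' x y := by ext; simp
      map_smul' s x := by ext; simp }
  -- `M` need not lie in the universe of `S`; being finitely generated, it is semilinearly
  -- isomorphic to the quotient of `S ^ n` by `ker k`, which does.
  let k : (Fin n → S) →ₛₗ[(e : S →+* T)] M := f.comp g.toLinearMap
  have hk : Function.Surjective k := hf.comp g.surjective
  have : HasProjectiveDimensionLE (ModuleCat.of S ((Fin n → S) ⧸ LinearMap.ker k)) d :=
    globalDimension_le_iff.1 h ((Fin n → S) ⧸ LinearMap.ker k)
  exact ModuleCat.hasProjectiveDimensionLE_of_semiLinearEquiv e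
    (M := ModuleCat.of S ((Fin n → S) ⧸ LinearMap.ker k)) (N := ModuleCat.of T M)
    (LinearEquiv.ofBijective ((LinearMap.ker k).liftQ k le_rfl)
      ⟨LinearMap.ker_eq_bot.1 (Submodule.ker_liftQ_eq_bot _ _ _ le_rfl), fun m ↦ by
        obtain ⟨x, rfl⟩ := hk m
        exact ⟨Submodule.Quotient.mk x, rfl⟩⟩) d

end RingEquiv

end AuslanderReg

end

noncomputable section

namespace AuslanderReg

/-! ### Semilinear base change of modules -/

section BaseChange

universe v v' w w'

variable {S : Type v} {S' : Type w} [Ring S] [Ring S'] {σ : S →+* S'}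
  {M : Type v'} {N : Type w'} [AddCommGroup M] [Module S M] [AddCommGroup N] [Module S' N]

variable (σ) in
/-- The semilinear map `S^κ → S'^κ` induced by a ring homomorphism. -/
def coordMap (κ : Type*) : (κ → S) →ₛₗ[σ] (κ → S') where
  toFun x i := σ (x i)
  map_add' x y := by ext; simp
  map_smul' s x := by ext; simp

@[simp] lemma coordMap_apply {κ : Type*} (x : κ → S) (i : κ) : coordMap σ κ x i = σ (x i) := rfl

variable {κ : Type*} [Fintype κ] [DecidableEq κ]

/-- The linear map `S'^κ → N` induced by `S^κ → M` and a semilinear map `M → N`. -/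
def baseMap (q : M →ₛₗ[σ] N) (f : (κ → S) →ₗ[S] M) : (κ → S') →ₗ[S'] N :=
  Fintype.linearCombination S' fun i ↦ q (f (Pi.single i 1))

lemma baseMap_coordMap (q : M →ₛₗ[σ] N) (f : (κ → S) →ₗ[S] M) (x : κ → S) :
    baseMap q f (coordMap σ κ x) = q (f x) := by
  rw [LinearMap.pi_apply_eq_sum_univ f x, map_sum, baseMap, Fintype.linearCombination_apply]
  refine Finset.sum_congr rfl fun i _ ↦ ?_
  have : (fun j ↦ if i = j then (1 : S) else 0) = Pi.single i 1 := by
    ext j; simp [Pi.single_apply, eq_comm]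
  rw [map_smulₛₗ, coordMap_apply, this]

lemma baseMap_single (q : M →ₛₗ[σ] N) (f : (κ → S) →ₗ[S] M) (i : κ) :
    baseMap q f (Pi.single i 1) = q (f (Pi.single i 1)) := by
  simp [baseMap]

/-- The semilinear map induced on kernels. -/
def kerMap (q : M →ₛₗ[σ] N) (f : (κ → S) →ₗ[S] M) :
    LinearMap.ker f →ₛₗ[σ] LinearMap.ker (baseMap q f) :=
  LinearMap.codRestrict _ ((coordMap σ κ).domRestrict (LinearMap.ker f)) fun x ↦ by
    rw [LinearMap.domRestrict_apply, LinearMap.mem_ker, baseMap_coordMap, x.2, map_zero]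

@[simp] lemma kerMap_coe (q : M →ₛₗ[σ] N) (f : (κ → S) →ₗ[S] M) (x : LinearMap.ker f) :
    (kerMap q f x : κ → S') = coordMap σ κ x := rfl

/-- Semilinear functionals on `M` factor uniquely through `q`. -/
def IsUniv (q : M →ₛₗ[σ] N) : Prop :=
  ∀ ψ : M →ₛₗ[σ] S', ∃! χ : N →ₗ[S'] S', ∀ x, χ (q x) = ψ x

/-- The semilinear functional `σ ∘ h`. -/
def pushFunctional (σ : S →+* S') (h : M →ₗ[S] S) : M →ₛₗ[σ] S' where
  toFun x := σ (h x)
  map_add' x y := by simp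
  map_smul' s x := by simp

lemma IsUniv.ext {q : M →ₛₗ[σ] N} (hq : IsUniv q) {g h : N →ₗ[S'] S'}
    (H : ∀ x, g (q x) = h (q x)) : g = h :=
  (hq (h.comp q)).unique H fun _ ↦ rfl

/-- The map on duals induced by a universal semilinear map. -/
def IsUniv.dual {q : M →ₛₗ[σ] N} (hq : IsUniv q) :
    (M →ₗ[S] S) →ₛₗ[RingHom.op σ] (N →ₗ[S'] S') where
  toFun h := (hq (pushFunctional σ h)).choose
  map_add' g h := hq.ext fun x ↦ by
    rw [LinearMap.add_apply, (hq (pushFunctional σ (g + h))).choose_spec.1,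
      (hq (pushFunctional σ g)).choose_spec.1, (hq (pushFunctional σ h)).choose_spec.1]
    simp [pushFunctional]
  map_smul' s h := hq.ext fun x ↦ by
    rw [LinearMap.smul_apply, (hq (pushFunctional σ (s • h))).choose_spec.1,
      (hq (pushFunctional σ h)).choose_spec.1]
    simp [pushFunctional]

@[simp] lemma IsUniv.dual_apply {q : M →ₛₗ[σ] N} (hq : IsUniv q) (h : M →ₗ[S] S) (x : M) :
    hq.dual h (q x) = σ (h x) :=
  (hq (pushFunctional σ h)).choose_spec.1 x

end BaseChange

section Projective

variable {S : Type*} [Ring S] {P N : Type*} [AddCommGroup P] [Module S P] [AddCommGroup N]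
  [Module S N]

/-- With `exists_retraction`, this turns projectivity into the problem of extending the identity of
`ker f` to `P`. -/
lemma projective_of_retraction [Module.Projective S P] {f : P →ₗ[S] N}
    (hf : Function.Surjective f) (r : P →ₗ[S] LinearMap.ker f)
    (hr : ∀ x : LinearMap.ker f, r x = x) : Module.Projective S N := by
  let g : P →ₗ[S] P := LinearMap.id - (LinearMap.ker f).subtype ∘ₗ r
  let s : N →ₗ[S] P := (LinearMap.ker f).liftQ g (fun x hx ↦ by
    simp [g, hr ⟨x, hx⟩]) ∘ₗ (f.quotKerEquivOfSurjective hf).symm.toLinearMap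
  refine Module.Projective.of_split s f (LinearMap.ext fun x ↦ ?_)
  obtain ⟨y, rfl⟩ := hf x
  have : (f.quotKerEquivOfSurjective hf).symm (f y) = Submodule.Quotient.mk y := by
    rw [LinearEquiv.symm_apply_eq]; rfl
  have h2 : f (r y : P) = 0 := (r y).2
  simp [s, this, g, h2]

lemma exists_retraction [Module.Projective S N] {f : P →ₗ[S] N} (hf : Function.Surjective f) :
    ∃ r : P →ₗ[S] LinearMap.ker f, ∀ x : LinearMap.ker f, r x = x := by
  obtain ⟨s, hs⟩ := Module.projective_lifting_property f LinearMap.id hf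
  have hs' : ∀ x, f (s x) = x := fun x ↦ LinearMap.congr_fun hs x
  refine ⟨LinearMap.codRestrict _ (LinearMap.id - s ∘ₗ f) fun x ↦ by simp [hs'], fun x ↦ ?_⟩
  ext
  have : f (x : P) = 0 := x.2
  simp [this]

end Projective

/-! ### Successive approximation -/

/-- Solve modulo `τ'` and repeat with the remainder `y`. Completeness `hC` sums the corrections, and
the remaining error, divisible by every power of `τ'`, vanishes by `hQ`. -/
lemma surjective_of_approximation {C Q : Type*} [AddCommGroup C] [AddCommGroup Q]
    (τ : AddMonoid.End C) (τ' : AddMonoid.End Q) (g : C →+ Q) (hg : ∀ c, g (τ c) = τ' (g c))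
    (hC : ∀ a : ℕ → C, ∃ c, ∀ n, ∃ c', c - ∑ i ∈ Finset.range n, (τ ^ i) (a i) = (τ ^ n) c')
    (hQ : ∀ x : Q, (∀ n : ℕ, ∃ y, x = (τ' ^ n) y) → x = 0)
    (h : ∀ x, ∃ c y, x = g c + τ' y) : Function.Surjective g := by
  intro x
  choose c y hcy using h
  let s : ℕ → Q := fun n ↦ y^[n] x
  have hpow : ∀ n z, g ((τ ^ n) z) = (τ' ^ n) (g z) := by
    intro n
    induction n with
    | zero => simp
    | succ n ih => 
      intro z
      rw [pow_succ, pow_succ]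
      exact (ih (τ z)).trans (congrArg (τ' ^ n) (hg z))
  have hs : ∀ n, x = g (∑ i ∈ Finset.range n, (τ ^ i) (c (s i))) + (τ' ^ n) (s n) := by
    intro n
    induction n with
    | zero => simp [s]
    | succ n ih =>
      have h1 : s (n + 1) = y (s n) := Function.iterate_succ_apply' _ _ _
      rw [Finset.sum_range_succ, map_add, hpow, h1, pow_succ, add_assoc]
      refine ih.trans (congrArg _ ?_)
      nth_rewrite 1 [hcy (s n)]
      exact map_add _ _ _
  obtain ⟨z, hz⟩ := hC fun i ↦ c (s i)
  refine ⟨z, sub_eq_zero.1 (hQ _ fun n ↦ ?_)⟩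
  obtain ⟨c', hc'⟩ := hz n
  refine ⟨g c' - s n, ?_⟩
  rw [map_sub, ← hpow, ← hc', map_sub]
  nth_rewrite 1 [hs n]
  abel

end AuslanderReg

end

noncomputable section

namespace AuslanderReg

/-! ### Complete deformations -/

universe v w

/-- `S` is complete and separated for the topology defined by a central element `t`, the map `p`
identifies `B` with `S / t S`, and the map `ι` identifies `E` with `S[1/t]`. -/
structure IsCompleteDeformation {S : Type u} {B : Type v} {E : Type w} [Ring S] [Ring B] [Ring E]
    (t : S) (p : S →+* B) (ι : S →+* E) : Prop where
  comm : ∀ s, t * s = s * t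
  p_surj : Function.Surjective p
  p_t : p t = 0
  p_ker : ∀ s, p s = 0 → ∃ s', s = t * s'
  ι_inj : Function.Injective ι
  ι_unit : IsUnit (ι t)
  ι_surj : ∀ e, ∃ (m : ℕ) (s : S), ι t ^ m * e = ι s
  sep : ∀ s : S, (∀ n : ℕ, ∃ s', s = t ^ n * s') → s = 0
  complete : ∀ a : ℕ → S, ∃ s, ∀ n, ∃ s', s - ∑ i ∈ Finset.range n, t ^ i * a i = t ^ n * s'

section Modules

variable {S : Type u} {B : Type v} {E : Type w} [Ring S] [Ring B] [Ring E]
  {t : S} {p : S →+* B} {ι : S →+* E} {M : Type u} {M' : Type v} {N : Type w}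
  [AddCommGroup M] [Module S M] [AddCommGroup M'] [Module B M'] [AddCommGroup N] [Module E N]

/-- `q` identifies `M'` with `M / t M`. -/
structure IsReduction (t : S) (q : M →ₛₗ[p] M') : Prop where
  surj : Function.Surjective q
  ker : ∀ x, q x = 0 → ∃ y, x = t • y

/-- `l` identifies `N` with `M[1/t]`, where `M` has no `t`-torsion. -/
structure IsLattice (t : S) (l : M →ₛₗ[ι] N) : Prop where
  inj : Function.Injective l
  surj : ∀ y, ∃ (m : ℕ) (x : M), ι t ^ m • y = l x

/-- `M` is separated for the topology defined by `t`. -/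
def IsSeparatedAt (t : S) (M : Type*) [AddCommGroup M] [Module S M] : Prop :=
  ∀ x : M, (∀ n : ℕ, ∃ y, x = t ^ n • y) → x = 0

namespace IsCompleteDeformation

variable (hD : IsCompleteDeformation t p ι)

include hD

lemma commute_map (e : E) : Commute (ι t) e := by
  obtain ⟨u, hu⟩ := hD.ι_unit
  obtain ⟨m, s, hs⟩ := hD.ι_surj e
  have h1 : Commute (ι t) (ι t ^ m * e) := by
    rw [hs, Commute, SemiconjBy, ← map_mul, hD.comm, map_mul]
  have h2 : e = ↑(u ^ m)⁻¹ * (ι t ^ m * e) := by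
    rw [← hu, ← mul_assoc, ← Units.val_pow_eq_pow_val, Units.inv_mul, one_mul]
  rw [h2]
  refine Commute.mul_right ?_ h1
  rw [← hu]
  exact (((Commute.refl u).pow_right m).inv_right).units_val

/-- Since `t` is central the notion is left-right symmetric, so statements about right modules are
those about left modules over the opposite rings. -/
lemma op : IsCompleteDeformation (MulOpposite.op t) (RingHom.op p) (RingHom.op ι) where
  comm s := MulOpposite.unop_injective (hD.comm s.unop).symm
  p_surj b := by
    obtain ⟨s, hs⟩ := hD.p_surj b.unop
    exact ⟨MulOpposite.op s, MulOpposite.unop_injective hs⟩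
  p_t := MulOpposite.unop_injective hD.p_t
  p_ker s hs := by
    obtain ⟨s', h⟩ := hD.p_ker s.unop (MulOpposite.op_injective hs)
    exact ⟨MulOpposite.op s', MulOpposite.unop_injective (h.trans (hD.comm _))⟩
  ι_inj s s' h := MulOpposite.unop_injective (hD.ι_inj (MulOpposite.op_injective h))
  ι_unit := hD.ι_unit.op
  ι_surj e := by
    obtain ⟨m, s, hs⟩ := hD.ι_surj e.unop
    refine ⟨m, MulOpposite.op s, MulOpposite.unop_injective ?_⟩
    change e.unop * ι t ^ m = ι s
    rw [← hs, ((hD.commute_map e.unop).pow_left m).eq]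
  sep s hs := MulOpposite.unop_injective (hD.sep s.unop fun n ↦ by
    obtain ⟨s', h⟩ := hs n
    refine ⟨s'.unop, ?_⟩
    rw [h, MulOpposite.unop_mul, MulOpposite.unop_pow, MulOpposite.unop_op]
    exact (Commute.pow_left (hD.comm _) n).eq.symm)
  complete a := by
    obtain ⟨s, hs⟩ := hD.complete fun n ↦ (a n).unop
    refine ⟨MulOpposite.op s, fun n ↦ ?_⟩
    obtain ⟨s', h⟩ := hs n
    refine ⟨MulOpposite.op s', MulOpposite.unop_injective ?_⟩
    have h1 : ∀ x : S, ∀ m : ℕ, x * t ^ m = t ^ m * x := fun x m ↦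
      (Commute.pow_left (hD.comm x) m).eq.symm
    simpa [Finset.unop_sum, h1] using h

lemma smul_comm (s : S) (x : M) : t • s • x = s • t • x := by
  rw [smul_smul, smul_smul, hD.comm]

lemma torsionFree {l : M →ₛₗ[ι] N} (hl : IsLattice t l) {x : M} (hx : t • x = 0) : x = 0 := by
  apply hl.inj
  rw [map_zero, ← hD.ι_unit.smul_eq_zero, ← map_smulₛₗ, hx, map_zero]

lemma smul_left_injective {l : M →ₛₗ[ι] N} (hl : IsLattice t l) {x y : M}
    (h : t • x = t • y) : x = y :=
  sub_eq_zero.1 (hD.torsionFree hl (by rw [smul_sub, h, sub_self]))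

lemma isLattice_self : IsLattice t ι.toSemilinearMap := ⟨hD.ι_inj, hD.ι_surj⟩

lemma isReduction_self : IsReduction t p.toSemilinearMap := ⟨hD.p_surj, hD.p_ker⟩

lemma isSeparatedAt_pi (κ : Type*) : IsSeparatedAt t (κ → S) := fun x hx ↦ by
  ext i
  refine hD.sep _ fun n ↦ ?_
  obtain ⟨y, rfl⟩ := hx n
  exact ⟨y i, rfl⟩

lemma complete_pi (κ : Type*) (a : ℕ → κ → S) : ∃ s : κ → S, ∀ n, ∃ s' : κ → S,
    s - ∑ i ∈ Finset.range n, t ^ i • a i = t ^ n • s' := by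
  choose s hs using fun j ↦ hD.complete fun i ↦ a i j
  refine ⟨s, fun n ↦ ?_⟩
  choose s' hs' using fun j ↦ hs j n
  refine ⟨s', funext fun j ↦ ?_⟩
  simpa using hs' j

end IsCompleteDeformation

lemma IsSeparatedAt.of_injective {M M' : Type*} [AddCommGroup M] [Module S M] [AddCommGroup M']
    [Module S M'] (h : IsSeparatedAt t M') (f : M →ₗ[S] M') (hf : Function.Injective f) :
    IsSeparatedAt t M := fun x hx ↦ hf (by
  rw [map_zero]
  refine h _ fun n ↦ ?_
  obtain ⟨y, rfl⟩ := hx n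
  exact ⟨f y, map_smul _ _ _⟩)

/-- Multiplication by a ring element, as an additive endomorphism. -/
def smulEnd (t : S) (M : Type*) [AddCommGroup M] [Module S M] : AddMonoid.End M :=
  DistribSMul.toAddMonoidHom M t

lemma smulEnd_apply {M : Type*} [AddCommGroup M] [Module S M] (x : M) :
    smulEnd t M x = t • x := rfl

lemma smulEnd_pow_apply {M : Type*} [AddCommGroup M] [Module S M] (n : ℕ) (x : M) :
    (smulEnd t M ^ n) x = t ^ n • x := by
  induction n with
  | zero => simp
  | succ n ih =>
    rw [pow_succ', pow_succ', mul_smul, ← ih]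
    rfl

namespace IsReduction

variable (hD : IsCompleteDeformation t p ι) {q : M →ₛₗ[p] M'} (hq : IsReduction t q)

include hD hq

lemma eq_of_eq {N' : Type*} [AddCommGroup N'] [Module B N'] (ψ : M →ₛₗ[p] N') {x y : M}
    (h : q x = q y) : ψ x = ψ y := by
  obtain ⟨z, hz⟩ := hq.ker (x - y) (by rw [map_sub, h, sub_self])
  rw [← sub_eq_zero, ← map_sub, hz, map_smulₛₗ, hD.p_t, zero_smul]

lemma exists_lift {N' : Type*} [AddCommGroup N'] [Module B N'] (ψ : M →ₛₗ[p] N') :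
    ∃ ψ' : M' →ₗ[B] N', ∀ x, ψ' (q x) = ψ x := by
  have hr := Function.surjInv_eq hq.surj
  refine ⟨{ toFun := fun y ↦ ψ (Function.surjInv hq.surj y), map_add' := fun x y ↦ ?_,
            map_smul' := fun b x ↦ ?_ }, fun x ↦ hq.eq_of_eq hD ψ (hr _)⟩
  · rw [← map_add]
    exact hq.eq_of_eq hD ψ (by rw [map_add, hr, hr, hr])
  · obtain ⟨s, rfl⟩ := hD.p_surj b
    rw [RingHom.id_apply, ← map_smulₛₗ]
    exact hq.eq_of_eq hD ψ (by rw [map_smulₛₗ, hr, hr])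

lemma isUniv : IsUniv q := fun ψ ↦ by
  obtain ⟨ψ', h⟩ := hq.exists_lift hD ψ
  refine ⟨ψ', h, fun φ hφ ↦ LinearMap.ext fun y ↦ ?_⟩
  obtain ⟨x, rfl⟩ := hq.surj y
  rw [h, hφ]

/-- A separated module is finitely generated if its reduction is. -/
lemma finite_of_finite (hM : IsSeparatedAt t M) [Module.Finite B M'] : Module.Finite S M := by
  obtain ⟨n, g, hg⟩ := Module.Finite.exists_fin' B M'
  choose w hw using fun i ↦ hq.surj (g (Pi.single i 1))
  let k : (Fin n → S) →ₗ[S] M := Fintype.linearCombination S w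
  have hk : ∀ x, q (k x) = g (coordMap p _ x) := fun x ↦ by
    have h1 : ∀ i, k (Pi.single i 1) = w i := fun i ↦ by simp [k]
    rw [← baseMap_coordMap q k x]
    refine LinearMap.congr_fun (LinearMap.pi_ext' fun i ↦ LinearMap.ext_ring ?_) _
    simp [baseMap_single, h1, hw]
  -- Lifts of generators of `M'` generate `M`: completeness is used only in `S ^ n`, separatedness
  -- only in `M`.
  refine Module.Finite.of_surjective k (surjective_of_approximation
    (smulEnd t _) (smulEnd t _) k.toAddMonoidHom
    (fun c ↦ map_smul k t c) (fun a ↦ ?_) (fun x hx ↦ hM x ?_) fun x ↦ ?_)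
  · simpa [smulEnd_pow_apply] using hD.complete_pi (Fin n) a
  · simpa [smulEnd_pow_apply] using hx
  · obtain ⟨b, hb⟩ := hg (q x)
    obtain ⟨c, rfl⟩ : ∃ c, coordMap p _ c = b := by
      choose c hc using fun i ↦ hD.p_surj (b i)
      exact ⟨c, funext hc⟩
    obtain ⟨y, hy⟩ := hq.ker (x - k c) (by rw [map_sub, hk, hb, sub_self])
    exact ⟨c, y, by rw [smulEnd_apply, ← hy]; exact (add_sub_cancel _ _).symm⟩

end IsReduction

namespace IsLattice

variable (hD : IsCompleteDeformation t p ι) {l : M →ₛₗ[ι] N} (hl : IsLattice t l)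

include hD

lemma pow_smul_injective {N : Type*} [AddCommGroup N] [Module E N] (m : ℕ) {x y : N}
    (h : ι t ^ m • x = ι t ^ m • y) : x = y := (hD.ι_unit.pow m).smul_left_cancel.1 h

/-- Functionals on the localization are, up to a power of `t`, integral on a lattice. -/
lemma exists_integral [Module.Finite S M] (l : M →ₛₗ[ι] N) (g : N →ₗ[E] E) :
    ∃ (m : ℕ) (h : M →ₗ[S] S), ∀ x, ι t ^ m * g (l x) = ι (h x) := by
  have hc : ∀ (n : ℕ) (s : S), ι s * ι t ^ n = ι t ^ n * ι s := fun n s ↦ by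
    rw [← map_pow, ← map_mul, ← map_mul, (Commute.pow_left (hD.comm s) n).eq]
  obtain ⟨n, f, hf⟩ := Module.Finite.exists_fin' S M
  choose m s hs using fun i ↦ hD.ι_surj (g (l (f (Pi.single i 1))))
  -- The sum of the exponents is a common denominator for the values of `g` on the generators.
  have key : ∀ x, ∃ y, ι t ^ (∑ i, m i) * g (l x) = ι y := by
    intro x
    obtain ⟨c, rfl⟩ := hf x
    rw [← baseMap_coordMap l f c, baseMap, Fintype.linearCombination_apply, map_sum,
      Finset.mul_sum]
    have : ∀ i, ∃ y, ι t ^ (∑ i, m i) * g (coordMap ι (Fin n) c i • l (f (Pi.single i 1))) =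
        ι y := fun i ↦ by
      refine ⟨c i * (t ^ (∑ j ∈ Finset.univ.erase i, m j) * s i), ?_⟩
      rw [map_smul, coordMap_apply, smul_eq_mul, ← mul_assoc, ← hc, mul_assoc,
        ← Finset.sum_erase_add _ _ (Finset.mem_univ i), pow_add, mul_assoc, hs, map_mul, map_mul,
        map_pow]
    choose y hy using this
    exact ⟨∑ i, y i, by rw [map_sum]; exact Finset.sum_congr rfl fun i _ ↦ hy i⟩
  choose y hy using key
  refine ⟨∑ i, m i, { toFun := y, map_add' := fun a b ↦ hD.ι_inj ?_,
                      map_smul' := fun c a ↦ hD.ι_inj ?_ }, hy⟩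
  · rw [← hy, map_add, map_add, map_add, mul_add, hy, hy]
  · rw [← hy, map_smulₛₗ, map_smul, RingHom.id_apply, smul_eq_mul, smul_eq_mul, map_mul, ← hy,
      ← mul_assoc, ← mul_assoc, hc]

include hl

lemma hom_ext {N' : Type*} [AddCommGroup N'] [Module E N'] {g h : N →ₗ[E] N'}
    (H : ∀ x, g (l x) = h (l x)) : g = h := LinearMap.ext fun y ↦ by
  obtain ⟨m, x, hx⟩ := hl.surj y
  exact pow_smul_injective hD m (by rw [← map_smul, ← map_smul, hx, H])

lemma exists_lift {N' : Type*} [AddCommGroup N'] [Module E N'] (ψ : M →ₛₗ[ι] N') :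
    ∃ ψ' : N →ₗ[E] N', ∀ x, ψ' (l x) = ψ x := by
  choose m x hx using hl.surj
  obtain ⟨u, hu⟩ := hD.ι_unit
  -- The prospective value `t ^ (-k) ψ z` at `y` does not depend on the representation `t ^ k y = l
  -- z`.
  have key : ∀ y k z, ι t ^ k • y = l z →
      (↑(u ^ m y)⁻¹ : E) • ψ (x y) = (↑(u ^ k)⁻¹ : E) • ψ z := by
    intro y k z hz
    have h1 : t ^ k • x y = t ^ m y • z := hl.inj (by
      rw [map_smulₛₗ, map_smulₛₗ, ← hx, ← hz, map_pow, map_pow, smul_smul, smul_smul, ← pow_add,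
        ← pow_add, add_comm])
    have h2 := congrArg ψ h1
    rw [map_smulₛₗ, map_smulₛₗ, map_pow, map_pow, ← hu, ← Units.val_pow_eq_pow_val,
      ← Units.val_pow_eq_pow_val] at h2
    have h3 : ψ z = (↑(u ^ m y)⁻¹ : E) • (↑(u ^ k) : E) • ψ (x y) := by
      rw [h2, smul_smul, Units.inv_mul, one_smul]
    rw [h3, smul_smul, smul_smul, ← Units.val_mul, ← Units.val_mul]
    congr 2
    rw [← zpow_natCast, ← zpow_natCast, ← zpow_neg, ← zpow_neg, ← zpow_add, ← zpow_add]
    congr 1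
    ring
  have hdef : ∀ y k z, ι t ^ k • y = l z →
      ι t ^ k • ((↑(u ^ m y)⁻¹ : E) • ψ (x y)) = ψ z := by
    intro y k z hz
    rw [key y k z hz, ← hu, smul_smul, ← Units.val_pow_eq_pow_val, Units.mul_inv, one_smul]
  refine ⟨{ toFun := fun y ↦ (↑(u ^ m y)⁻¹ : E) • ψ (x y), map_add' := fun y z ↦ ?_,
            map_smul' := fun e y ↦ ?_ }, fun z ↦ ?_⟩
  · refine pow_smul_injective hD (m y + m z) ?_
    have hy : ι t ^ (m y + m z) • y = l (t ^ m z • x y) := by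
      rw [map_smulₛₗ, ← hx, map_pow, smul_smul, ← pow_add, add_comm]
    have hz : ι t ^ (m y + m z) • z = l (t ^ m y • x z) := by
      rw [map_smulₛₗ, ← hx, map_pow, smul_smul, ← pow_add]
    rw [smul_add, hdef _ _ _ hy, hdef _ _ _ hz, hdef (y + z) _ (t ^ m z • x y + t ^ m y • x z)
      (by rw [smul_add, hy, hz, map_add]), map_add]
  · obtain ⟨k, s, hs⟩ := hD.ι_surj e
    refine pow_smul_injective hD (k + m y) ?_
    have hc : ∀ n : ℕ, ι s * ι t ^ n = ι t ^ n * ι s := fun n ↦ by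
      rw [← map_pow, ← map_mul, ← map_mul, (Commute.pow_left (hD.comm s) n).eq]
    have he : ι t ^ (k + m y) * e = ι s * ι t ^ m y := by
      rw [hc, ← hs, add_comm, pow_add, mul_assoc]
    have h1 : ι t ^ (k + m y) • e • y = l (s • x y) := by
      rw [smul_smul, he, map_smulₛₗ, ← hx, smul_smul]
    rw [hdef _ _ _ h1, RingHom.id_apply, smul_smul, he, mul_smul, hdef _ _ _ (hx y), map_smulₛₗ]
  · simpa using hdef (l z) 0 z (by simp)

lemma isUniv : IsUniv l := fun ψ ↦ by
  obtain ⟨ψ', h⟩ := hl.exists_lift hD ψ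
  exact ⟨ψ', h, fun φ hφ ↦ hl.hom_ext hD fun x ↦ by rw [h, hφ]⟩

end IsLattice

end Modules

end AuslanderReg

end

/-! ### Lifting vanishing of `Ext`, projective dimension and noetherianity from `S / t S` to
`S[1/t]` -/

noncomputable section

namespace AuslanderReg

universe v w

namespace IsCompleteDeformation

variable {S : Type u} {B : Type v} {E : Type w} [Ring S] [Ring B] [Ring E]
  {t : S} {p : S →+* B} {ι : S →+* E} {M : Type u} {M' : Type v} {N : Type w}
  [AddCommGroup M] [Module S M] [AddCommGroup M'] [Module B M'] [AddCommGroup N] [Module E N]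
  (hD : IsCompleteDeformation t p ι) {q : M →ₛₗ[p] M'} {l : M →ₛₗ[ι] N}

section Syzygy

variable {n : ℕ} {f : (Fin n → S) →ₗ[S] M}

include hD

lemma coordMap_surjective (κ : Type*) : Function.Surjective (coordMap p κ) := fun b ↦ by
  choose c hc using fun i ↦ hD.p_surj (b i)
  exact ⟨c, funext hc⟩

lemma isLattice_coordMap (κ : Type) [Finite κ] : IsLattice t (coordMap ι κ) where
  inj x y h := funext fun i ↦ hD.ι_inj (congrFun h i)
  surj y := by
    have := Fintype.ofFinite κ
    choose m s hs using fun i ↦ hD.ι_surj (y i)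
    have : ∀ i, ∃ x, ι t ^ (∑ i, m i) * y i = ι x := fun i ↦ by
      classical
      rw [← Finset.sum_erase_add _ _ (Finset.mem_univ i), pow_add, mul_assoc, hs, ← map_pow,
        ← map_mul]
      exact ⟨_, rfl⟩
    choose x hx using this
    exact ⟨∑ i, m i, x, funext hx⟩

omit hD [Ring E] in
lemma baseMap_surjective_of_isReduction (hq : IsReduction t q) (hf : Function.Surjective f) :
    Function.Surjective (baseMap q f) := fun y ↦ by
  obtain ⟨x, rfl⟩ := hq.surj y
  obtain ⟨c, rfl⟩ := hf x
  exact ⟨_, baseMap_coordMap q f c⟩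

lemma baseMap_surjective_of_isLattice (hl : IsLattice t l) (hf : Function.Surjective f) :
    Function.Surjective (baseMap l f) := fun y ↦ by
  obtain ⟨m, x, hx⟩ := hl.surj y
  obtain ⟨c, rfl⟩ := hf x
  obtain ⟨u, hu⟩ := hD.ι_unit
  refine ⟨(↑(u ^ m)⁻¹ : E) • coordMap ι _ c, ?_⟩
  rw [map_smul, baseMap_coordMap, ← hx, smul_smul, ← hu, ← Units.val_pow_eq_pow_val,
    Units.inv_mul, one_smul]

/-- As `M` has no `t`-torsion, `ker f → S ^ n → M` stays exact modulo `t`. A lift of `y` is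
corrected by `t • w`, and an element of `ker f` divisible by `t` in `S ^ n` is so in `ker f`. -/
lemma kerMap_isReduction (hq : IsReduction t q) (hl : IsLattice t l)
    (hf : Function.Surjective f) : IsReduction t (kerMap q f) where
  surj y := by
    obtain ⟨x, hx⟩ := hD.coordMap_surjective (Fin n) y
    obtain ⟨z, hz⟩ := hq.ker (f x) (by rw [← baseMap_coordMap, hx, y.2])
    obtain ⟨w, rfl⟩ := hf z
    refine ⟨⟨x - t • w, by rw [LinearMap.mem_ker, map_sub, hz, map_smul, sub_self]⟩, ?_⟩
    ext1
    rw [kerMap_coe, map_sub, hx, map_smulₛₗ, hD.p_t, zero_smul, sub_zero]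
  ker x hx := by
    have h1 : ∀ i, p ((x : Fin n → S) i) = 0 := fun i ↦ congrFun (congrArg Subtype.val hx) i
    choose y hy using fun i ↦ hD.p_ker _ (h1 i)
    have hxy : (x : Fin n → S) = t • y := funext hy
    refine ⟨⟨y, hD.torsionFree hl ?_⟩, Subtype.ext hxy⟩
    rw [← map_smul, ← hxy, x.2]

lemma kerMap_isLattice (hl : IsLattice t l) : IsLattice t (kerMap l f) where
  inj x y h := Subtype.ext ((hD.isLattice_coordMap (Fin n)).inj (congrArg Subtype.val h))
  surj y := by
    obtain ⟨m, x, hx⟩ := (hD.isLattice_coordMap (Fin n)).surj y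
    refine ⟨m, ⟨x, hl.inj ?_⟩, Subtype.ext hx⟩
    rw [← baseMap_coordMap, ← hx, map_smul, y.2, smul_zero, map_zero]

lemma isSeparatedAt_ker : IsSeparatedAt t (LinearMap.ker f) :=
  (hD.isSeparatedAt_pi (Fin n)).of_injective _ (LinearMap.ker f).injective_subtype

/-- No noetherian hypothesis on `S` is needed: the kernel is separated and its reduction is a
submodule of the noetherian module `B ^ n`. -/
lemma finite_ker [IsNoetherianRing B] (hq : IsReduction t q) (hl : IsLattice t l)
    (hf : Function.Surjective f) : Module.Finite S (LinearMap.ker f) :=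
  (hD.kerMap_isReduction hq hl hf).finite_of_finite hD hD.isSeparatedAt_ker

/-- Extension problems over `S` can be solved modulo `t`. -/
lemma exists_extension {X : Type u} {X' : Type v} {Y : Type w} [AddCommGroup X] [Module S X]
    [AddCommGroup X'] [Module B X'] [AddCommGroup Y] [Module E Y] [Module.Finite S X]
    {qX : X →ₛₗ[p] X'} {lX : X →ₛₗ[ι] Y} (hqX : IsReduction t qX) (hlX : IsLattice t lX)
    (hX : IsSeparatedAt t X) (hq : IsReduction t q) (hl : IsLattice t l)
    (hf : Function.Surjective f)
    (hext : ∀ g : LinearMap.ker (baseMap q f) →ₗ[B] X',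
      ∃ h : (Fin n → B) →ₗ[B] X', ∀ x : LinearMap.ker (baseMap q f), h x = g x)
    (φ : LinearMap.ker f →ₗ[S] X) :
    ∃ h : (Fin n → S) →ₗ[S] X, ∀ x : LinearMap.ker f, h x = φ x := by
  obtain ⟨m, g, hg⟩ := Module.Finite.exists_fin' S X
  let τ' : AddMonoid.End (LinearMap.ker f →ₗ[S] X) :=
    { toFun := fun h ↦
        { toFun := fun x ↦ t • h x
          map_add' := fun x y ↦ by simp
          map_smul' := fun s x ↦ by simp [hD.smul_comm s] }
      map_zero' := by ext; simp
      map_add' := fun h h' ↦ by ext; simp }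
  have hτ' : ∀ k h x, (τ' ^ k) h x = t ^ k • h x := by
    intro k
    induction k with
    | zero => simp
    | succ k ih =>
      intro h x
      rw [pow_succ, pow_succ, mul_smul]
      exact ih (τ' h) x
  -- Maps `S ^ n → X` are parametrised by matrices over `S` through `g`, because completeness is
  -- available for `S` but not for `X`.
  let ext : (Fin n → Fin m → S) → (Fin n → S) →ₗ[S] X := fun c ↦
    Fintype.linearCombination S fun i ↦ g (c i)
  let k : (Fin n → Fin m → S) →+ (LinearMap.ker f →ₗ[S] X) :=
    { toFun := fun c ↦ ext c ∘ₗ (LinearMap.ker f).subtype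
      map_zero' := by ext x; simp [ext, Fintype.linearCombination_apply]
      map_add' := fun c d ↦ by
        ext x; simp [ext, Fintype.linearCombination_apply, Finset.sum_add_distrib] }
  suffices hk : Function.Surjective k by
    obtain ⟨c, hc⟩ := hk φ
    exact ⟨ext c, fun x ↦ LinearMap.congr_fun hc x⟩
  refine surjective_of_approximation (smulEnd t _) τ' k (fun c ↦ ?_) (fun a ↦ ?_) (fun x hx ↦ ?_)
    fun h ↦ ?_
  · ext x
    change ext (t • c) x = t • ext c x
    simp [ext, Fintype.linearCombination_apply, Finset.smul_sum, hD.smul_comm _ (g _)]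
  · have := hD.complete_pi (Fin n × Fin m) fun i x ↦ a i x.1 x.2
    obtain ⟨s, hs⟩ := this
    refine ⟨fun i j ↦ s (i, j), fun r ↦ ?_⟩
    obtain ⟨s', hs'⟩ := hs r
    refine ⟨fun i j ↦ s' (i, j), ?_⟩
    ext i j
    simpa [smulEnd_pow_apply] using congrFun hs' (i, j)
  · ext y
    refine hX _ fun r ↦ ?_
    obtain ⟨z, hz⟩ := hx r
    exact ⟨z y, by rw [hz, hτ']⟩
  -- Extend the reduction of `h` over `B` and lift the extension to `ext c`. The error on `ker f` is
  -- divisible by `t`, and the quotient `y` is linear because `X` has no `t`-torsion.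
  · obtain ⟨h', hh'⟩ := (hD.kerMap_isReduction hq hl hf).exists_lift hD (qX.comp h)
    obtain ⟨e, he⟩ := hext h'
    choose d hd using fun i ↦ hqX.surj (e (Pi.single i 1))
    choose c hc using fun i ↦ hg (d i)
    have h1 : ∀ x, qX (ext c x) = e (coordMap p _ x) := fun x ↦ by
      have h1 : ∀ i, ext c (Pi.single i 1) = d i := fun i ↦ by simp [ext, hc]
      rw [← baseMap_coordMap qX (ext c) x]
      refine LinearMap.congr_fun (LinearMap.pi_ext' fun i ↦ LinearMap.ext_ring ?_) _
      simp [baseMap_single, h1, hd]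
    have h2 : ∀ x, ∃ y, h x - ext c x = t • y := fun x ↦ hqX.ker _ (by
      rw [map_sub, h1, ← kerMap_coe q f x, he, hh']
      simp)
    choose y hy using h2
    refine ⟨c, { toFun := y, map_add' := fun x z ↦ ?_, map_smul' := fun s x ↦ ?_ },
      LinearMap.ext fun x ↦ ?_⟩
    · refine hD.smul_left_injective hlX ?_
      rw [smul_add, ← hy, ← hy, ← hy]
      simp only [map_add, Submodule.coe_add]
      abel
    · refine hD.smul_left_injective hlX ?_
      rw [RingHom.id_apply, hD.smul_comm, ← hy, ← hy]
      simp only [map_smul, Submodule.coe_smul, smul_sub]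
    · change h x = ext c x + t • y x
      rw [← hy, add_sub_cancel]

end Syzygy

include hD

/-- In degree `0`, a functional on `M` is zero modulo `t`, so it is `t` times a functional;
iterating, its values are infinitely divisible and vanish. In degree `1`, an integral multiple of
the functional on the syzygy is extended by `exists_extension`. Higher degrees shift to the syzygy,
which again has a reduction and a localization. -/
lemma extVanishes_of_reduction [IsNoetherianRing B] [Module.Finite S M] (hq : IsReduction t q)
    (hl : IsLattice t l) (j : ℕ) (h : ExtVanishes B M' j) : ExtVanishes E N j := by
  have hinj : ∀ (m : ℕ) {x y : E}, ι t ^ m * x = ι t ^ m * y → x = y := fun m x y h ↦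
    (hD.ι_unit.pow m).mul_left_cancel h
  induction j generalizing M M' N with
  | zero =>
    rw [extVanishes_zero_iff] at h ⊢
    intro g
    obtain ⟨m, k, hk⟩ := IsLattice.exists_integral hD l g
    have key : ∀ (r : ℕ) (k : M →ₗ[S] S), ∀ x, ∃ s, k x = t ^ r * s := by
      intro r
      induction r with
      | zero => exact fun k x ↦ ⟨k x, by simp⟩
      | succ r ih =>
        intro k x
        have h0 : ∀ x, p (k x) = 0 := fun x ↦ by
          rw [← (hq.isUniv hD).dual_apply, h ((hq.isUniv hD).dual k), LinearMap.zero_apply]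
        choose y hy using fun x ↦ hD.p_ker _ (h0 x)
        have hreg : ∀ {a b : S}, t * a = t * b → a = b := fun {a b} hab ↦
          hD.smul_left_injective hD.isLattice_self hab
        obtain ⟨s, hs⟩ := ih { toFun := y
                               map_add' := fun a b ↦ hreg (by
                                 rw [mul_add, ← hy, ← hy, ← hy, map_add])
                               map_smul' := fun c a ↦ hreg (by
                                rw [← hy, map_smul, smul_eq_mul, RingHom.id_apply, smul_eq_mul,
                                  ← mul_assoc, hD.comm, mul_assoc, ← hy]) } x
        refine ⟨s, (hy x).trans ?_⟩
        rw [pow_succ', mul_assoc]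
        exact congrArg _ hs
    refine hl.hom_ext hD fun x ↦ hinj m ?_
    rw [hk, hD.sep (k x) fun r ↦ key r k x]
    simp
  | succ j ih =>
    obtain ⟨n, f, hf⟩ := Module.Finite.exists_fin' S M
    have hf' := baseMap_surjective_of_isReduction hq hf
    have hf'' := hD.baseMap_surjective_of_isLattice hl hf
    have := hD.finite_ker hq hl hf
    have hq' := hD.kerMap_isReduction hq hl hf
    have hl' := hD.kerMap_isLattice (f := f) hl
    cases j with
    | zero =>
      rw [zero_add, extVanishes_one_iff hf''] at *
      rw [extVanishes_one_iff hf'] at h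
      intro g
      obtain ⟨m, k, hk⟩ := IsLattice.exists_integral hD (kerMap l f) g
      obtain ⟨e, he⟩ := hD.exists_extension hD.isReduction_self hD.isLattice_self hD.sep hq hl hf
        h k
      obtain ⟨u, hu⟩ := hD.ι_unit
      -- `e` extends the integral multiple `t ^ m g`; dividing by the unit `ι t ^ m` gives an
      -- extension of `g`.
      let e' : (Fin n → E) →ₗ[E] E := Fintype.linearCombination E fun i ↦
        ↑(u ^ m)⁻¹ * ι (e (Pi.single i 1))
      have hc : ∀ s, ι s * ↑(u ^ m)⁻¹ = ↑(u ^ m)⁻¹ * ι s := fun s ↦ by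
        rw [Units.mul_inv_eq_iff_eq_mul, mul_assoc, Units.eq_inv_mul_iff_mul_eq,
          Units.val_pow_eq_pow_val, hu, ← map_pow, ← map_mul, ← map_mul,
          (Commute.pow_left (hD.comm s) m).eq]
      have he' : ∀ x, e' (coordMap ι _ x) = ↑(u ^ m)⁻¹ * ι (e x) := fun x ↦ by
        rw [LinearMap.pi_apply_eq_sum_univ e x, map_sum, Finset.mul_sum,
          Fintype.linearCombination_apply]
        refine Finset.sum_congr rfl fun i _ ↦ ?_
        have : (fun j ↦ if i = j then (1 : S) else 0) = Pi.single i 1 := by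
          ext j; simp [Pi.single_apply, eq_comm]
        rw [this, smul_eq_mul, smul_eq_mul, map_mul, coordMap_apply, ← mul_assoc, hc, mul_assoc]
      refine ⟨e', fun y ↦ ?_⟩
      refine LinearMap.congr_fun (f := e' ∘ₗ (LinearMap.ker (baseMap l f)).subtype) (g := g)
        (hl'.hom_ext hD fun x ↦ hinj m ?_) y
      rw [hk, LinearMap.comp_apply, Submodule.subtype_apply, kerMap_coe, he', he, ← mul_assoc,
        ← hu, ← Units.val_pow_eq_pow_val, Units.mul_inv, one_mul]
    | succ j =>
      rw [extVanishes_add_two_iff hf'']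
      rw [extVanishes_add_two_iff hf'] at h
      exact ih hq' hl' h

/-- If `M'` is projective, a retraction onto its syzygy extends the reduction of any map on `ker f`.
Hence the identity of `ker f` extends over `S`, and inverting `t` splits the presentation of `N`. -/
lemma hasProjectiveDimensionLT_of_reduction [IsNoetherianRing B] [Module.Finite S M]
    (hq : IsReduction t q) (hl : IsLattice t l) (d : ℕ)
    (h : HasProjectiveDimensionLT (ModuleCat.of B M') (d + 1)) :
    HasProjectiveDimensionLT (ModuleCat.of E N) (d + 1) := by
  induction d generalizing M M' N with
  | zero =>
    rw [zero_add, hasProjectiveDimensionLT_one_iff] at *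
    obtain ⟨n, f, hf⟩ := Module.Finite.exists_fin' S M
    have hf' := baseMap_surjective_of_isReduction hq hf
    have hf'' := hD.baseMap_surjective_of_isLattice hl hf
    have := hD.finite_ker hq hl hf
    have hl' := hD.kerMap_isLattice (f := f) hl
    obtain ⟨r, hr⟩ := exists_retraction hf'
    obtain ⟨e, he⟩ := hD.exists_extension (hD.kerMap_isReduction hq hl hf) hl'
      hD.isSeparatedAt_ker hq hl hf (fun g ↦ ⟨g ∘ₗ r, fun x ↦ by simp [hr]⟩) LinearMap.id
    refine projective_of_retraction hf'' (baseMap (kerMap l f) e) fun y ↦ ?_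
    refine LinearMap.congr_fun (f := baseMap (kerMap l f) e ∘ₗ
      (LinearMap.ker (baseMap l f)).subtype) (g := LinearMap.id) (hl'.hom_ext hD fun x ↦ ?_) y
    rw [LinearMap.comp_apply, Submodule.subtype_apply, kerMap_coe, baseMap_coordMap, he]
    rfl
  | succ d ih =>
    obtain ⟨n, f, hf⟩ := Module.Finite.exists_fin' S M
    have hf' := baseMap_surjective_of_isReduction hq hf
    have hf'' := hD.baseMap_surjective_of_isLattice hl hf
    have := hD.finite_ker hq hl hf
    have hq' := hD.kerMap_isReduction hq hl hf
    have hl' := hD.kerMap_isLattice (f := f) hl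
    rw [hasProjectiveDimensionLT_add_two_iff hf'']
    rw [hasProjectiveDimensionLT_add_two_iff hf'] at h
    exact ih hq' hl' h

omit hD in
-- The module `M / t M` is realised as a quotient of `B ^ n`, which puts it in the universe of `B`.
lemma exists_reduction (t : S) (p : S →+* B) (hp : Function.Surjective p)
    (hker : ∀ s, p s = 0 → ∃ s', s = t * s')
    (M : Type u) [AddCommGroup M] [Module S M] [Module.Finite S M] :
    ∃ (M' : Type v) (_ : AddCommGroup M') (_ : Module B M') (q : M →ₛₗ[p] M'),
      IsReduction t q ∧ Module.Finite B M' := by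
  obtain ⟨n, f, hf⟩ := Module.Finite.exists_fin' S M
  have : RingHomSurjective p := ⟨hp⟩
  let K : Submodule B (Fin n → B) := (LinearMap.ker f).map (coordMap p (Fin n))
  let k : (Fin n → S) →ₛₗ[p] ((Fin n → B) ⧸ K) := K.mkQ.comp (coordMap p (Fin n))
  have hk : ∀ x, k x = 0 → ∃ y, f x = t • y := fun x hx ↦ by
    obtain ⟨z, hz, hzx⟩ := (Submodule.Quotient.mk_eq_zero _).1 hx
    have h1 : ∀ i, p ((x - z) i) = 0 := fun i ↦ by
      rw [Pi.sub_apply, map_sub, ← coordMap_apply, ← coordMap_apply, hzx, sub_self]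
    choose y hy using fun i ↦ hker _ (h1 i)
    have hy' : x - z = t • y := funext hy
    refine ⟨f y, ?_⟩
    rw [← map_smul, ← hy', map_sub, LinearMap.mem_ker.1 hz, sub_zero]
  let e : M ≃ₗ[S] (Fin n → S) ⧸ LinearMap.ker f := (f.quotKerEquivOfSurjective hf).symm
  let q' : (Fin n → S) ⧸ LinearMap.ker f →ₛₗ[p] ((Fin n → B) ⧸ K) :=
    (LinearMap.ker f).liftQ k fun x hx ↦
      (Submodule.Quotient.mk_eq_zero _).2 (Submodule.mem_map_of_mem hx)
  refine ⟨(Fin n → B) ⧸ K, inferInstance, inferInstance, q'.comp e.toLinearMap, ⟨fun y ↦ ?_,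
    fun x hx ↦ ?_⟩, inferInstance⟩
  · obtain ⟨b, rfl⟩ := K.mkQ_surjective y
    choose c hc using fun i ↦ hp (b i)
    refine ⟨f c, ?_⟩
    have h1 : e (f c) = Submodule.Quotient.mk c := by
      rw [LinearEquiv.symm_apply_eq]; rfl
    have h2 : coordMap p _ c = b := funext hc
    change q' (e (f c)) = _
    rw [h1, ← h2]
    rfl
  · obtain ⟨c, rfl⟩ := hf x
    have h1 : e (f c) = Submodule.Quotient.mk c := by
      rw [LinearEquiv.symm_apply_eq]; rfl
    exact hk c (by
      change q' (e (f c)) = 0 at hx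
      rw [h1] at hx
      exact hx)

/-- Finitely generated modules over `E` have lattices. -/
lemma exists_lattice (N : Type w) [AddCommGroup N] [Module E N] [Module.Finite E N] :
    ∃ (n : ℕ) (K : Submodule S (Fin n → S)) (l : ((Fin n → S) ⧸ K) →ₛₗ[ι] N),
      IsLattice t l := by
  obtain ⟨n, f, hf⟩ := Module.Finite.exists_fin' E N
  let k : (Fin n → S) →ₛₗ[ι] N := f.comp (coordMap ι (Fin n))
  refine ⟨n, LinearMap.ker k, (LinearMap.ker k).liftQ k le_rfl,
    LinearMap.ker_eq_bot.1 (Submodule.ker_liftQ_eq_bot _ _ _ le_rfl), fun y ↦ ?_⟩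
  obtain ⟨e, rfl⟩ := hf y
  obtain ⟨m, x, hx⟩ := (hD.isLattice_coordMap (Fin n)).surj e
  refine ⟨m, Submodule.Quotient.mk x, ?_⟩
  rw [← map_smul, hx]
  rfl

lemma globalDimension_le [IsNoetherianRing B] {d : ℕ} (h : globalDimension B ≤ d) :
    globalDimension E ≤ d := by
  refine globalDimension_le_of_finite fun N _ _ _ ↦ ?_
  obtain ⟨n, K, l, hl⟩ := hD.exists_lattice N
  obtain ⟨M', _, _, q, hq, _⟩ := exists_reduction t p hD.p_surj hD.p_ker ((Fin n → S) ⧸ K)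
  exact hD.hasProjectiveDimensionLT_of_reduction hq hl d (globalDimension_le_iff.1 h M')

/-- The contraction `I` of a left ideal is saturated: `t s ∈ I` implies `s ∈ I`. So `I / t I` embeds
in `B`, whence `I` is finitely generated over `S`. -/
lemma isNoetherianRing [IsNoetherianRing B] : IsNoetherianRing E := by
  refine isNoetherianRing_iff_ideal_fg E |>.2 fun J ↦ ?_
  have : RingHomSurjective p := ⟨hD.p_surj⟩
  let I : Ideal S := J.comap ι
  let q : I →ₛₗ[p] Submodule.map p.toSemilinearMap (I : Submodule S S) :=
    LinearMap.codRestrict _ (p.toSemilinearMap.domRestrict I) fun x ↦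
      Submodule.mem_map_of_mem x.2
  have hq : IsReduction t q := by
    refine ⟨?_, fun x hx ↦ ?_⟩
    · rintro ⟨_, x, hx, rfl⟩
      exact ⟨⟨x, hx⟩, rfl⟩
    · obtain ⟨s, hs⟩ := hD.p_ker x (congrArg Subtype.val hx)
      refine ⟨⟨s, ?_⟩, Subtype.ext hs⟩
      have h1 : ι x ∈ J := x.2
      obtain ⟨u, hu⟩ := hD.ι_unit
      have h2 : ι s = ↑u⁻¹ * ι x := by
        rw [hs, map_mul, ← hu, ← mul_assoc, Units.inv_mul, one_mul]
      change ι s ∈ J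
      rw [h2]
      exact J.mul_mem_left _ h1
  have hfin : Module.Finite S I := hq.finite_of_finite hD
    (IsSeparatedAt.of_injective (M' := S) hD.sep (Submodule.subtype I)
      (Submodule.injective_subtype I))
  obtain ⟨T, hT⟩ : (I : Submodule S S).FG := Module.Finite.iff_fg.1 hfin
  classical
  refine ⟨T.image ι, le_antisymm (Submodule.span_le.2 ?_) fun e he ↦ ?_⟩
  · rw [Finset.coe_image]
    rintro _ ⟨x, hx, rfl⟩
    have : x ∈ I := by rw [← hT]; exact Submodule.subset_span hx
    exact this
  · obtain ⟨m, s, hs⟩ := hD.ι_surj e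
    obtain ⟨u, hu⟩ := hD.ι_unit
    have h1 : e = ↑(u ^ m)⁻¹ * ι s := by
      rw [← hs, ← hu, ← mul_assoc, ← Units.val_pow_eq_pow_val, Units.inv_mul, one_mul]
    have h2 : s ∈ I := by
      change ι s ∈ J
      rw [← hs]
      exact J.mul_mem_left _ he
    rw [h1]
    refine Submodule.smul_mem _ (↑(u ^ m)⁻¹ : E) ?_
    rw [← hT] at h2
    rw [Finset.coe_image]
    have h3 : Submodule.span S (T : Set S) ≤
      (Submodule.span E (ι '' T)).comap ι.toSemilinearMap := Submodule.span_le.2 fun x hx ↦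
        Submodule.subset_span ⟨x, hx, rfl⟩
    exact h3 h2

end IsCompleteDeformation

end AuslanderReg

end

/-! ### Lifting the Auslander condition from `S / t S` to `S[1/t]` -/

noncomputable section

namespace AuslanderReg

universe v w

section Dual

variable {B : Type v} [Ring B]

/-- The right `B`-module `B` is the left regular module of the opposite ring. -/
def opSelfEquiv (B : Type v) [Ring B] : B ≃ₗ[Bᵐᵒᵖ] Bᵐᵒᵖ where
  toFun := MulOpposite.op
  invFun := MulOpposite.unop
  left_inv _ := rfl
  right_inv _ := rfl
  map_add' _ _ := rfl
  map_smul' _ _ := rfl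

instance isNoetherian_op_self [IsNoetherianRing Bᵐᵒᵖ] : IsNoetherian Bᵐᵒᵖ B :=
  isNoetherian_of_linearEquiv (opSelfEquiv B).symm

instance dualSubmoduleAddCommGroup {X : Type*} [AddCommGroup X] [Module B X]
    (Λ : Submodule Bᵐᵒᵖ (X →ₗ[B] B)) : AddCommGroup Λ := Submodule.addCommGroup Λ

/-- Evaluation on a finite family. -/
def evalFamily {X : Type*} [AddCommGroup X] [Module B X] {κ : Type*} (w : κ → X) :
    (X →ₗ[B] B) →ₗ[Bᵐᵒᵖ] (κ → B) where
  toFun h i := h (w i)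
  map_add' _ _ := rfl
  map_smul' _ _ := rfl

lemma evalFamily_injective {X : Type*} [AddCommGroup X] [Module B X] {n : ℕ}
    {f : (Fin n → B) →ₗ[B] X} (hf : Function.Surjective f) :
    Function.Injective (evalFamily (B := B) fun i ↦ f (Pi.single i 1)) := fun g h hgh ↦ by
  have : g ∘ₗ f = h ∘ₗ f := LinearMap.pi_ext' fun i ↦ LinearMap.ext_ring (congrFun hgh i)
  ext x
  obtain ⟨y, rfl⟩ := hf x
  exact LinearMap.congr_fun this y

instance isNoetherian_dual [IsNoetherianRing Bᵐᵒᵖ] (X : Type*) [AddCommGroup X] [Module B X]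
    [Module.Finite B X] : IsNoetherian Bᵐᵒᵖ (X →ₗ[B] B) := by
  obtain ⟨n, f, hf⟩ := Module.Finite.exists_fin' B X
  exact isNoetherian_of_injective _ (evalFamily_injective hf)

end Dual

namespace IsCompleteDeformation

variable {S : Type u} {B : Type v} {E : Type w} [Ring S] [Ring B] [Ring E]
  {t : S} {p : S →+* B} {ι : S →+* E} {M : Type u} {M' : Type v} {N : Type w}
  [AddCommGroup M] [Module S M] [AddCommGroup M'] [Module B M'] [AddCommGroup N] [Module E N]
  (hD : IsCompleteDeformation t p ι) {q : M →ₛₗ[p] M'} {l : M →ₛₗ[ι] N}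

include hD

lemma exists_functional_of_map_eq_zero (k : M →ₗ[S] S) (hk : ∀ x, p (k x) = 0) :
    ∃ h : M →ₗ[S] S, k = MulOpposite.op t • h := by
  choose y hy using fun x ↦ hD.p_ker _ (hk x)
  have hreg : ∀ {a b : S}, t * a = t * b → a = b := fun {a b} hab ↦
    hD.smul_left_injective hD.isLattice_self hab
  refine ⟨{ toFun := y, map_add' := fun a b ↦ hreg ?_, map_smul' := fun c a ↦ hreg ?_ },
    LinearMap.ext fun x ↦ (hy x).trans (hD.comm _)⟩
  · rw [mul_add, ← hy, ← hy, ← hy, map_add]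
  · rw [← hy, map_smul, smul_eq_mul, RingHom.id_apply, smul_eq_mul, ← mul_assoc, hD.comm,
      mul_assoc, ← hy]

lemma isSeparatedAt_dual : IsSeparatedAt (MulOpposite.op t) (M →ₗ[S] S) := fun h hh ↦ by
  ext x
  refine hD.sep _ fun n ↦ ?_
  obtain ⟨y, rfl⟩ := hh n
  refine ⟨y x, ?_⟩
  rw [← MulOpposite.op_pow, LinearMap.smul_apply, op_smul_eq_mul]
  exact (Commute.pow_left (hD.comm _) n).eq.symm

/-- By saturation `Λ / t Λ` embeds in the dual of `M'`, a noetherian right `B`-module; and `Λ` is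
separated. -/
lemma finite_saturated [IsNoetherianRing Bᵐᵒᵖ] [Module.Finite B M'] (hq : IsReduction t q)
    (Λ : Submodule Sᵐᵒᵖ (M →ₗ[S] S)) (hΛ : ∀ h, MulOpposite.op t • h ∈ Λ → h ∈ Λ) :
    Module.Finite Sᵐᵒᵖ Λ := by
  have : RingHomSurjective (RingHom.op p) := ⟨hD.op.p_surj⟩
  let θ := (hq.isUniv hD).dual
  let qΛ : Λ →ₛₗ[RingHom.op p] Λ.map θ := LinearMap.codRestrict _ (θ.domRestrict Λ) fun x ↦
    Submodule.mem_map_of_mem x.2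
  have hqΛ : IsReduction (MulOpposite.op t) qΛ := by
    refine ⟨?_, fun a ha ↦ ?_⟩
    · rintro ⟨_, x, hx, rfl⟩
      exact ⟨⟨x, hx⟩, rfl⟩
    · have h0 : θ a = 0 := congrArg Subtype.val ha
      obtain ⟨h, hh⟩ := hD.exists_functional_of_map_eq_zero a.1 fun x ↦ by
        rw [← (hq.isUniv hD).dual_apply]
        exact LinearMap.congr_fun h0 _
      exact ⟨⟨h, hΛ h (hh ▸ a.2)⟩, Subtype.ext hh⟩
  exact hqΛ.finite_of_finite hD.op
    (hD.isSeparatedAt_dual.of_injective Λ.subtype Λ.injective_subtype)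

/-- Submodules of the cokernel of `Hom(E^n, E) → Hom(N, E)` are controlled by subquotients of the
cokernel of `Hom(B^n, B) → Hom(M', B)`. -/
lemma extVanishes_submodule_coker [IsNoetherianRing B] [IsNoetherianRing Bᵐᵒᵖ]
    [Module.Finite S M] [Module.Finite B M'] (hq : IsReduction t q) (hl : IsLattice t l) {n : ℕ}
    (i : M →ₗ[S] (Fin n → S)) (iB : M' →ₗ[B] (Fin n → B)) (iE : N →ₗ[E] (Fin n → E))
    (hiB : ∀ x, iB (q x) = coordMap p _ (i x)) (hiE : ∀ x, iE (l x) = coordMap ι _ (i x)) (c : ℕ)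
    (h : ∀ L : Submodule Bᵐᵒᵖ ((M' →ₗ[B] B) ⧸ LinearMap.range (opDual iB)),
      ∀ j < c, ExtVanishes Bᵐᵒᵖ L j)
    (L : Submodule Eᵐᵒᵖ ((N →ₗ[E] E) ⧸ LinearMap.range (opDual iE))) (j : ℕ) (hj : j < c) :
    ExtVanishes Eᵐᵒᵖ L j := by
  have : RingHomSurjective (RingHom.op p) := ⟨hD.op.p_surj⟩
  let θE := (hl.isUniv hD).dual
  let θB := (hq.isUniv hD).dual
  let ψ : (M →ₗ[S] S) →ₛₗ[RingHom.op ι] ((N →ₗ[E] E) ⧸ LinearMap.range (opDual iE)) :=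
    (Submodule.mkQ _).comp θE
  let ρ : (M →ₗ[S] S) →ₛₗ[RingHom.op p] ((M' →ₗ[B] B) ⧸ LinearMap.range (opDual iB)) :=
    (Submodule.mkQ _).comp θB
  have hψ : ∀ g : (Fin n → S) →ₗ[S] S, ψ (opDual i g) = 0 := fun g ↦ by
    refine (Submodule.Quotient.mk_eq_zero _).2 ⟨baseMap ι.toSemilinearMap g,
      (hl.isUniv hD).ext fun x ↦ ?_⟩
    rw [(hl.isUniv hD).dual_apply, opDual_apply, hiE, baseMap_coordMap]
    rfl
  have hunit : ∀ (L : Submodule Eᵐᵒᵖ ((N →ₗ[E] E) ⧸ LinearMap.range (opDual iE))) x,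
      RingHom.op ι (MulOpposite.op t) • x ∈ L → x ∈ L := fun L x hx ↦ by
    obtain ⟨u, hu⟩ := hD.op.ι_unit
    rw [← hu] at hx
    simpa [smul_smul] using L.smul_mem (↑u⁻¹ : Eᵐᵒᵖ) hx
  -- The integral functionals whose class lies in `L`. Since `t` is invertible on `L`, they form a
  -- saturated, hence finitely generated, submodule.
  let Λ : Submodule Sᵐᵒᵖ (M →ₗ[S] S) := L.comap ψ
  have hΛ : ∀ h, MulOpposite.op t • h ∈ Λ → h ∈ Λ := fun h hh ↦ by
    change ψ _ ∈ L at hh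
    rw [map_smulₛₗ] at hh
    exact hunit L _ hh
  have hfinΛ := hD.finite_saturated hq Λ hΛ
  let ψΛ : Λ →ₛₗ[RingHom.op ι] L := LinearMap.codRestrict _ (ψ.domRestrict Λ) fun x ↦ x.2
  -- The image of `Λ` in `L` is a lattice, because each functional on `N` becomes integral after
  -- multiplication by a power of `t`.
  let lL : (Λ ⧸ LinearMap.ker ψΛ) →ₛₗ[RingHom.op ι] L := (LinearMap.ker ψΛ).liftQ ψΛ le_rfl
  have hlL : IsLattice (MulOpposite.op t) lL := by
    refine ⟨LinearMap.ker_eq_bot.1 (Submodule.ker_liftQ_eq_bot _ _ _ le_rfl), ?_⟩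
    rintro ⟨y, hy⟩
    obtain ⟨g, rfl⟩ := Submodule.mkQ_surjective _ y
    obtain ⟨m, k, hk⟩ := IsLattice.exists_integral hD l g
    have h1 : (RingHom.op ι (MulOpposite.op t)) ^ m • g = θE k := (hl.isUniv hD).ext fun x ↦ by
      rw [(hl.isUniv hD).dual_apply, ← hk]
      exact (((hD.commute_map _).pow_left m).eq).symm
    have h2 : (RingHom.op ι (MulOpposite.op t)) ^ m • Submodule.mkQ _ g = ψ k := by
      rw [← map_smul, h1]
      rfl
    refine ⟨m, Submodule.Quotient.mk ⟨k, ?_⟩, Subtype.ext h2⟩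
    change ψ k ∈ L
    rw [← h2]
    exact L.smul_mem _ hy
  let ρΛ : Λ →ₛₗ[RingHom.op p] Λ.map ρ := LinearMap.codRestrict _ (ρ.domRestrict Λ) fun x ↦
    Submodule.mem_map_of_mem x.2
  let L₀ : Submodule Bᵐᵒᵖ (Λ.map ρ) := (LinearMap.ker ψΛ).map ρΛ
  let qL : (Λ ⧸ LinearMap.ker ψΛ) →ₛₗ[RingHom.op p] (Λ.map ρ) ⧸ L₀ :=
    Submodule.mapQ _ _ ρΛ (Submodule.le_comap_map _ _)
  -- If `a` dies, then for some `b` in `ker ψΛ` the reduction of `a - b` extends to `B ^ n`. Lifting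
  -- the extension to `g'` gives `a - b = opDual i g' + t k`, so `ψ a = t ψ k` and `k` lies in `Λ`.
  have hqL : IsReduction (MulOpposite.op t) qL := by
    refine ⟨fun y ↦ ?_, fun x hx ↦ ?_⟩
    · obtain ⟨⟨_, a, ha, rfl⟩, rfl⟩ := Submodule.mkQ_surjective _ y
      exact ⟨Submodule.Quotient.mk ⟨a, ha⟩, rfl⟩
    · obtain ⟨a, rfl⟩ := Submodule.mkQ_surjective _ x
      obtain ⟨b, hb, hba⟩ := (Submodule.Quotient.mk_eq_zero _).1 hx
      have h1 : ρ (a - b : Λ) = 0 := by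
        rw [Submodule.coe_sub, map_sub, sub_eq_zero]
        exact (congrArg Subtype.val hba).symm
      obtain ⟨g, hg⟩ := (Submodule.Quotient.mk_eq_zero _).1 h1
      choose s hs using fun i ↦ hD.p_surj (g (Pi.single i 1))
      let g' : (Fin n → S) →ₗ[S] S := Fintype.linearCombination S s
      have hg' : ∀ x, p (g' x) = g (coordMap p _ x) := fun x ↦ by
        have h3 : ∀ i, g' (Pi.single i 1) = s i := fun i ↦ by simp [g']
        change p.toSemilinearMap (g' x) = _
        rw [← baseMap_coordMap p.toSemilinearMap g' x]
        refine LinearMap.congr_fun (LinearMap.pi_ext' fun i ↦ LinearMap.ext_ring ?_) _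
        rw [LinearMap.comp_apply, LinearMap.comp_apply, LinearMap.single_apply, baseMap_single, h3]
        exact hs i
      obtain ⟨k, hk⟩ := hD.exists_functional_of_map_eq_zero
        (((a - b : Λ) : M →ₗ[S] S) - opDual i g') fun x ↦ by
          rw [LinearMap.sub_apply, map_sub, opDual_apply, hg', ← hiB, ← (hq.isUniv hD).dual_apply,
            sub_eq_zero]
          exact (LinearMap.congr_fun hg _).symm
      have hb' : ψ b = 0 := congrArg Subtype.val (LinearMap.mem_ker.1 hb)
      have h2 : RingHom.op ι (MulOpposite.op t) • ψ k = ψ a := by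
        rw [← map_smulₛₗ, ← hk, map_sub, hψ, Submodule.coe_sub, map_sub, hb', sub_zero, sub_zero]
      have hkΛ : k ∈ Λ := hunit L _ (by rw [h2]; exact a.2)
      refine ⟨Submodule.Quotient.mk ⟨k, hkΛ⟩, (Submodule.Quotient.eq _).2 ?_⟩
      rw [LinearMap.mem_ker]
      refine Subtype.ext ?_
      change ψ ((a : M →ₗ[S] S) - MulOpposite.op t • k) = 0
      rw [map_sub, map_smulₛₗ, h2, sub_self]
  -- The reduction of the lattice is a quotient of two submodules of the cokernel over `B`, both
  -- covered by `h`.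
  refine hD.op.extVanishes_of_reduction hqL hlL j ((h _ j hj).quotient fun i hi ↦ ?_)
  exact (h (L₀.map (Submodule.subtype _)) i (by lia)).of_linearEquiv
    (Submodule.equivSubtypeMap _ _).symm

lemma subExtVanishes_of_reduction [IsNoetherianRing B] [IsNoetherianRing Bᵐᵒᵖ]
    [Module.Finite S M] (hq : IsReduction t q) (hl : IsLattice t l) (k c : ℕ)
    (h : SubExtVanishes B M' (k + 1) c) : SubExtVanishes E N (k + 1) c := by
  induction k generalizing M M' N with
  | zero =>
    obtain ⟨n, f, hf⟩ := Module.Finite.exists_fin' S M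
    rw [zero_add, subExtVanishes_one_iff (hD.baseMap_surjective_of_isLattice hl hf)]
    rw [zero_add, subExtVanishes_one_iff (baseMap_surjective_of_isReduction hq hf)] at h
    have := hD.finite_ker hq hl hf
    exact hD.extVanishes_submodule_coker (hD.kerMap_isReduction hq hl hf)
      (hD.kerMap_isLattice (f := f) hl) (LinearMap.ker f).subtype _ _
      (fun x ↦ rfl) (fun x ↦ rfl) c h
  | succ k ih =>
    obtain ⟨n, f, hf⟩ := Module.Finite.exists_fin' S M
    have := hD.finite_ker hq hl hf
    rw [subExtVanishes_add_two_iff (hD.baseMap_surjective_of_isLattice hl hf)]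
    rw [subExtVanishes_add_two_iff (baseMap_surjective_of_isReduction hq hf)] at h
    exact ih (hD.kerMap_isReduction hq hl hf) (hD.kerMap_isLattice hl) h

lemma auslanderCondition [IsNoetherianRing B] [IsNoetherianRing Bᵐᵒᵖ]
    (h : AuslanderCondition B) : AuslanderCondition E := by
  rw [auslanderCondition_iff] at h ⊢
  intro N _ _ _ k
  obtain ⟨n, K, l, hl⟩ := hD.exists_lattice N
  obtain ⟨M', _, _, q, hq, hfin⟩ := exists_reduction t p hD.p_surj hD.p_ker ((Fin n → S) ⧸ K)
  exact hD.subExtVanishes_of_reduction hq hl k _ (h M' hfin k)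

end IsCompleteDeformation

lemma isNoetherianRing_op_op {B : Type v} [Ring B] [IsNoetherianRing B] :
    IsNoetherianRing Bᵐᵒᵖᵐᵒᵖ :=
  isNoetherianRing_of_ringEquiv B (RingEquiv.opOp B)

/-- Auslander regularity passes from `S / t S` to `S[1/t]` when `S` is `t`-adically complete. -/
theorem IsCompleteDeformation.isAuslanderRegular {S : Type u} {B : Type v} {E : Type w} [Ring S]
    [Ring B] [Ring E] {t : S} {p : S →+* B} {ι : S →+* E} (hD : IsCompleteDeformation t p ι)
    (hB : IsAuslanderRegular B) : IsAuslanderRegular E := by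
  have := hB.left_noetherian
  have := hB.right_noetherian
  have := isNoetherianRing_op_op (B := B)
  obtain ⟨d, hd⟩ := exists_globalDimension_le_of_lt_top hB.left_globalDimension
  obtain ⟨d', hd'⟩ := exists_globalDimension_le_of_lt_top hB.right_globalDimension
  exact ⟨hD.isNoetherianRing, hD.op.isNoetherianRing,
    globalDimension_lt_top (hD.globalDimension_le hd),
    globalDimension_lt_top (hD.op.globalDimension_le hd'),
    hD.auslanderCondition hB.left_condition, hD.op.auslanderCondition hB.right_condition⟩

end AuslanderReg

end

noncomputable section

namespace AuslanderReg

universe v w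

/-! ### Descent along flat extensions with a bimodule retraction -/

/-- Left linear relations over `E` with coefficients in `B` come from relations over `B`. -/
def LeftFlat {B : Type v} {E : Type w} [Ring B] [Ring E] (φ : B →+* E) : Prop :=
  ∀ (κ κ' : Type) [Fintype κ] [Fintype κ'] (a : κ → κ' → B) (e : κ → E),
    (∀ j, ∑ i, e i * φ (a i j) = 0) → ∃ (r : ℕ) (s : Fin r → κ → B) (c : Fin r → E),
      (∀ k j, ∑ i, s k i * a i j = 0) ∧ ∀ i, e i = ∑ k, c k * φ (s k i)

/-- `E` is flat on both sides over `B`, and `ρ` is a retraction of `B`-bimodules. -/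
structure IsFlatRetract {B : Type v} {E : Type w} [Ring B] [Ring E] (φ : B →+* E) (ρ : E →+ B) :
    Prop where
  map_mul_left : ∀ b e, ρ (φ b * e) = b * ρ e
  map_mul_right : ∀ b e, ρ (e * φ b) = ρ e * b
  map_one : ρ 1 = 1
  leftFlat : LeftFlat φ
  rightFlat : LeftFlat (RingHom.op φ)

lemma baseMap_apply {S S' M N κ : Type*} [Ring S] [Ring S'] {σ : S →+* S'} [AddCommGroup M]
    [Module S M] [AddCommGroup N] [Module S' N] [Fintype κ] [DecidableEq κ] (q : M →ₛₗ[σ] N)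
    (f : (κ → S) →ₗ[S] M) (y : κ → S') :
    baseMap q f y = ∑ i, y i • q (f (Pi.single i 1)) := rfl

lemma LinearMap.pi_apply_eq_sum_single {S M κ : Type*} [Semiring S] [AddCommMonoid M]
    [Module S M] [Fintype κ] [DecidableEq κ] (g : (κ → S) →ₗ[S] M) (y : κ → S) :
    g y = ∑ i, y i • g (Pi.single i 1) := by
  conv_lhs => rw [pi_eq_sum_univ' y, map_sum]
  simp only [map_smul]

lemma LeftFlat.op_op {B : Type v} {E : Type w} [Ring B] [Ring E] {φ : B →+* E}
    (h : LeftFlat φ) : LeftFlat (RingHom.op (RingHom.op φ)) := by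
  intro κ κ' _ _ a e hae
  obtain ⟨r, s, c, h1, h2⟩ := h κ κ' (fun i j ↦ (a i j).unop.unop) (fun i ↦ (e i).unop.unop)
    fun j ↦ by
      have := congrArg (fun x ↦ x.unop.unop) (hae j)
      simpa [Finset.unop_sum] using this
  refine ⟨r, fun k i ↦ .op (.op (s k i)), fun k ↦ .op (.op (c k)), fun k j ↦ ?_, fun i ↦ ?_⟩
  · apply MulOpposite.unop_injective
    apply MulOpposite.unop_injective
    simpa [Finset.unop_sum] using h1 k j
  · apply MulOpposite.unop_injective
    apply MulOpposite.unop_injective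
    simpa [Finset.unop_sum] using h2 i

lemma IsFlatRetract.op {B : Type v} {E : Type w} [Ring B] [Ring E] {φ : B →+* E} {ρ : E →+ B}
    (h : IsFlatRetract φ ρ) : IsFlatRetract (RingHom.op φ) (AddMonoidHom.mulOp ρ) where
  map_mul_left b e := MulOpposite.unop_injective (h.map_mul_right b.unop e.unop)
  map_mul_right b e := MulOpposite.unop_injective (h.map_mul_left b.unop e.unop)
  map_one := MulOpposite.unop_injective h.map_one
  leftFlat := h.rightFlat
  rightFlat := h.leftFlat.op_op

section

variable {B : Type v} {E : Type w} [Ring B] [Ring E] {φ : B →+* E} {ρ : E →+ B}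
  {M : Type v} {N : Type w} [AddCommGroup M] [Module B M] [AddCommGroup N] [Module E N]
  {q : M →ₛₗ[φ] N} {n : ℕ} {f : (Fin n → B) →ₗ[B] M}

/-- `N` is the base change of `M`, in terms of a presentation of `M`. -/
structure IsBaseChangeOf (q : M →ₛₗ[φ] N) (f : (Fin n → B) →ₗ[B] M) : Prop where
  surj : Function.Surjective f
  surj' : Function.Surjective (baseMap q f)
  ker : ∀ y, baseMap q f y = 0 →
    y ∈ Submodule.span E (coordMap φ (Fin n) '' (LinearMap.ker f : Set (Fin n → B)))

namespace IsBaseChangeOf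

lemma hom_ext (hq : IsBaseChangeOf q f) {N' : Type*} [AddCommGroup N'] [Module E N']
    {g h : N →ₗ[E] N'} (H : ∀ x, g (q x) = h (q x)) : g = h := by
  have : g ∘ₗ baseMap q f = h ∘ₗ baseMap q f :=
    LinearMap.pi_ext' fun i ↦ LinearMap.ext_ring (by simp [baseMap_single, H])
  ext y
  obtain ⟨x, rfl⟩ := hq.surj' y
  exact LinearMap.congr_fun this x

lemma isUniv (hq : IsBaseChangeOf q f) : IsUniv q := fun ψ ↦ by
  have hle : LinearMap.ker (baseMap q f) ≤ LinearMap.ker (baseMap ψ f) := fun y hy ↦ by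
    refine Submodule.span_le.2 ?_ (hq.ker y hy)
    rintro _ ⟨x, hx, rfl⟩
    rw [SetLike.mem_coe, LinearMap.mem_ker, baseMap_coordMap, LinearMap.mem_ker.1 hx, map_zero]
  let ψ' : N →ₗ[E] E := (LinearMap.ker (baseMap q f)).liftQ (baseMap ψ f) hle ∘ₗ
    ((baseMap q f).quotKerEquivOfSurjective hq.surj').symm.toLinearMap
  have hψ' : ∀ x, ψ' (q x) = ψ x := fun x ↦ by
    obtain ⟨c, rfl⟩ := hq.surj x
    have : ((baseMap q f).quotKerEquivOfSurjective hq.surj').symm (q (f c)) =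
        Submodule.Quotient.mk (coordMap φ _ c) := by
      rw [LinearEquiv.symm_apply_eq, ← baseMap_coordMap]; rfl
    simp only [ψ', LinearMap.comp_apply, LinearEquiv.coe_coe, this]
    exact baseMap_coordMap ψ f c
  exact ⟨ψ', hψ', fun g hg ↦ hq.hom_ext fun x ↦ by rw [hg, hψ']⟩

/-- By flatness the syzygy of the base change is the base change of the syzygy: relations over `E`
among the generators of `ker f` come from relations over `B`. -/
lemma exists_presentation_ker [IsNoetherianRing B] (hφ : LeftFlat φ) (hq : IsBaseChangeOf q f) :
    ∃ (m : ℕ) (g : (Fin m → B) →ₗ[B] LinearMap.ker f), IsBaseChangeOf (kerMap q f) g := by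
  obtain ⟨m, g, hg⟩ := Module.Finite.exists_fin' B (LinearMap.ker f)
  refine ⟨m, g, hg, ?_, fun y hy ↦ ?_⟩
  · rintro ⟨y, hy⟩
    have h1 : Submodule.span E (coordMap φ (Fin n) '' (LinearMap.ker f : Set (Fin n → B))) ≤
        LinearMap.range ((LinearMap.ker (baseMap q f)).subtype ∘ₗ baseMap (kerMap q f) g) := by
      refine Submodule.span_le.2 ?_
      rintro _ ⟨x, hx, rfl⟩
      obtain ⟨z, hz⟩ := hg ⟨x, hx⟩
      refine ⟨coordMap φ _ z, ?_⟩
      rw [LinearMap.comp_apply, baseMap_coordMap, hz]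
      rfl
    obtain ⟨z, hz⟩ := h1 (hq.ker y hy)
    exact ⟨z, Subtype.ext hz⟩
  · obtain ⟨r, s, c, h1, h2⟩ := hφ (Fin m) (Fin n) (fun i j ↦ (g (Pi.single i 1) : Fin n → B) j) y
      fun j ↦ by
        have := congrFun (congrArg (LinearMap.ker (baseMap q f)).subtype
          ((baseMap_apply _ _ _).symm.trans hy)) j
        simpa [Finset.sum_apply] using this
    have h3 : y = ∑ k, c k • coordMap φ _ (s k) := funext fun i ↦ by
      simp [h2 i, Finset.sum_apply]
    rw [h3]
    refine Submodule.sum_mem _ fun k _ ↦ Submodule.smul_mem _ _ (Submodule.subset_span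
      ⟨s k, ?_, rfl⟩)
    rw [SetLike.mem_coe, LinearMap.mem_ker, LinearMap.pi_apply_eq_sum_single g]
    ext j
    simpa [Finset.sum_apply] using h1 k j

end IsBaseChangeOf

namespace IsFlatRetract

variable (hφ : IsFlatRetract φ ρ)

include hφ

lemma map_map (b : B) : ρ (φ b) = b := by
  rw [← mul_one (φ b), hφ.map_mul_left, hφ.map_one, mul_one]

/-- A functional over `B` is extended to the base change, the problem is solved over `E`, and the
left linear retraction `ρ` brings the solution back to `B`. -/
lemma extVanishes_of_baseChange [IsNoetherianRing B] (hq : IsBaseChangeOf q f) (j : ℕ)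
    (h : ExtVanishes E N j) : ExtVanishes B M j := by
  induction j generalizing M N n with
  | zero =>
    rw [extVanishes_zero_iff] at h ⊢
    intro g
    ext x
    rw [← hφ.map_map (g x), ← hq.isUniv.dual_apply, h (hq.isUniv.dual g)]
    simp
  | succ j ih =>
    obtain ⟨m, g, hg⟩ := hq.exists_presentation_ker hφ.leftFlat
    cases j with
    | zero =>
      rw [zero_add, extVanishes_one_iff hq.surj'] at h
      rw [zero_add, extVanishes_one_iff hq.surj]
      intro k
      obtain ⟨e, he⟩ := h (hg.isUniv.dual k)
      refine ⟨{ toFun := fun x ↦ ρ (e (coordMap φ _ x)), map_add' := fun x y ↦ by simp,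
                map_smul' := fun b x ↦ ?_ }, fun x ↦ ?_⟩
      · rw [map_smulₛₗ, map_smul, smul_eq_mul, hφ.map_mul_left]
        rfl
      · change ρ (e (coordMap φ _ x)) = k x
        rw [← kerMap_coe q f x, he, hg.isUniv.dual_apply, hφ.map_map]
    | succ j =>
      rw [extVanishes_add_two_iff hq.surj'] at h
      rw [extVanishes_add_two_iff hq.surj]
      exact ih hg h

lemma hasProjectiveDimensionLT_of_baseChange [IsNoetherianRing B] (hq : IsBaseChangeOf q f)
    (d : ℕ) (h : HasProjectiveDimensionLT (ModuleCat.of E N) (d + 1)) :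
    HasProjectiveDimensionLT (ModuleCat.of B M) (d + 1) := by
  induction d generalizing M N n with
  | zero =>
    rw [zero_add, hasProjectiveDimensionLT_one_iff] at *
    obtain ⟨r, hr⟩ := exists_retraction hq.surj'
    -- Applying `ρ` coordinatewise maps the syzygy over `E` into `ker f`. The extra factor `e` makes
    -- the span induction go through, since `ρ` is not `E`-linear; on generators, `ρ` is right
    -- `B`-linear.
    have key : ∀ y ∈ Submodule.span E
        (coordMap φ (Fin n) '' (LinearMap.ker f : Set (Fin n → B))),
        ∀ e : E, (fun i ↦ ρ (e * y i)) ∈ LinearMap.ker f := by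
      intro y hy
      refine Submodule.span_induction ?_ (fun e ↦ ?_) (fun x y _ _ hx hy e ↦ ?_)
        (fun a x _ hx e ↦ ?_) hy
      · rintro _ ⟨x, hx, rfl⟩ e
        simp only [coordMap_apply, hφ.map_mul_right]
        exact Submodule.smul_mem _ (ρ e) hx
      · simp only [Pi.zero_apply, mul_zero, map_zero]
        exact zero_mem _
      · simp only [Pi.add_apply, mul_add, map_add]
        exact add_mem (hx e) (hy e)
      · simp only [Pi.smul_apply, smul_eq_mul, ← mul_assoc]
        exact hx (e * a)
    let r' : (Fin n → B) →ₗ[B] LinearMap.ker f :=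
      { toFun := fun x ↦ ⟨fun i ↦ ρ ((r (coordMap φ _ x) : Fin n → E) i), by
          simpa using key _ (hq.ker _ (r (coordMap φ _ x)).2) 1⟩
        map_add' := fun x y ↦ by ext i; simp
        map_smul' := fun b x ↦ by ext i; simp [hφ.map_mul_left] }
    refine projective_of_retraction hq.surj r' fun x ↦ Subtype.ext (funext fun i ↦ ?_)
    change ρ ((r (coordMap φ _ x) : Fin n → E) i) = (x : Fin n → B) i
    rw [← kerMap_coe q f x, hr, kerMap_coe, coordMap_apply, hφ.map_map]
  | succ d ih =>
    obtain ⟨m, g, hg⟩ := hq.exists_presentation_ker hφ.leftFlat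
    rw [hasProjectiveDimensionLT_add_two_iff hq.surj'] at h
    rw [hasProjectiveDimensionLT_add_two_iff hq.surj]
    exact ih hg h

/-- Flatness on the other side makes the `E`-span `L'` of the image of `L` a base change of `L`, so
vanishing descends from `L'` to `L`. -/
lemma extVanishes_submodule_coker [IsNoetherianRing B] [IsNoetherianRing Bᵐᵒᵖ]
    (hq : IsBaseChangeOf q f) {m : ℕ}
    (i : M →ₗ[B] (Fin m → B)) (iE : N →ₗ[E] (Fin m → E))
    (hiE : ∀ x, iE (q x) = coordMap φ _ (i x)) (c : ℕ)
    (h : ∀ L : Submodule Eᵐᵒᵖ ((N →ₗ[E] E) ⧸ LinearMap.range (opDual iE)),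
      ∀ j < c, ExtVanishes Eᵐᵒᵖ L j)
    (L : Submodule Bᵐᵒᵖ ((M →ₗ[B] B) ⧸ LinearMap.range (opDual i))) (j : ℕ) (hj : j < c) :
    ExtVanishes Bᵐᵒᵖ L j := by
  have hfin : Module.Finite B M := Module.Finite.of_surjective f hq.surj
  let θ := hq.isUniv.dual
  have hθ : ∀ g : (Fin m → B) →ₗ[B] B,
      θ (opDual i g) = opDual iE (baseMap φ.toSemilinearMap g) := fun g ↦
    hq.isUniv.ext fun x ↦ by
      rw [hq.isUniv.dual_apply, opDual_apply, opDual_apply, hiE, baseMap_coordMap]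
      rfl
  let ψ : ((M →ₗ[B] B) ⧸ LinearMap.range (opDual i)) →ₛₗ[RingHom.op φ]
      ((N →ₗ[E] E) ⧸ LinearMap.range (opDual iE)) :=
    Submodule.mapQ _ _ θ (by
      rintro _ ⟨g, rfl⟩
      exact ⟨_, (hθ g).symm⟩)
  let L' : Submodule Eᵐᵒᵖ ((N →ₗ[E] E) ⧸ LinearMap.range (opDual iE)) :=
    Submodule.span Eᵐᵒᵖ (ψ '' L)
  let qL : L →ₛₗ[RingHom.op φ] L' := LinearMap.codRestrict _ (ψ.domRestrict L) fun x ↦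
    Submodule.subset_span ⟨x, x.2, rfl⟩
  obtain ⟨k, g, hg⟩ := Module.Finite.exists_fin' Bᵐᵒᵖ L
  have hqL : IsBaseChangeOf qL g := by
    refine ⟨hg, ?_, fun y hy ↦ ?_⟩
    · rintro ⟨y, hy⟩
      have h1 : L' ≤ LinearMap.range (L'.subtype ∘ₗ baseMap qL g) := by
        refine Submodule.span_le.2 ?_
        rintro _ ⟨x, hx, rfl⟩
        obtain ⟨z, hz⟩ := hg ⟨x, hx⟩
        refine ⟨coordMap (RingHom.op φ) _ z, ?_⟩
        rw [LinearMap.comp_apply, baseMap_coordMap, hz]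
        rfl
      obtain ⟨z, hz⟩ := h1 hy
      exact ⟨z, Subtype.ext hz⟩
    · choose a ha using fun r : Fin k ↦
        (LinearMap.range (opDual i)).mkQ_surjective (g (Pi.single r 1)).1
      have h1 : (LinearMap.range (opDual iE)).mkQ (∑ r, y r • θ (a r)) = 0 := by
        have h2 := congrArg L'.subtype ((baseMap_apply _ _ _).symm.trans hy)
        rw [map_sum, map_zero] at h2
        rw [map_sum, ← h2]
        refine Finset.sum_congr rfl fun r _ ↦ ?_
        rw [map_smul, map_smul]
        congr 1
        change _ = ψ (g (Pi.single r 1)).1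
        rw [← ha r]
        rfl
      -- A relation `y` among the generators of `L'` says that `∑ y r • θ (a r)` extends to a
      -- functional `G` on `E ^ m`. Evaluated at the generators `w s` of `M`, this is a linear
      -- system with coefficients in `B` and unknowns `y` and the coordinates of `-G`.
      obtain ⟨G, hG⟩ := (Submodule.Quotient.mk_eq_zero _).1 h1
      let w : Fin n → M := fun s ↦ f (Pi.single s 1)
      have h2 : ∀ s, ∑ j, φ (i (w s) j) * G (Pi.single j 1) =
          ∑ r, φ (a r (w s)) * (y r).unop := fun s ↦ by
        have h3 := LinearMap.congr_fun hG (q (w s))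
        rw [opDual_apply, hiE, LinearMap.pi_apply_eq_sum_single G] at h3
        simpa [LinearMap.sum_apply, θ] using h3
      obtain ⟨t, s, c, h3, h4⟩ := hφ.rightFlat (Fin k ⊕ Fin m) (Fin n)
        (Sum.elim (fun r s ↦ .op (a r (w s))) fun j s ↦ .op (i (w s) j))
        (Sum.elim y fun j ↦ .op (-G (Pi.single j 1))) fun l ↦ by
          apply MulOpposite.unop_injective
          have := h2 l
          rw [MulOpposite.unop_zero, Finset.unop_sum, Fintype.sum_sum_type]
          simp only [Sum.elim_inl, Sum.elim_inr, MulOpposite.unop_mul, MulOpposite.unop_op,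
            RingHom.op_apply_apply, mul_neg, Finset.sum_neg_distrib]
          rw [this]
          simp
      have h5 : y = ∑ l, c l • coordMap (RingHom.op φ) _ (fun r ↦ s l (.inl r)) :=
        funext fun r ↦ by
          have := h4 (.inl r)
          rw [Sum.elim_inl] at this
          simp [this, Finset.sum_apply]
      rw [h5]
      refine Submodule.sum_mem _ fun l _ ↦ Submodule.smul_mem _ _ (Submodule.subset_span
        ⟨_, ?_, rfl⟩)
      rw [SetLike.mem_coe, LinearMap.mem_ker, LinearMap.pi_apply_eq_sum_single g]
      apply Subtype.ext
      -- Each solution over `B` supplied by flatness is a relation among the `a r` modulo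
      -- functionals that extend to `B ^ m`, that is, a relation in `L`.
      have h6 : ∑ r, s l (.inl r) • a r =
          -opDual i (∑ j, s l (.inr j) • LinearMap.proj (R := B) (φ := fun _ ↦ B) j) := by
        apply evalFamily_injective hq.surj
        funext x
        have := congrArg MulOpposite.unop (h3 l x)
        rw [MulOpposite.unop_zero, Finset.unop_sum, Fintype.sum_sum_type] at this
        simp only [Sum.elim_inl, Sum.elim_inr, MulOpposite.unop_mul, MulOpposite.unop_op] at this
        change (∑ r, s l (.inl r) • a r) (w x) = (-opDual i (∑ j, s l (.inr j) •
          LinearMap.proj (R := B) (φ := fun _ ↦ B) j)) (w x)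
        rw [LinearMap.neg_apply, opDual_apply, LinearMap.sum_apply, LinearMap.sum_apply]
        exact eq_neg_of_add_eq_zero_left this
      have h7 := congrArg (LinearMap.range (opDual i)).mkQ h6
      rw [map_neg, map_sum] at h7
      simp only [map_smul, ha] at h7
      rw [AddSubmonoidClass.coe_finsetSum]
      simp only [Submodule.coe_smul]
      rw [h7, ZeroMemClass.coe_zero, neg_eq_zero]
      exact (Submodule.Quotient.mk_eq_zero _).2 ⟨_, rfl⟩
  exact hφ.op.extVanishes_of_baseChange hqL j (h L' j hj)

lemma subExtVanishes_of_baseChange [IsNoetherianRing B] [IsNoetherianRing Bᵐᵒᵖ]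
    (hq : IsBaseChangeOf q f) (k c : ℕ)
    (h : SubExtVanishes E N (k + 1) c) : SubExtVanishes B M (k + 1) c := by
  induction k generalizing M N n with
  | zero =>
    obtain ⟨m, g, hg⟩ := hq.exists_presentation_ker hφ.leftFlat
    rw [zero_add, subExtVanishes_one_iff hq.surj]
    rw [zero_add, subExtVanishes_one_iff hq.surj'] at h
    exact hφ.extVanishes_submodule_coker hg (LinearMap.ker f).subtype _ (fun x ↦ rfl) c h
  | succ k ih =>
    obtain ⟨m, g, hg⟩ := hq.exists_presentation_ker hφ.leftFlat
    rw [subExtVanishes_add_two_iff hq.surj]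
    rw [subExtVanishes_add_two_iff hq.surj'] at h
    exact ih hg h

omit hφ in
lemma exists_baseChange (φ : B →+* E) (M : Type v) [AddCommGroup M] [Module B M]
    [Module.Finite B M] : ∃ (N : Type w) (_ : AddCommGroup N) (_ : Module E N) (q : M →ₛₗ[φ] N)
      (n : ℕ) (f : (Fin n → B) →ₗ[B] M), Module.Finite E N ∧ IsBaseChangeOf q f := by
  obtain ⟨n, f, hf⟩ := Module.Finite.exists_fin' B M
  let K : Submodule E (Fin n → E) :=
    Submodule.span E (coordMap φ (Fin n) '' (LinearMap.ker f : Set (Fin n → B)))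
  let e : M ≃ₗ[B] (Fin n → B) ⧸ LinearMap.ker f := (f.quotKerEquivOfSurjective hf).symm
  let q' : (Fin n → B) ⧸ LinearMap.ker f →ₛₗ[φ] ((Fin n → E) ⧸ K) :=
    (LinearMap.ker f).liftQ (K.mkQ.comp (coordMap φ (Fin n))) fun x hx ↦
      (Submodule.Quotient.mk_eq_zero _).2 (Submodule.subset_span ⟨x, hx, rfl⟩)
  have hq' : ∀ c, (q'.comp e.toLinearMap) (f c) = K.mkQ (coordMap φ _ c) := fun c ↦ by
    have h1 : e (f c) = Submodule.Quotient.mk c := by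
      rw [LinearEquiv.symm_apply_eq]; rfl
    change q' (e (f c)) = _
    rw [h1]
    rfl
  have hb : baseMap (q'.comp e.toLinearMap) f = K.mkQ :=
    LinearMap.pi_ext' fun i ↦ LinearMap.ext_ring (by
      rw [LinearMap.comp_apply, LinearMap.single_apply, baseMap_single, hq', LinearMap.comp_apply,
        LinearMap.single_apply]
      congr 1
      ext j
      rw [coordMap_apply, Pi.single_apply, Pi.single_apply]
      split_ifs <;> simp)
  refine ⟨(Fin n → E) ⧸ K, inferInstance, inferInstance, q'.comp e.toLinearMap, n, f,
    inferInstance, hf, ?_, ?_⟩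
  · rw [hb]
    exact K.mkQ_surjective
  · rw [hb]
    exact fun y hy ↦ (Submodule.Quotient.mk_eq_zero _).1 hy

lemma globalDimension_le [IsNoetherianRing B] {d : ℕ} (h : globalDimension E ≤ d) :
    globalDimension B ≤ d := by
  refine globalDimension_le_of_finite fun M _ _ _ ↦ ?_
  obtain ⟨N, _, _, q, n, f, _, hq⟩ := exists_baseChange φ M
  exact hφ.hasProjectiveDimensionLT_of_baseChange hq d (globalDimension_le_iff.1 h N)

lemma auslanderCondition [IsNoetherianRing B] [IsNoetherianRing Bᵐᵒᵖ]
    (h : AuslanderCondition E) : AuslanderCondition B := by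
  rw [auslanderCondition_iff] at h ⊢
  intro M _ _ _ k
  obtain ⟨N, _, _, q, n, f, hfin, hq⟩ := exists_baseChange φ M
  exact hφ.subExtVanishes_of_baseChange hq k _ (h N hfin k)

/-- Auslander regularity descends along flat extensions with a bimodule retraction. -/
theorem isAuslanderRegular [IsNoetherianRing B] [IsNoetherianRing Bᵐᵒᵖ]
    (hE : IsAuslanderRegular E) : IsAuslanderRegular B := by
  have := isNoetherianRing_op_op (B := B)
  obtain ⟨d, hd⟩ := exists_globalDimension_le_of_lt_top hE.left_globalDimension
  obtain ⟨d', hd'⟩ := exists_globalDimension_le_of_lt_top hE.right_globalDimension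
  exact ⟨inferInstance, inferInstance,
    globalDimension_lt_top (hφ.globalDimension_le hd),
    globalDimension_lt_top (hφ.op.globalDimension_le hd'),
    hφ.auslanderCondition hE.left_condition, hφ.op.auslanderCondition hE.right_condition⟩

end IsFlatRetract

end

end AuslanderReg

end

noncomputable section

namespace AuslanderReg

/-! ### Commutative noetherian rings of finite global dimension -/

section CommNull

variable {G : Type u} [CommRing G]

/-- A module killed by an element outside of `p`. -/
def IsNull (p : Ideal G) (E : Type*) [AddCommGroup E] [Module G E] : Prop :=
  ∃ s ∉ p, ∀ e : E, s • e = 0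

/-- Nakayama at `p` without localizing: by Cayley-Hamilton a monic `P` with lower coefficients in
`(x)` satisfies `P(s) E = 0`, and `P(s)` is a power of `s` modulo `p`, so not in `p`. -/
lemma isNull_of_smul_mem {p : Ideal G} [p.IsPrime] {E : Type*} [AddCommGroup E] [Module G E]
    [Module.Finite G E] {s x : G} (hs : s ∉ p) (hx : x ∈ p)
    (h : ∀ e : E, ∃ e' : E, s • e = x • e') : IsNull p E := by
  obtain ⟨P, hP, -, hc, h0⟩ :=
    LinearMap.exists_monic_and_natDegree_eq_and_coeff_mem_pow_and_aeval_eq_zero G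
      (s • (LinearMap.id : E →ₗ[G] E)) (Ideal.span {x}) (by
        rintro _ ⟨e, rfl⟩
        obtain ⟨e', he'⟩ := h e
        rw [LinearMap.smul_apply, LinearMap.id_apply, he']
        exact Submodule.smul_mem_smul (Ideal.mem_span_singleton_self x) trivial)
  refine ⟨P.eval s, fun hmem ↦ hs ?_, fun e ↦ ?_⟩
  · rw [Polynomial.eval_eq_sum_range, Finset.sum_range_succ, hP.coeff_natDegree, one_mul] at hmem
    refine ‹p.IsPrime›.mem_of_pow_mem P.natDegree ((Ideal.add_mem_iff_right _ ?_).1 hmem)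
    refine Ideal.sum_mem _ fun i hi ↦ Ideal.mul_mem_right _ _ ?_
    refine (Ideal.span_singleton_le_iff_mem p).2 hx (Ideal.pow_le_self ?_ (hc i))
    have := Finset.mem_range.1 hi
    omega
  · have h1 := LinearMap.congr_fun h0 e
    have h2 : s • (LinearMap.id : E →ₗ[G] E) = algebraMap G (Module.End G E) s := rfl
    rw [h2, Polynomial.aeval_algebraMap_apply] at h1
    exact h1

lemma shortExact_of_exact {M₁ M₂ M₃ : Type u} [AddCommGroup M₁] [Module G M₁] [AddCommGroup M₂]
    [Module G M₂] [AddCommGroup M₃] [Module G M₃] {f : M₁ →ₗ[G] M₂} {g : M₂ →ₗ[G] M₃}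
    (hf : Function.Injective f) (hg : Function.Surjective g) (h : Function.Exact f g) :
    (ModuleCat.shortComplexOfCompEqZero f g h.linearMap_comp_eq_zero).ShortExact :=
  ModuleCat.shortComplex_shortExact _ h hf hg

lemma isNull_ext_of_exact {p : Ideal G} [p.IsPrime] {M : ModuleCat.{u} G} {i : ℕ}
    {S : ShortComplex (ModuleCat.{u} G)} (hS : S.ShortExact)
    (h1 : IsNull p (Ext.{u} S.X₁ M i)) (h3 : IsNull p (Ext.{u} S.X₃ M i)) :
    IsNull p (Ext.{u} S.X₂ M i) := by
  obtain ⟨s, hs, h1⟩ := h1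
  obtain ⟨t, ht, h3⟩ := h3
  refine ⟨t * s, fun h ↦ (‹p.IsPrime›.mem_or_mem h).elim ht hs, fun e ↦ ?_⟩
  obtain ⟨y, hy⟩ := Ext.contravariant_sequence_exact₂ hS M (s • e) (by rw [Ext.comp_smul, h1])
  rw [mul_smul, ← hy, ← Ext.comp_smul, h3, Ext.comp_zero]

lemma isNull_ext_X₁ {p : Ideal G} [p.IsPrime] {M : ModuleCat.{u} G} {i : ℕ}
    {S : ShortComplex (ModuleCat.{u} G)} (hS : S.ShortExact)
    (h2 : Subsingleton (Ext.{u} S.X₂ M i)) (h3 : IsNull p (Ext.{u} S.X₃ M (i + 1))) :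
    IsNull p (Ext.{u} S.X₁ M i) := by
  obtain ⟨t, ht, h3⟩ := h3
  refine ⟨t, ht, fun e ↦ ?_⟩
  obtain ⟨y, hy⟩ := Ext.contravariant_sequence_exact₁ hS M (t • e) (add_comm 1 i)
    (by rw [Ext.comp_smul, h3])
  rw [← hy, h2.elim y 0, Ext.comp_zero]

lemma exists_shortExact_smul {N : ModuleCat.{u} G} {x : G} (hreg : IsSMulRegular N x) :
    ∃ (g : N ⟶ ModuleCat.of G (QuotSMulTop x N)) (w : (x • 𝟙 N) ≫ g = 0),
      (ShortComplex.mk (x • 𝟙 N) g w).ShortExact :=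
  ⟨_, _, hreg.smulShortComplex_shortExact⟩

lemma smul_ext_eq_zero {N M : ModuleCat.{u} G} {x : G} (hx : ∀ n : N, x • n = 0) {i : ℕ}
    (y : Ext.{u} N M i) : x • y = 0 := by
  have h1 : x • 𝟙 N = 0 := by
    ext z
    exact hx z
  rw [← Ext.mk₀_id_comp y, ← Ext.smul_comp, ← Ext.mk₀_smul, h1, Ext.mk₀_zero, Ext.zero_comp]

variable [IsNoetherianRing G]

/-- The sequence `N → N → N / x N` gives `t Ext^i(N, M) ⊆ x Ext^i(N, M)` for a `t` outside `p`, and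
`isNull_of_smul_mem` applies. -/
lemma isNull_ext_of_smul {p : Ideal G} [p.IsPrime] {N M : ModuleCat.{u} G} [Module.Finite G N]
    [Module.Finite G M] {i : ℕ} {x : G} (hx : x ∈ p) (hreg : IsSMulRegular N x)
    (h3 : IsNull p (Ext.{u} (ModuleCat.of G (QuotSMulTop x N)) M (i + 1))) :
    IsNull p (Ext.{u} N M i) := by
  obtain ⟨t, ht, h3⟩ := h3
  refine isNull_of_smul_mem ht hx fun e ↦ ?_
  obtain ⟨g, w, hS⟩ := exists_shortExact_smul hreg
  obtain ⟨y, hy⟩ := Ext.contravariant_sequence_exact₁ hS M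
    (t • e) (add_comm 1 i) (by rw [Ext.comp_smul, h3])
  refine ⟨y, ?_⟩
  rw [← hy, Ext.mk₀_smul, Ext.smul_comp, Ext.mk₀_id_comp]

/-- If `G ⧸ p` embeds into a module of projective dimension at most `j`, then `Ext` groups of
finitely generated modules vanish at `p` in degrees above `j`. -/
lemma isNull_ext {D : ℕ} (hD : globalDimension G ≤ D) {p : Ideal G} [p.IsPrime]
    {Q : Type u} [AddCommGroup Q] [Module G Q] [Module.Finite G Q] {j : ℕ}
    (hQ : HasProjectiveDimensionLT (ModuleCat.of G Q) (j + 1))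
    {g : (G ⧸ p) →ₗ[G] Q} (hg : Function.Injective g) (i : ℕ) (hi : j < i)
    (N M : Type u) [AddCommGroup N] [Module G N] (hN : Module.Finite G N)
    [AddCommGroup M] [Module G M] [Module.Finite G M] :
    IsNull p (Ext.{u} (ModuleCat.of G N) (ModuleCat.of G M) i) := by
  -- Descending induction on `i`, starting above `D` where `Ext` vanishes; for fixed `i`, a prime
  -- filtration reduces to `N = G ⧸ q`.
  induction hn : D + 1 - i generalizing i N M with
  | zero =>
    have := globalDimension_le_iff.1 hD N
    have := HasProjectiveDimensionLT.subsingleton (ModuleCat.of G N) (D + 1) i (by omega)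
      (ModuleCat.of G M)
    exact ⟨1, p.primeCompl.one_mem, fun e ↦ Subsingleton.elim _ _⟩
  | succ n ih =>
    have ih' := fun (N : Type u) [AddCommGroup N] [Module G N] (hN : Module.Finite G N) ↦
      ih (i + 1) (by omega) N M hN (by omega)
    induction hN using IsNoetherianRing.induction_on_isQuotientEquivQuotientPrime G with
    | subsingleton N =>
      have := (ModuleCat.isZero_of_subsingleton (ModuleCat.of G N)).hasProjectiveDimensionLT_zero
      have := HasProjectiveDimensionLT.subsingleton (ModuleCat.of G N) 0 i (by omega)
        (ModuleCat.of G M)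
      exact ⟨1, p.primeCompl.one_mem, fun e ↦ Subsingleton.elim _ _⟩
    | exact N₁ N₂ N₃ f g' hf hg' hfg h1 h3 =>
      exact isNull_ext_of_exact (shortExact_of_exact hf hg' hfg) h1 h3
    | quotient N q e =>
      by_cases hqp : q.1 ≤ p
      · by_cases hpq : p ≤ q.1
        · have hpq' : q.1 = p := le_antisymm hqp hpq
          obtain ⟨q, hq⟩ := q
          subst hpq'
          -- Case `q = p`: `N` embeds in `Q`, whose `Ext^i` vanishes, so `Ext^i` of `N` injects into
          -- `Ext^(i+1)` of the cokernel.
          have hinj : Function.Injective (g ∘ₗ e.toLinearMap) := hg.comp e.injective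
          refine isNull_ext_X₁ (shortExact_of_exact hinj (Submodule.mkQ_surjective _)
            (LinearMap.exact_map_mkQ_range _)) ?_ (ih' _ inferInstance)
          exact HasProjectiveDimensionLT.subsingleton (ModuleCat.of G Q) (j + 1) i (by omega) _
        -- Case `q` strictly inside `p`: an element of `p` outside `q` is regular on `G ⧸ q`.
        · obtain ⟨x, hxp, hxq⟩ := SetLike.not_le_iff_exists.1 hpq
          refine isNull_ext_of_smul (N := ModuleCat.of G N) (M := ModuleCat.of G M) hxp ?_
            (ih' _ inferInstance)
          refine isSMulRegular_iff_right_eq_zero_of_smul.2 fun y hy ↦ ?_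
          apply e.injective
          have h1 : e (x • y) = e 0 := congrArg e hy
          rw [map_smul] at h1
          rw [map_zero] at h1 ⊢
          obtain ⟨z, hz⟩ := Ideal.Quotient.mk_surjective (e y)
          rw [← hz] at h1 ⊢
          rw [Ideal.Quotient.eq_zero_iff_mem]
          exact (q.2.mem_or_mem (Ideal.Quotient.eq_zero_iff_mem.1 h1)).resolve_left hxq
      -- Case `q` not contained in `p`: an element of `q` outside `p` kills `N` and hence its `Ext`
      -- groups.
      · obtain ⟨s, hs, hsp⟩ := SetLike.not_le_iff_exists.1 hqp
        refine ⟨s, hsp, smul_ext_eq_zero fun y ↦ e.injective ?_⟩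
        change e (s • y) = e 0
        rw [map_smul, map_zero]
        obtain ⟨z, hz⟩ := Ideal.Quotient.mk_surjective (e y)
        rw [← hz]
        exact Ideal.Quotient.eq_zero_iff_mem.2 (q.1.mul_mem_right _ hs)

/-- Otherwise prime avoidance puts the annihilator of `Ext^k` inside an associated prime `p` of `Q`;
but `G ⧸ p` embeds in `Q`, so by `isNull_ext` some element outside `p` kills `Ext^k`. -/
lemma exists_isSMulRegular {D : ℕ} (hD : globalDimension G ≤ D) {Q N M : Type u} [AddCommGroup Q]
    [Module G Q] [Module.Finite G Q] [AddCommGroup N] [Module G N] [Module.Finite G N]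
    [AddCommGroup M] [Module G M] [Module.Finite G M] {j k : ℕ} (hjk : j < k)
    (hQ : HasProjectiveDimensionLT (ModuleCat.of G Q) (j + 1)) :
    ∃ x ∈ Module.annihilator G (Ext.{u} (ModuleCat.of G N) (ModuleCat.of G M) k),
      IsSMulRegular Q x := by
  by_contra! h
  obtain ⟨p, hp, hle⟩ := (Ideal.subset_union_prime_finite (f := id)
    (I := Module.annihilator G (Ext.{u} (ModuleCat.of G N) (ModuleCat.of G M) k))
    (associatedPrimes.finite G Q) 0 0 fun q hq _ _ ↦ IsAssociatedPrime.isPrime hq).1 (by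
      simp_rw [id, biUnion_associatedPrimes_eq_compl_regular]
      exact fun x hx ↦ h x hx)
  have := hp.isPrime
  obtain ⟨g, hg⟩ := (isAssociatedPrime_iff_exists_injective_linearMap p Q).1 hp |>.2
  obtain ⟨s, hs, h0⟩ := isNull_ext hD hQ hg k hjk N M inferInstance
  exact hs (hle (Module.mem_annihilator.2 h0))

/-- A `Q`-regular element `x` killing `L` embeds `Ext^i` into `Q ⧸ xQ` in degree `i - 1`. Passing to
`Q ⧸ xQ` raises the bound on projective dimension by one, so `i + j` is constant until degree `0`,
where regularity kills all homomorphisms. -/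
lemma subsingleton_ext_of_annihilator {D : ℕ} (hD : globalDimension G ≤ D) {N M : Type u}
    [AddCommGroup N] [Module G N] [Module.Finite G N]
    [AddCommGroup M] [Module G M] [Module.Finite G M] {k : ℕ}
    {L : Type u} [AddCommGroup L] [Module G L]
    (hL : Module.annihilator G (Ext.{u} (ModuleCat.of G N) (ModuleCat.of G M) k) ≤
      Module.annihilator G L) (i : ℕ)
    (Q : Type u) [AddCommGroup Q] [Module G Q] [Module.Finite G Q] (j : ℕ) (hij : i + j < k)
    (hQ : HasProjectiveDimensionLT (ModuleCat.of G Q) (j + 1)) :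
    Subsingleton (Ext.{u} (ModuleCat.of G L) (ModuleCat.of G Q) i) := by
  induction i generalizing Q j with
  | zero =>
    obtain ⟨x, hx, hreg⟩ := exists_isSMulRegular (N := N) (M := M) hD (by omega : j < k) hQ
    refine (Ext.addEquiv₀.trans ModuleCat.homAddEquiv).subsingleton_congr.2
      (subsingleton_of_forall_eq 0 fun f ↦ LinearMap.ext fun z ↦ hreg ?_)
    have h1 : x • z = 0 := Module.mem_annihilator.1 (hL hx) z
    exact ((map_smul f x z).symm.trans (by rw [h1, map_zero])).trans (smul_zero x).symm
  | succ i ih =>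
    obtain ⟨x, hx, hreg⟩ := exists_isSMulRegular (N := N) (M := M) hD (by omega : j < k) hQ
    obtain ⟨g, w, hS⟩ := exists_shortExact_smul (N := ModuleCat.of G Q) hreg
    have h3 : Subsingleton (Ext.{u} (ModuleCat.of G L) (ModuleCat.of G (QuotSMulTop x Q)) i) :=
      ih (QuotSMulTop x Q) (j + 1) (by omega)
        (hS.hasProjectiveDimensionLT_X₃ (j + 1) hQ (hasProjectiveDimensionLT_of_ge
          (ModuleCat.of G Q) (j + 1) _ (by omega)))
    refine subsingleton_of_forall_eq 0 fun y ↦ ?_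
    obtain ⟨z, hz⟩ := Ext.covariant_sequence_exact₁ (ModuleCat.of G L) hS y
      (by rw [Ext.mk₀_smul, Ext.comp_smul, Ext.comp_mk₀_id,
        smul_ext_eq_zero (Module.mem_annihilator.1 (hL hx))]) rfl
    rw [← hz, h3.elim z 0, Ext.zero_comp]

end CommNull


/-! ### Transport of `Ext` vanishing along ring isomorphisms -/

section Transport

universe v w

variable {B : Type v} {E : Type w} [Ring B] [Ring E]

lemma LeftFlat.of_bijective {φ : B →+* E} (hφ : Function.Bijective φ) : LeftFlat φ := by
  intro κ κ' _ _ a e h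
  choose b hb using fun i ↦ hφ.2 (e i)
  refine ⟨1, fun _ ↦ b, fun _ ↦ 1, fun _ j ↦ hφ.1 ?_, fun i ↦ by simp [hb]⟩
  rw [map_sum, map_zero, ← h j]
  simp [hb]

lemma IsFlatRetract.of_ringEquiv (e : B ≃+* E) :
    IsFlatRetract (e : B →+* E) (e.symm : E →+ B) where
  map_mul_left b x := by simp
  map_mul_right b x := by simp
  map_one := by simp
  leftFlat := .of_bijective e.bijective
  rightFlat := .of_bijective e.op.bijective

lemma IsBaseChangeOf.of_bijective {φ : B →+* E} (hφ : Function.Bijective φ) {M : Type v}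
    {N : Type w} [AddCommGroup M] [Module B M] [AddCommGroup N] [Module E N] {q : M →ₛₗ[φ] N}
    (hq : Function.Bijective q) {n : ℕ} {f : (Fin n → B) →ₗ[B] M} (hf : Function.Surjective f) :
    IsBaseChangeOf q f := by
  have hsurj : Function.Surjective (coordMap φ (Fin n)) := fun y ↦ by
    choose b hb using fun i ↦ hφ.2 (y i)
    exact ⟨b, funext hb⟩
  refine ⟨hf, fun y ↦ ?_, fun y hy ↦ ?_⟩
  · obtain ⟨x, rfl⟩ := hq.2 y
    obtain ⟨z, rfl⟩ := hf x
    exact ⟨_, baseMap_coordMap q f z⟩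
  · obtain ⟨x, rfl⟩ := hsurj y
    rw [baseMap_coordMap] at hy
    exact Submodule.subset_span ⟨x, hq.1 (hy.trans (map_zero q).symm), rfl⟩

lemma ExtVanishes.of_ringEquiv [IsNoetherianRing B] (e : B ≃+* E) {M : Type v} {N : Type w}
    [AddCommGroup M] [Module B M] [Module.Finite B M] [AddCommGroup N] [Module E N]
    {q : M →ₛₗ[(e : B →+* E)] N} (hq : Function.Bijective q) {j : ℕ} (h : ExtVanishes E N j) :
    ExtVanishes B M j := by
  obtain ⟨n, f, hf⟩ := Module.Finite.exists_fin' B M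
  exact (IsFlatRetract.of_ringEquiv e).extVanishes_of_baseChange
    (IsBaseChangeOf.of_bijective e.bijective hq hf) j h

end Transport

/-! ### Auslander regularity of commutative noetherian rings of finite global dimension -/

section Comm

variable {G : Type u} [CommRing G]

lemma extSelf_op_smul_eq (N : ModuleCat.{u} G) (k : ℕ) (x : G) (y : ExtSelf G N k) :
    MulOpposite.op x • y = x • (show Ext.{u} N (ModuleCat.of G G) k from y) := by
  rw [extSelf_smul_def, Ext.smul_eq_comp_mk₀]
  congr 2
  ext
  simp [rightMul]

variable [IsNoetherianRing G]

/-- A submodule `L` of `Ext^k(N, G)` is killed by its annihilator, so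
`subsingleton_ext_of_annihilator` applies with `Q = G`, `j = 0`. The rest identifies right with left
modules. -/
lemma auslanderCondition_of_comm {D : ℕ} (hD : globalDimension G ≤ D) : AuslanderCondition G := by
  intro N hN k L
  rw [le_moduleGrade_iff]
  intro j hj
  have hfin : Module.Finite G (Ext.{u} N (ModuleCat.of G G) k) := inferInstance
  let e : Gᵐᵒᵖ ≃+* G := (RingEquiv.toOpposite G).symm
  let : Module G L := Module.compHom L (RingEquiv.toOpposite G : G →+* Gᵐᵒᵖ)
  have hsmul : ∀ (x : G) (l : L), x • l = MulOpposite.op x • l := fun _ _ ↦ rfl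
  let q : L →ₛₗ[(e : Gᵐᵒᵖ →+* G)] L :=
    { toFun := id, map_add' := fun _ _ ↦ rfl, map_smul' := fun _ _ ↦ rfl }
  have : IsNoetherianRing Gᵐᵒᵖ := isNoetherianRing_of_ringEquiv G (RingEquiv.toOpposite G)
  have hn : Module.Finite Gᵐᵒᵖ (ExtSelf G N k) := by
    let q' : Ext.{u} N (ModuleCat.of G G) k →ₛₗ[(RingEquiv.toOpposite G : G →+* Gᵐᵒᵖ)]
        ExtSelf G N k :=
      { toFun := id, map_add' := fun _ _ ↦ rfl,
        map_smul' := fun x y ↦ (extSelf_op_smul_eq N k x y).symm }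
    have : RingHomSurjective (RingEquiv.toOpposite G : G →+* Gᵐᵒᵖ) :=
      ⟨(RingEquiv.toOpposite G).surjective⟩
    exact Module.Finite.of_surjective q' Function.surjective_id
  refine ExtVanishes.of_ringEquiv e (q := q) Function.bijective_id ?_
  exact subsingleton_ext_of_annihilator (N := N) (M := G) (k := k) hD (fun x hx ↦
    Module.mem_annihilator.2 fun l ↦ Subtype.ext ((extSelf_op_smul_eq N k x l).trans
      (Module.mem_annihilator.1 hx _))) j G 0 (by omega)
      (hasProjectiveDimensionLT_one_iff.2 inferInstance)

/-- Commutative noetherian rings of finite global dimension are Auslander regular. -/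
theorem isAuslanderRegular_of_comm {D : ℕ} (hD : globalDimension G ≤ D) :
    IsAuslanderRegular G := by
  have : IsNoetherianRing Gᵐᵒᵖ := isNoetherianRing_of_ringEquiv G (RingEquiv.toOpposite G)
  have hD' := globalDimension_le_of_ringEquiv (RingEquiv.toOpposite G) hD
  exact ⟨inferInstance, inferInstance, globalDimension_lt_top hD, globalDimension_lt_top hD',
    auslanderCondition_of_comm hD, auslanderCondition_of_comm hD'⟩

end Comm

end AuslanderReg

end

noncomputable section

namespace AuslanderReg

/-! ### Global dimension of polynomial rings -/

section PolynomialRing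

variable {S : Type u} [CommRing S]

lemma shortExact_baseChange {T : Type u} [CommRing T] [Algebra S T] [Module.Flat S T]
    {P M : Type u} [AddCommGroup P] [Module S P] [AddCommGroup M] [Module S M] {f : P →ₗ[S] M}
    (hf : Function.Surjective f) :
    ∃ w, (ShortComplex.mk (ModuleCat.ofHom ((LinearMap.ker f).subtype.baseChange T))
      (ModuleCat.ofHom (f.baseChange T)) w).ShortExact := by
  have hex : Function.Exact ((LinearMap.ker f).subtype.lTensor T) (f.lTensor T) :=
    lTensor_exact T (LinearMap.exact_subtype_ker_map f) hf
  exact ⟨_, shortExact_of_exact (G := T)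
    (f := (LinearMap.ker f).subtype.baseChange T) (g := f.baseChange T)
    (Module.Flat.lTensor_preserves_injective_linearMap (M := T) (LinearMap.ker f).subtype
      (Submodule.subtype_injective _)) (LinearMap.lTensor_surjective T hf) hex⟩

lemma hasProjectiveDimensionLT_baseChange {T : Type u} [CommRing T] [Algebra S T] [Module.Flat S T]
    (d : ℕ) (M : Type u) [AddCommGroup M] [Module S M]
    (h : HasProjectiveDimensionLT (ModuleCat.of S M) (d + 1)) :
    HasProjectiveDimensionLT (ModuleCat.of T (T ⊗[S] M)) (d + 1) := by
  induction d generalizing M with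
  | zero =>
    rw [zero_add, hasProjectiveDimensionLT_one_iff] at *
    infer_instance
  | succ d ih =>
    obtain ⟨f, hf⟩ : ∃ f : (M →₀ S) →ₗ[S] M, Function.Surjective f :=
      ⟨_, Finsupp.linearCombination_id_surjective S M⟩
    rw [hasProjectiveDimensionLT_add_two_iff hf] at h
    obtain ⟨w, hS⟩ := shortExact_baseChange (T := T) hf
    have hP : HasProjectiveDimensionLT (ModuleCat.of T (T ⊗[S] (M →₀ S))) 1 :=
      hasProjectiveDimensionLT_one_iff.2 inferInstance
    exact hS.hasProjectiveDimensionLT_X₃ (d + 1) (ih _ h)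
      (hasProjectiveDimensionLT_of_ge (ModuleCat.of T (T ⊗[S] (M →₀ S))) 1 _ (by omega))

variable {M : Type u} [AddCommGroup M] [Module S M] [Module S[X] M] [IsScalarTower S S[X] M]

open Polynomial

variable (S M) in
/-- Multiplication by `X` on an `S[X]`-module. -/
def xEnd : M →ₗ[S] M where
  toFun m := (X : S[X]) • m
  map_add' _ _ := smul_add _ _ _
  map_smul' s m := by
    rw [RingHom.id_apply, ← algebraMap_smul S[X] s m, ← algebraMap_smul S[X] s, smul_smul,
      smul_smul, mul_comm]

variable (S M) in
/-- The endomorphism `X ⊗ 1 - 1 ⊗ X` of `S[X] ⊗ M`. -/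
def polyDelta : S[X] ⊗[S] M →ₗ[S[X]] S[X] ⊗[S] M :=
  (X : S[X]) • LinearMap.id - (xEnd S M).baseChange S[X]

variable (S M) in
/-- The action map `S[X] ⊗ M → M`. -/
def polyAct : S[X] ⊗[S] M →ₗ[S[X]] M := LinearMap.liftBaseChange S[X] LinearMap.id

lemma polyDelta_tmul (p : S[X]) (m : M) :
    polyDelta S M (p ⊗ₜ m) = (X * p) ⊗ₜ m - p ⊗ₜ ((X : S[X]) • m) := by
  simp [polyDelta, xEnd, TensorProduct.smul_tmul']

lemma polyAct_tmul (p : S[X]) (m : M) : polyAct S M (p ⊗ₜ m) = p • m := by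
  simp [polyAct]

lemma polyAct_polyDelta (z : S[X] ⊗[S] M) : polyAct S M (polyDelta S M z) = 0 := by
  induction z with
  | zero => simp
  | add x y hx hy => rw [map_add, map_add, hx, hy, add_zero]
  | tmul p m => rw [polyDelta_tmul, map_sub, polyAct_tmul, polyAct_tmul, smul_smul, mul_comm,
      sub_self]

/-- Modulo the image of `polyDelta`, powers of `X` move across the tensor sign. This gives exactness
in the middle of the characteristic sequence. -/
lemma sub_one_tmul_mem_range (z : S[X] ⊗[S] M) :
    z - 1 ⊗ₜ polyAct S M z ∈ LinearMap.range (polyDelta S M) := by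
  induction z with
  | zero => simp
  | add x y hx hy =>
    have := add_mem hx hy
    rwa [map_add, TensorProduct.tmul_add, add_sub_add_comm]
  | tmul p m =>
    rw [polyAct_tmul]
    induction p using Polynomial.induction_on' generalizing m with
    | add p q hp hq =>
      rw [TensorProduct.add_tmul, add_smul, TensorProduct.tmul_add, add_sub_add_comm]
      exact add_mem (hp m) (hq m)
    | monomial n a =>
      induction n generalizing m with
      | zero =>
        have : (monomial 0 a : S[X]) ⊗ₜ[S] m = 1 ⊗ₜ ((monomial 0 a : S[X]) • m) := by
          rw [monomial_zero_left, ← algebraMap_eq, algebraMap_smul, TensorProduct.tmul_smul,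
            TensorProduct.smul_tmul', Algebra.smul_def, mul_one]
        rw [this, sub_self]
        exact zero_mem _
      | succ n ih =>
        have h1 : (monomial (n + 1) a : S[X]) = X * monomial n a := by
          rw [X_mul_monomial]
        have h2 := add_mem (ih ((X : S[X]) • m)) (LinearMap.mem_range_self (polyDelta S M)
          ((monomial n a : S[X]) ⊗ₜ m))
        rw [polyDelta_tmul, ← h1, smul_smul, mul_comm, ← h1] at h2
        convert h2 using 1
        abel

variable (S M) in
/-- The coefficients of an element of `S[X] ⊗ M`. -/
def tensorCoeff (i : ℕ) : S[X] ⊗[S] M →ₗ[S] M :=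
  (TensorProduct.lid S M).toLinearMap ∘ₗ (lcoeff S i).rTensor M

omit [Module S[X] M] [IsScalarTower S S[X] M] in
lemma tensorCoeff_tmul (i : ℕ) (p : S[X]) (m : M) :
    tensorCoeff S M i (p ⊗ₜ m) = p.coeff i • m := by
  simp [tensorCoeff]

lemma tensorCoeff_polyDelta (i : ℕ) (z : S[X] ⊗[S] M) :
    tensorCoeff S M (i + 1) (polyDelta S M z) =
      tensorCoeff S M i z - (X : S[X]) • tensorCoeff S M (i + 1) z := by
  induction z with
  | zero => simp
  | add x y hx hy =>
    simp only [map_add, hx, hy, smul_add]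
    abel
  | tmul p m =>
    rw [polyDelta_tmul, map_sub, tensorCoeff_tmul, tensorCoeff_tmul, tensorCoeff_tmul,
      tensorCoeff_tmul, coeff_X_mul]
    congr 1
    exact ((xEnd S M).map_smul (p.coeff (i + 1)) m).symm

omit [Module S[X] M] [IsScalarTower S S[X] M] in
lemma exists_tensorCoeff_sum (z : S[X] ⊗[S] M) : ∃ N, ∀ n ≥ N,
    z = ∑ i ∈ Finset.range n, (X ^ i : S[X]) ⊗ₜ tensorCoeff S M i z ∧
      tensorCoeff S M n z = 0 := by
  induction z with
  | zero => exact ⟨0, fun n _ ↦ by simp⟩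
  | add x y hx hy =>
    obtain ⟨N, hN⟩ := hx
    obtain ⟨N', hN'⟩ := hy
    refine ⟨max N N', fun n hn ↦ ⟨?_, ?_⟩⟩
    · conv_lhs => rw [(hN n (le_trans (le_max_left _ _) hn)).1,
        (hN' n (le_trans (le_max_right _ _) hn)).1]
      simp only [map_add, TensorProduct.tmul_add, Finset.sum_add_distrib]
    · rw [map_add, (hN n (le_trans (le_max_left _ _) hn)).2,
        (hN' n (le_trans (le_max_right _ _) hn)).2, add_zero]
  | tmul p m =>
    refine ⟨p.natDegree + 1, fun n hn ↦ ⟨?_, ?_⟩⟩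
    · conv_lhs => rw [p.as_sum_range' n (by omega), TensorProduct.sum_tmul]
      refine Finset.sum_congr rfl fun i _ ↦ ?_
      rw [tensorCoeff_tmul, TensorProduct.tmul_smul, TensorProduct.smul_tmul',
        ← C_mul_X_pow_eq_monomial,
        smul_eq_C_mul]
    · rw [tensorCoeff_tmul, coeff_eq_zero_of_natDegree_lt (by omega), zero_smul]

/-- For `z` in the kernel the coefficients satisfy `z_i = X z_{i+1}` and vanish for large `i`, hence
all vanish by descending induction. -/
lemma polyDelta_injective : Function.Injective (polyDelta S M) := by
  rw [injective_iff_map_eq_zero]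
  intro z hz
  obtain ⟨N, hN⟩ := exists_tensorCoeff_sum z
  have h1 : ∀ i, tensorCoeff S M i z = (X : S[X]) • tensorCoeff S M (i + 1) z := fun i ↦ by
    rw [← sub_eq_zero, ← tensorCoeff_polyDelta, hz, map_zero]
  have h2 : ∀ i ≤ N, tensorCoeff S M (N - i) z = 0 := fun i ↦ by
    induction i with
    | zero => exact fun _ ↦ (hN N le_rfl).2
    | succ i ih =>
      intro hi
      rw [h1, show N - (i + 1) + 1 = N - i by omega, ih (by omega), smul_zero]
  rw [(hN N le_rfl).1]
  refine Finset.sum_eq_zero fun i hi ↦ ?_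
  have := h2 (N - i) (by omega)
  rw [Nat.sub_sub_self (Finset.mem_range.1 hi).le] at this
  rw [this, TensorProduct.tmul_zero]

/-- The characteristic sequence `0 → S[X] ⊗ M → S[X] ⊗ M → M → 0` costs one dimension, and flat base
change does not increase projective dimension. -/
lemma globalDimension_polynomial_le {d : ℕ} (h : globalDimension S ≤ d) :
    globalDimension S[X] ≤ (d + 1 : ℕ) := by
  rw [globalDimension_le_iff] at h ⊢
  intro M _ _
  let : Module S M := Module.compHom M (algebraMap S S[X])
  have : IsScalarTower S S[X] M := IsScalarTower.of_algebraMap_smul fun _ _ ↦ rfl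
  have hS := shortExact_of_exact (polyDelta_injective (S := S) (M := M))
    (g := polyAct S M) (fun m ↦ ⟨1 ⊗ₜ m, by rw [polyAct_tmul, one_smul]⟩) (fun z ↦ by
      refine ⟨fun hz ↦ ?_, ?_⟩
      · have := sub_one_tmul_mem_range z
        rwa [hz, TensorProduct.tmul_zero, sub_zero] at this
      · rintro ⟨y, rfl⟩
        exact polyAct_polyDelta y)
  have h1 := hasProjectiveDimensionLT_baseChange (T := S[X]) d M (h M)
  exact hS.hasProjectiveDimensionLT_X₃ (d + 1) h1
    (hasProjectiveDimensionLT_of_ge (ModuleCat.of S[X] (S[X] ⊗[S] M)) (d + 1) _ (by omega))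

lemma globalDimension_mvPolynomial_le {d : ℕ} (h : globalDimension S ≤ d) (r : ℕ) :
    globalDimension (MvPolynomial (Fin r) S) ≤ (d + r : ℕ) := by
  induction r with
  | zero =>
    exact globalDimension_le_of_ringEquiv
      (MvPolynomial.isEmptyAlgEquiv S (Fin 0)).symm.toRingEquiv h
  | succ r ih =>
    exact globalDimension_le_of_ringEquiv (MvPolynomial.finSuccEquiv S r).symm.toRingEquiv
      (globalDimension_polynomial_le ih)

end PolynomialRing

end AuslanderReg

end

noncomputable section

namespace AuslanderReg

/-! ### Filtered rings with commutative noetherian associated graded ring -/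

universe v w

/-- `F` is an exhaustive ring filtration of `B`, and `σ i : F i → G` are symbol maps, identifying
`G` with the associated graded ring; `γ i` is the projection of `G` to its component of
degree `i`. -/
structure IsSymbolMap {B : Type v} {G : Type w} [Ring B] [CommRing G] (F : ℕ → AddSubgroup B)
    (σ : ℕ → B → G) (γ : ℕ → G →+ G) : Prop where
  mono : Monotone F
  protected one_mem : 1 ∈ F 0
  protected mul_mem : ∀ {i j x y}, x ∈ F i → y ∈ F j → x * y ∈ F (i + j)
  exh : ∀ x, ∃ i, x ∈ F i
  protected map_add : ∀ {i x y}, x ∈ F i → y ∈ F i → σ i (x + y) = σ i x + σ i y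
  protected map_mul : ∀ {i j x y}, x ∈ F i → y ∈ F j → σ (i + j) (x * y) = σ i x * σ j y
  protected map_one : σ 0 1 = 1
  zero_iff : ∀ {x}, x ∈ F 0 → (σ 0 x = 0 ↔ x = 0)
  succ_iff : ∀ {i x}, x ∈ F (i + 1) → (σ (i + 1) x = 0 ↔ x ∈ F i)
  comp_symbol : ∀ {i x} j, x ∈ F i → γ j (σ i x) = if i = j then σ i x else 0
  exists_symbol : ∀ i g, ∃ x ∈ F i, σ i x = γ i g
  sum_comp : ∀ g, ∃ N, ∀ n ≥ N, g = ∑ i ∈ Finset.range n, γ i g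

namespace IsSymbolMap

variable {B : Type v} {G : Type w} [Ring B] [CommRing G] {F : ℕ → AddSubgroup B}
  {σ : ℕ → B → G} {γ : ℕ → G →+ G}

lemma op (h : IsSymbolMap F σ γ) : IsSymbolMap (B := Bᵐᵒᵖ)
    (fun i ↦ (F i).comap (MulOpposite.opAddEquiv (α := B)).symm.toAddMonoidHom)
    (fun i x ↦ σ i x.unop) γ where
  mono i j hij x hx := h.mono hij hx
  one_mem := h.one_mem
  mul_mem {i j x y} hx hy := by
    have := h.mul_mem (show y.unop ∈ F j from hy) (show x.unop ∈ F i from hx)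
    rwa [add_comm] at this
  exh x := h.exh x.unop
  map_add hx hy := h.map_add hx hy
  map_mul {i j x y} hx hy := by
    have := h.map_mul (show y.unop ∈ F j from hy) (show x.unop ∈ F i from hx)
    rwa [add_comm, mul_comm] at this
  map_one := h.map_one
  zero_iff hx := (h.zero_iff hx).trans (MulOpposite.unop_eq_zero_iff _)
  succ_iff hx := h.succ_iff hx
  comp_symbol j hx := h.comp_symbol j hx
  exists_symbol i g := by
    obtain ⟨x, hx, hg⟩ := h.exists_symbol i g
    exact ⟨.op x, hx, hg⟩
  sum_comp := h.sum_comp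

variable (h : IsSymbolMap F σ γ)

include h

protected lemma map_zero (i : ℕ) : σ i 0 = 0 := by
  have := h.map_add (i := i) (zero_mem _) (zero_mem _)
  simpa using this

protected lemma map_neg {i : ℕ} {x : B} (hx : x ∈ F i) : σ i (-x) = -σ i x := by
  rw [eq_neg_iff_add_eq_zero, ← h.map_add (neg_mem hx) hx, neg_add_cancel, h.map_zero]

protected lemma map_sub {i : ℕ} {x y : B} (hx : x ∈ F i) (hy : y ∈ F i) :
    σ i (x - y) = σ i x - σ i y := by
  rw [sub_eq_add_neg, h.map_add hx (neg_mem hy), h.map_neg hy, sub_eq_add_neg]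

protected lemma map_sum {ι : Type*} (s : Finset ι) {i : ℕ} {x : ι → B} (hx : ∀ k ∈ s, x k ∈ F i) :
    σ i (∑ k ∈ s, x k) = ∑ k ∈ s, σ i (x k) := by
  induction s using Finset.cons_induction with
  | empty => simp [h.map_zero]
  | cons a s ha ih =>
    rw [Finset.sum_cons, Finset.sum_cons, h.map_add (hx _ (Finset.mem_cons_self _ _))
      (sum_mem fun k hk ↦ hx k (Finset.mem_cons_of_mem hk)),
      ih fun k hk ↦ hx k (Finset.mem_cons_of_mem hk)]

lemma comp_mul {d : ℕ} {z : B} (hz : z ∈ F d) (i : ℕ) (g : G) :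
    γ i (g * σ d z) = if d ≤ i then γ (i - d) g * σ d z else 0 := by
  obtain ⟨N, hN⟩ := h.sum_comp g
  have h1 : ∀ j, γ i (γ j g * σ d z) = if j + d = i then γ j g * σ d z else 0 := fun j ↦ by
    obtain ⟨x, hx, hg⟩ := h.exists_symbol j g
    rw [← hg, ← h.map_mul hx hz, h.comp_symbol _ (h.mul_mem hx hz)]
  conv_lhs => rw [hN (max N (i + 1)) (le_max_left _ _), Finset.sum_mul, _root_.map_sum]
  simp only [h1]
  split_ifs with hd
  · rw [Finset.sum_eq_single (i - d)]
    · rw [if_pos (by omega)]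
    · exact fun j _ hj ↦ if_neg (by omega)
    · intro hj
      simp at hj
  · exact Finset.sum_eq_zero fun j _ ↦ if_neg (by omega)

/-- Only the part of `g` of degree `i - d` contributes; if `d > i` there is none and `b = 0`. The
coarse bound `b ∈ F i` is enough later. -/
lemma exists_multiplier {κ : Type*} {d : ℕ} {s : κ → B} (hs : ∀ l, s l ∈ F d) (i : ℕ) (g : G) :
    ∃ b ∈ F i, ∀ l, b * s l ∈ F i ∧ σ i (b * s l) = γ i (g * σ d (s l)) := by
  by_cases hd : d ≤ i
  · obtain ⟨b, hb, hbg⟩ := h.exists_symbol (i - d) g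
    refine ⟨b, h.mono (Nat.sub_le _ _) hb, fun l ↦ ?_⟩
    have h1 := h.mul_mem hb (hs l)
    have h2 := h.map_mul hb (hs l)
    rw [Nat.sub_add_cancel hd] at h1 h2
    exact ⟨h1, by rw [h2, hbg, h.comp_mul (hs l), if_pos hd]⟩
  · refine ⟨0, zero_mem _, fun l ↦ ?_⟩
    rw [zero_mul, h.comp_mul (hs l), if_neg hd, h.map_zero]
    exact ⟨zero_mem _, rfl⟩

lemma exists_forall_mem {κ : Type*} [Finite κ] (x : κ → B) : ∃ i, ∀ l, x l ∈ F i := by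
  choose i hi using fun l ↦ h.exh (x l)
  obtain ⟨N, hN⟩ := (Set.finite_range i).bddAbove
  exact ⟨N, fun l ↦ h.mono (hN ⟨l, rfl⟩) (hi l)⟩

/-- Submodules of free modules have finite standard bases. -/
lemma exists_standardBasis [IsNoetherianRing G] {κ : Type} [Fintype κ]
    (K : Submodule B (κ → B)) :
    ∃ (r : ℕ) (s : Fin r → κ → B), (∀ k, s k ∈ K) ∧ ∀ x ∈ K, ∃ c : Fin r → B,
      x = ∑ k, c k • s k ∧ (∀ j, (∀ l, x l ∈ F j) → ∀ k, c k ∈ F j) ∧ (x = 0 → c = 0) := by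
  -- The symbols of elements of `K`. Finitely many span the same submodule of the noetherian module
  -- `G ^ κ`; the standard basis `s` lifts them.
  let W : Set (κ → G) := {y | ∃ i, ∃ x ∈ K, (∀ l, x l ∈ F i) ∧ y = fun l ↦ σ i (x l)}
  obtain ⟨T, hTW, hT⟩ := (Submodule.fg_span_iff_fg_span_finset_subset W).1
    (IsNoetherian.noetherian (Submodule.span G W))
  choose d s hsK hsF hsσ using fun k : Fin T.card ↦ hTW (T.equivFin.symm k).2
  have hspan : Submodule.span G W = Submodule.span G (Set.range fun k l ↦ σ (d k) (s k l)) := by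
    rw [hT]
    congr 1
    ext y
    constructor
    · intro hy
      refine ⟨T.equivFin ⟨y, hy⟩, ?_⟩
      have := hsσ (T.equivFin ⟨y, hy⟩)
      rw [Equiv.symm_apply_apply] at this
      exact this.symm
    · rintro ⟨k, rfl⟩
      have := hsσ k
      change (fun l ↦ σ (d k) (s k l)) ∈ T
      rw [← this]
      exact (T.equivFin.symm k).2
  have key : ∀ i, ∀ x ∈ K, (∀ l, x l ∈ F i) →
      ∃ c : Fin T.card → B, x = ∑ k, c k • s k ∧ ∀ k, c k ∈ F i := by
    -- One step of division: the symbol of degree `i` is cancelled, so the remainder drops to degree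
    -- `i - 1`, or to zero when `i = 0`.
    have approx : ∀ i, ∀ x ∈ K, (∀ l, x l ∈ F i) → ∃ b : Fin T.card → B, (∀ k, b k ∈ F i) ∧
        x - ∑ k, b k • s k ∈ K ∧ ∀ l, (x - ∑ k, b k • s k) l ∈ F i ∧
          σ i ((x - ∑ k, b k • s k) l) = 0 := by
      intro i x hx hxF
      have h1 : (fun l ↦ σ i (x l)) ∈ Submodule.span G W :=
        Submodule.subset_span ⟨i, x, hx, hxF, rfl⟩
      rw [hspan, Submodule.mem_span_range_iff_exists_fun] at h1
      obtain ⟨g, hg⟩ := h1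
      choose b hbF hb using fun k ↦ h.exists_multiplier (hsF k) i (g k)
      have h2 : ∀ l, (x - ∑ k, b k • s k) l ∈ F i ∧ σ i ((x - ∑ k, b k • s k) l) = 0 := fun l ↦ by
        have h3 : (∑ k, b k • s k) l = ∑ k, b k * s k l := by simp [Finset.sum_apply]
        have h4 : ∑ k, b k * s k l ∈ F i := sum_mem fun k _ ↦ (hb k l).1
        rw [Pi.sub_apply, h3, h.map_sub (hxF l) h4, h.map_sum _ fun k _ ↦ (hb k l).1]
        refine ⟨sub_mem (hxF l) h4, ?_⟩
        have h5 := congrFun hg l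
        simp only [Finset.sum_apply, Pi.smul_apply, smul_eq_mul] at h5
        rw [Finset.sum_congr rfl fun k _ ↦ (hb k l).2, ← _root_.map_sum, h5,
          h.comp_symbol _ (hxF l),
          if_pos rfl, sub_self]
      exact ⟨b, hbF, sub_mem hx (sum_mem fun k _ ↦ K.smul_mem _ (hsK k)), h2⟩
    intro i
    induction i with
    | zero =>
      intro x hx hxF
      obtain ⟨b, hbF, -, h2⟩ := approx 0 x hx hxF
      exact ⟨b, sub_eq_zero.1 (funext fun l ↦ (h.zero_iff (h2 l).1).1 (h2 l).2), hbF⟩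
    | succ i ih =>
      intro x hx hxF
      obtain ⟨b, hbF, hmem, h2⟩ := approx (i + 1) x hx hxF
      obtain ⟨c, hc, hcF⟩ := ih _ hmem fun l ↦ (h.succ_iff (h2 l).1).1 (h2 l).2
      refine ⟨b + c, ?_, fun k ↦ add_mem (hbF k) (h.mono (Nat.le_succ i) (hcF k))⟩
      simp only [Pi.add_apply, add_smul, Finset.sum_add_distrib, ← hc]
      abel
  refine ⟨T.card, s, hsK, fun x hx ↦ ?_⟩
  -- Dividing in the least degree containing `x` gives coefficients bounded by every admissible `j`;
  -- for `x = 0` the zero coefficients are imposed.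
  by_cases h0 : x = 0
  · exact ⟨0, by simp [h0], fun j _ k ↦ zero_mem _, fun _ ↦ rfl⟩
  · classical
    have hex := h.exists_forall_mem x
    obtain ⟨c, hc, hcF⟩ := key (Nat.find hex) x hx (Nat.find_spec hex)
    exact ⟨c, hc, fun j hj k ↦ h.mono (Nat.find_min' hex hj) (hcF k), fun h1 ↦ absurd h1 h0⟩

lemma isNoetherianRing [IsNoetherianRing G] : IsNoetherianRing B := by
  have : IsNoetherian B (Fin 1 → B) := ⟨fun K ↦ by
    obtain ⟨r, s, hs, hK⟩ := h.exists_standardBasis K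
    have : K = Submodule.span B (Set.range s) := by
      refine le_antisymm (fun x hx ↦ ?_) (Submodule.span_le.2 ?_)
      · obtain ⟨c, hc, -⟩ := hK x hx
        rw [hc]
        exact sum_mem fun k _ ↦ Submodule.smul_mem _ _ (Submodule.subset_span ⟨k, rfl⟩)
      · rintro _ ⟨k, rfl⟩
        exact hs k
    rw [this]
    exact Submodule.fg_span (Set.finite_range s)⟩
  exact isNoetherian_of_linearEquiv (LinearEquiv.funUnique (Fin 1) B B)

/-- Flatness of a ring of series over its ring of coefficients. -/
lemma leftFlat_of_coeff [IsNoetherianRing G] {E : Type*} [Ring E] {φ : B →+* E} (κ : ℤ → E →+ B)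
    (hinj : ∀ e, (∀ n, κ n e = 0) → e = 0) (hmul : ∀ n e b, κ n (e * φ b) = κ n e * b)
    (hreal : ∀ (ι : Type) [Fintype ι] (e : ι → E) (c : ℤ → B),
      (∀ n j, (∀ l, κ n (e l) ∈ F j) → c n ∈ F j) → (∀ n, (∀ l, κ n (e l) = 0) → c n = 0) →
        ∃ e', ∀ n, κ n e' = c n) : LeftFlat φ := by
  intro ι ι' _ _ a e hae
  let K : Submodule B (ι → B) :=
    { carrier := {s | ∀ j, ∑ i, s i * a i j = 0}
      add_mem' := fun {s s'} hs hs' j ↦ by simp [add_mul, Finset.sum_add_distrib, hs j, hs' j]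
      zero_mem' := fun j ↦ by simp
      smul_mem' := fun b s hs j ↦ by simp [mul_assoc, ← Finset.mul_sum, hs j] }
  obtain ⟨r, s, hs, hK⟩ := h.exists_standardBasis K
  -- Division is done for each coefficient separately; `hcF` and `hc0` are what `hreal` needs to
  -- assemble the quotients into elements of `E`.
  choose c hc hcF hc0 using fun n ↦ hK (fun i ↦ κ n (e i)) fun j ↦ by
    rw [← Finset.sum_congr rfl fun i _ ↦ hmul n (e i) (a i j), ← _root_.map_sum, hae,
      _root_.map_zero]
  choose c' hc' using fun k ↦ hreal ι e (fun n ↦ c n k) (fun n j hj ↦ hcF n j hj k)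
    fun n hn ↦ congrFun (hc0 n (funext hn)) k
  refine ⟨r, s, c', hs, fun i ↦ sub_eq_zero.1 (hinj _ fun n ↦ ?_)⟩
  rw [_root_.map_sub, _root_.map_sum, sub_eq_zero]
  simp only [hmul, hc']
  have := congrFun (hc n) i
  simpa [Finset.sum_apply] using this

end IsSymbolMap

end AuslanderReg

end

/-! ### The completed Rees ring and Auslander regularity of filtered rings -/

noncomputable section

namespace AuslanderReg

universe v w

namespace IsSymbolMap

variable {B : Type v} {G : Type w} [Ring B] [CommRing G] {F : ℕ → AddSubgroup B}
  {σ : ℕ → B → G} {γ : ℕ → G →+ G}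

/-- The completed Rees ring: series `∑ b_n X^n` with `b_n ∈ F_n` and, for each `m`,
`b_n ∈ F_{n - m}` for almost all `n`. -/
def completedRees (h : IsSymbolMap F σ γ) : Subring (PowerSeries B) where
  carrier := {f | (∀ n, f.coeff n ∈ F n) ∧ ∀ m, ∃ N, ∀ n ≥ N, f.coeff (n + m) ∈ F n}
  zero_mem' := ⟨fun n ↦ by simp, fun m ↦ ⟨0, fun n _ ↦ by simp⟩⟩
  one_mem' := by
    refine ⟨fun n ↦ ?_, fun m ↦ ⟨1, fun n hn ↦ ?_⟩⟩
    · rw [PowerSeries.coeff_one]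
      split_ifs with hn
      · subst hn
        exact h.one_mem
      · exact zero_mem _
    · rw [PowerSeries.coeff_one, if_neg (by omega)]
      exact zero_mem _
  add_mem' {f g} hf hg := by
    refine ⟨fun n ↦ ?_, fun m ↦ ?_⟩
    · rw [map_add]
      exact add_mem (hf.1 n) (hg.1 n)
    · obtain ⟨N, hN⟩ := hf.2 m
      obtain ⟨N', hN'⟩ := hg.2 m
      refine ⟨max N N', fun n hn ↦ ?_⟩
      rw [map_add]
      exact add_mem (hN n (le_trans (le_max_left _ _) hn)) (hN' n (le_trans (le_max_right _ _) hn))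
  neg_mem' {f} hf := by
    refine ⟨fun n ↦ ?_, fun m ↦ ?_⟩
    · rw [map_neg]
      exact neg_mem (hf.1 n)
    · obtain ⟨N, hN⟩ := hf.2 m
      refine ⟨N, fun n hn ↦ ?_⟩
      rw [map_neg]
      exact neg_mem (hN n hn)
  mul_mem' {f g} hf hg := by
    refine ⟨fun n ↦ ?_, fun m ↦ ?_⟩
    · rw [PowerSeries.coeff_mul]
      refine sum_mem fun ij hij ↦ ?_
      rw [← Finset.HasAntidiagonal.mem_antidiagonal.1 hij]
      exact h.mul_mem (hf.1 _) (hg.1 _)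
    · obtain ⟨N, hN⟩ := hf.2 m
      obtain ⟨N', hN'⟩ := hg.2 m
      -- With this bound, in each product of total degree `n + m` one of the two indices is large
      -- enough for its coefficient to lie `m` filtration steps lower.
      refine ⟨N + m + N' + m, fun n hn ↦ ?_⟩
      rw [PowerSeries.coeff_mul]
      refine sum_mem fun ij hij ↦ ?_
      have hij' := Finset.HasAntidiagonal.mem_antidiagonal.1 hij
      by_cases hi : N + m ≤ ij.1
      · have h1 := hN (ij.1 - m) (by omega)
        rw [Nat.sub_add_cancel (by omega)] at h1
        have h2 := h.mul_mem h1 (hg.1 ij.2)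
        rwa [show ij.1 - m + ij.2 = n by omega] at h2
      · have h1 := hN' (ij.2 - m) (by omega)
        rw [Nat.sub_add_cancel (by omega)] at h1
        have h2 := h.mul_mem (hf.1 ij.1) h1
        rwa [show ij.1 + (ij.2 - m) = n by omega] at h2

section Rees

variable (h : IsSymbolMap F σ γ)

lemma exists_symbol_coeff_eq_zero (f : h.completedRees) :
    ∃ N, ∀ n ≥ N, σ n (PowerSeries.coeff n f.1) = 0 := by
  obtain ⟨N, hN⟩ := f.2.2 1
  refine ⟨N + 1, fun n hn ↦ ?_⟩
  obtain ⟨n, rfl⟩ : ∃ k, n = k + 1 := ⟨n - 1, by omega⟩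
  exact (h.succ_iff (f.2.1 _)).2 (hN n (by omega))

/-- The polynomial of symbols of the coefficients. -/
def symbolPolynomial (f : h.completedRees) : Polynomial G :=
  ∑ n ∈ Finset.range (h.exists_symbol_coeff_eq_zero f).choose,
    Polynomial.monomial n (σ n (PowerSeries.coeff n f.1))

lemma coeff_symbolPolynomial (f : h.completedRees) (n : ℕ) :
    (h.symbolPolynomial f).coeff n = σ n (PowerSeries.coeff n f.1) := by
  rw [symbolPolynomial, Polynomial.finsetSum_coeff]
  simp only [Polynomial.coeff_monomial]
  rw [Finset.sum_ite_eq' _ n]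
  split_ifs with hn
  · rfl
  · refine ((h.exists_symbol_coeff_eq_zero f).choose_spec n ?_).symm
    simpa using hn

/-- The polynomial of symbols, as a ring homomorphism. -/
def symbolPolynomialHom : h.completedRees →+* Polynomial G where
  toFun := h.symbolPolynomial
  map_zero' := by ext n; simp [coeff_symbolPolynomial, h.map_zero]
  map_one' := by
    ext n
    rw [coeff_symbolPolynomial, Subring.coe_one, PowerSeries.coeff_one, Polynomial.coeff_one]
    by_cases hn : n = 0
    · subst hn
      simp [h.map_one]
    · rw [if_neg hn, if_neg hn, h.map_zero]
  map_add' f g := by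
    ext n
    rw [Polynomial.coeff_add, coeff_symbolPolynomial, coeff_symbolPolynomial,
      coeff_symbolPolynomial, Subring.coe_add, map_add, h.map_add (f.2.1 n) (g.2.1 n)]
  map_mul' f g := by
    ext n
    rw [Polynomial.coeff_mul, coeff_symbolPolynomial, Subring.coe_mul, PowerSeries.coeff_mul,
      h.map_sum]
    · refine Finset.sum_congr rfl fun ij hij ↦ ?_
      rw [coeff_symbolPolynomial, coeff_symbolPolynomial, ← h.map_mul (f.2.1 _) (g.2.1 _),
        Finset.HasAntidiagonal.mem_antidiagonal.1 hij]
    · intro ij hij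
      rw [← Finset.HasAntidiagonal.mem_antidiagonal.1 hij]
      exact h.mul_mem (f.2.1 _) (g.2.1 _)

/-- The reduction map from the completed Rees ring to the associated graded ring. -/
def reesReduction : h.completedRees →+* G :=
  (Polynomial.evalRingHom 1).comp h.symbolPolynomialHom

lemma reesReduction_apply (f : h.completedRees) :
    h.reesReduction f = ∑ n ∈ (h.symbolPolynomial f).support, σ n (PowerSeries.coeff n f.1) := by
  change Polynomial.eval 1 (h.symbolPolynomial f) = _
  rw [Polynomial.eval_eq_sum, Polynomial.sum]
  simp [coeff_symbolPolynomial]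

lemma comp_reesReduction (f : h.completedRees) (i : ℕ) :
    γ i (h.reesReduction f) = σ i (PowerSeries.coeff i f.1) := by
  rw [reesReduction_apply, _root_.map_sum, Finset.sum_congr rfl fun n _ ↦
    h.comp_symbol i (f.2.1 n), Finset.sum_ite_eq']
  split_ifs with hi
  · rfl
  · rw [Polynomial.mem_support_iff, not_not, coeff_symbolPolynomial] at hi
    exact hi.symm

lemma monomial_mem {n : ℕ} {b : B} (hb : b ∈ F n) :
    (PowerSeries.monomial n b) ∈ h.completedRees := by
  refine ⟨fun k ↦ ?_, fun m ↦ ⟨n + 1, fun k hk ↦ ?_⟩⟩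
  · rw [PowerSeries.coeff_monomial]
    split_ifs with hk
    · subst hk
      exact hb
    · exact zero_mem _
  · rw [PowerSeries.coeff_monomial, if_neg (by omega)]
    exact zero_mem _

/-- The variable, as an element of the completed Rees ring. -/
def reesX : h.completedRees :=
  ⟨PowerSeries.monomial 1 1, h.monomial_mem (h.mono (Nat.zero_le 1) h.one_mem)⟩

lemma coe_reesX : (h.reesX : PowerSeries B) = PowerSeries.X := rfl

lemma reesX_comm (f : h.completedRees) : h.reesX * f = f * h.reesX :=
  Subtype.ext (PowerSeries.commute_X f.1).symm

lemma coe_reesX_pow (m : ℕ) : ((h.reesX ^ m : h.completedRees) : PowerSeries B) =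
    PowerSeries.X ^ m := rfl

omit h in
lemma single_one_comm (m : ℤ) (f : HahnSeries ℤ B) :
    HahnSeries.single m 1 * f = f * HahnSeries.single m 1 := by
  ext n
  rw [HahnSeries.coeff_single_mul, HahnSeries.coeff_mul_single, one_mul, mul_one]

omit h in
lemma single_one_mul_single_one (m m' : ℤ) : HahnSeries.single m (1 : B) *
    HahnSeries.single m' 1 = HahnSeries.single (m + m') 1 := by
  rw [HahnSeries.single_mul_single, one_mul]

/-- The subring of Laurent series obtained by inverting the variable in the completed
Rees ring. -/
def reesLaurent : Subring (HahnSeries ℤ B) where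
  carrier := {f | ∃ (m : ℕ) (c : h.completedRees),
    HahnSeries.single (m : ℤ) 1 * f = HahnSeries.ofPowerSeries ℤ B c}
  zero_mem' := ⟨0, 0, by simp⟩
  one_mem' := ⟨0, 1, by simp⟩
  add_mem' := by
    rintro f g ⟨m, c, hf⟩ ⟨m', c', hg⟩
    refine ⟨m + m', h.reesX ^ m' * c + h.reesX ^ m * c', ?_⟩
    rw [Subring.coe_add, Subring.coe_mul, Subring.coe_mul, coe_reesX_pow, coe_reesX_pow, map_add,
      map_mul, map_mul, HahnSeries.ofPowerSeries_X_pow, HahnSeries.ofPowerSeries_X_pow, ← hf, ← hg,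
      ← mul_assoc, ← mul_assoc, single_one_mul_single_one, single_one_mul_single_one, mul_add,
      add_comm (m' : ℤ), Nat.cast_add]
  neg_mem' := by
    rintro f ⟨m, c, hf⟩
    exact ⟨m, -c, by rw [mul_neg, hf, Subring.coe_neg, map_neg]⟩
  mul_mem' := by
    rintro f g ⟨m, c, hf⟩ ⟨m', c', hg⟩
    refine ⟨m + m', c * c', ?_⟩
    rw [Subring.coe_mul, map_mul, ← hf, ← hg, single_one_comm m f, mul_assoc f,
      ← mul_assoc (HahnSeries.single (m : ℤ) 1), single_one_mul_single_one, ← mul_assoc,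
      ← mul_assoc, ← Nat.cast_add, single_one_comm _ f]

lemma ofPowerSeries_mem (c : h.completedRees) :
    HahnSeries.ofPowerSeries ℤ B c ∈ h.reesLaurent := ⟨0, c, by simp⟩

/-- The inclusion of the completed Rees ring into its localization. -/
def reesInclusion : h.completedRees →+* h.reesLaurent :=
  ((HahnSeries.ofPowerSeries ℤ B).comp h.completedRees.subtype).codRestrict _ h.ofPowerSeries_mem

@[simp] lemma coe_reesInclusion (c : h.completedRees) :
    (h.reesInclusion c : HahnSeries ℤ B) = HahnSeries.ofPowerSeries ℤ B c := rfl

lemma coe_reesInclusion_reesX : (h.reesInclusion h.reesX : HahnSeries ℤ B) =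
    HahnSeries.single 1 1 := by
  rw [coe_reesInclusion, coe_reesX, HahnSeries.ofPowerSeries_X]

/-- All symbols vanish, so `b_0 = 0` and `b_{n+1} ∈ F_n`: the coefficients can be shifted down. The
tail condition for `m + 1` becomes the one for `m`. -/
lemma exists_eq_reesX_mul {c : h.completedRees} (hc : h.reesReduction c = 0) :
    ∃ c', c = h.reesX * c' := by
  have h1 : ∀ i, σ i (PowerSeries.coeff i c.1) = 0 := fun i ↦ by
    rw [← h.comp_reesReduction, hc, map_zero]
  refine ⟨⟨PowerSeries.mk fun n ↦ PowerSeries.coeff (n + 1) c.1, fun n ↦ ?_, fun m ↦ ?_⟩,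
    Subtype.ext (PowerSeries.ext fun n ↦ ?_)⟩
  · rw [PowerSeries.coeff_mk]
    exact (h.succ_iff (c.2.1 _)).1 (h1 _)
  · obtain ⟨N, hN⟩ := c.2.2 (m + 1)
    refine ⟨N, fun n hn ↦ ?_⟩
    rw [PowerSeries.coeff_mk]
    exact hN n hn
  · rw [Subring.coe_mul, coe_reesX]
    cases n with
    | zero =>
      rw [PowerSeries.coeff_zero_X_mul]
      exact (h.zero_iff (c.2.1 0)).1 (h1 0)
    | succ n => rw [PowerSeries.coeff_succ_X_mul, PowerSeries.coeff_mk]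

lemma reesReduction_surjective : Function.Surjective h.reesReduction := fun g ↦ by
  obtain ⟨N, hN⟩ := h.sum_comp g
  choose x hx hg using fun i ↦ h.exists_symbol i g
  have h1 : ∀ i, h.reesReduction ⟨_, h.monomial_mem (hx i)⟩ = γ i g := fun i ↦ by
    change Polynomial.eval 1 (h.symbolPolynomial _) = _
    have : h.symbolPolynomial ⟨_, h.monomial_mem (hx i)⟩ = Polynomial.monomial i (γ i g) := by
      ext n
      rw [coeff_symbolPolynomial, PowerSeries.coeff_monomial, Polynomial.coeff_monomial]
      by_cases hn : n = i
      · subst hn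
        simp [hg]
      · rw [if_neg hn, if_neg (Ne.symm hn), h.map_zero]
    rw [this, Polynomial.eval_monomial, one_pow, mul_one]
  refine ⟨∑ i ∈ Finset.range N, ⟨_, h.monomial_mem (hx i)⟩, ?_⟩
  rw [map_sum, Finset.sum_congr rfl fun i _ ↦ h1 i, ← hN N le_rfl]

lemma reesReduction_reesX : h.reesReduction h.reesX = 0 := by
  rw [reesReduction_apply]
  refine Finset.sum_eq_zero fun n _ ↦ ?_
  rw [coe_reesX, PowerSeries.coeff_X]
  split_ifs with hn
  · subst hn
    exact (h.succ_iff (h.mono (Nat.zero_le 1) h.one_mem)).2 h.one_mem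
  · exact h.map_zero n

/-- The limit of the partial sums `∑ X^i a_i`. -/
def reesLimit (a : ℕ → h.completedRees) : h.completedRees where
  val := PowerSeries.mk fun n ↦ ∑ ij ∈ Finset.HasAntidiagonal.antidiagonal n,
    PowerSeries.coeff ij.2 (a ij.1).1
  property := by
    refine ⟨fun n ↦ ?_, fun m ↦ ?_⟩
    · rw [PowerSeries.coeff_mk]
      refine sum_mem fun ij hij ↦ h.mono ?_ ((a ij.1).2.1 ij.2)
      have := Finset.HasAntidiagonal.mem_antidiagonal.1 hij
      omega
    -- Multiplication by `X ^ i` already gains `i` filtration steps, so only the finitely many terms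
    -- with `i < m` need a tail bound.
    · choose N hN using fun i ↦ (a i).2.2 (m - i)
      refine ⟨(∑ i ∈ Finset.range m, N i) + m, fun n hn ↦ ?_⟩
      rw [PowerSeries.coeff_mk]
      refine sum_mem fun ij hij ↦ ?_
      have hij' := Finset.HasAntidiagonal.mem_antidiagonal.1 hij
      by_cases hm : m ≤ ij.1
      · exact h.mono (by omega) ((a ij.1).2.1 ij.2)
      · have h1 : N ij.1 ≤ ∑ i ∈ Finset.range m, N i :=
          Finset.single_le_sum (f := N) (fun _ _ ↦ Nat.zero_le _) (Finset.mem_range.2 (by omega))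
        have h2 := hN ij.1 n (by omega)
        rwa [show n + (m - ij.1) = ij.2 by omega] at h2

lemma reesLimit_eq (a : ℕ → h.completedRees) :
    h.reesLimit a = a 0 + h.reesX * h.reesLimit fun i ↦ a (i + 1) := by
  refine Subtype.ext (PowerSeries.ext fun n ↦ ?_)
  rw [Subring.coe_add, Subring.coe_mul, map_add, coe_reesX]
  cases n with
  | zero => simp [reesLimit]
  | succ n =>
    rw [PowerSeries.coeff_succ_X_mul, reesLimit, PowerSeries.coeff_mk, reesLimit,
      PowerSeries.coeff_mk, Finset.Nat.antidiagonal_succ, Finset.sum_cons, Finset.sum_map]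
    rfl

lemma isCompleteDeformation :
    IsCompleteDeformation h.reesX h.reesReduction h.reesInclusion where
  comm := h.reesX_comm
  p_surj := h.reesReduction_surjective
  p_t := h.reesReduction_reesX
  p_ker _ hs := h.exists_eq_reesX_mul hs
  ι_inj c c' hcc := Subtype.ext (HahnSeries.ofPowerSeries_injective (congrArg Subtype.val hcc))
  ι_unit := by
    have hmem : HahnSeries.single (-1 : ℤ) (1 : B) ∈ h.reesLaurent := ⟨1, 1, by
      rw [single_one_mul_single_one]; simp⟩
    refine ⟨⟨_, ⟨_, hmem⟩, Subtype.ext ?_, Subtype.ext ?_⟩, rfl⟩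
    · rw [Subring.coe_mul, coe_reesInclusion_reesX, single_one_mul_single_one]
      rfl
    · rw [Subring.coe_mul, coe_reesInclusion_reesX, single_one_mul_single_one]
      rfl
  ι_surj e := by
    obtain ⟨m, c, hc⟩ := e.2
    refine ⟨m, c, Subtype.ext ?_⟩
    rw [← map_pow, Subring.coe_mul, coe_reesInclusion, coe_reesX_pow,
      HahnSeries.ofPowerSeries_X_pow, hc]
    rfl
  sep s hs := Subtype.ext (PowerSeries.ext fun n ↦ by
    obtain ⟨s', rfl⟩ := hs (n + 1)
    rw [Subring.coe_mul, coe_reesX_pow, PowerSeries.coeff_X_pow_mul', if_neg (by omega)]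
    simp)
  complete a := by
    refine ⟨h.reesLimit a, fun n ↦ ⟨h.reesLimit fun i ↦ a (i + n), ?_⟩⟩
    rw [sub_eq_iff_eq_add]
    induction n with
    | zero => simp
    | succ n ih =>
      rw [ih, h.reesLimit_eq fun i ↦ a (i + n), Finset.sum_range_succ, mul_add, pow_succ, mul_assoc,
        zero_add]
      simp only [add_assoc, add_comm 1 n]
      abel

/-- Elements of `B` as constant series. -/
def reesConst : B →+* h.reesLaurent :=
  (HahnSeries.C (Γ := ℤ)).codRestrict _ fun b ↦ by
    obtain ⟨n, hn⟩ := h.exh b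
    have : PowerSeries.monomial n b = PowerSeries.X ^ n * PowerSeries.C b := by
      ext k
      rw [PowerSeries.coeff_X_pow_mul', PowerSeries.coeff_C, PowerSeries.coeff_monomial]
      split_ifs <;> first | rfl | omega
    -- A constant `b ∈ F n` is `X ^ (-n)` times the element `b X ^ n` of the completed Rees ring.
    refine ⟨n, ⟨_, h.monomial_mem hn⟩, Eq.trans ?_ (congrArg _ this).symm⟩
    rw [map_mul, HahnSeries.ofPowerSeries_X_pow, HahnSeries.ofPowerSeries_C]

/-- The coefficients of an element of `reesLaurent`. -/
def reesCoeff (n : ℤ) : h.reesLaurent →+ B where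
  toFun e := (e : HahnSeries ℤ B).coeff n
  map_zero' := rfl
  map_add' _ _ := rfl

lemma reesCoeff_mul_const (n : ℤ) (e : h.reesLaurent) (b : B) :
    h.reesCoeff n (e * h.reesConst b) = h.reesCoeff n e * b :=
  HahnSeries.coeff_mul_single_zero

lemma reesCoeff_const_mul (n : ℤ) (e : h.reesLaurent) (b : B) :
    h.reesCoeff n (h.reesConst b * e) = b * h.reesCoeff n e :=
  HahnSeries.coeff_single_zero_mul

lemma eq_zero_of_reesCoeff {e : h.reesLaurent} (he : ∀ n, h.reesCoeff n e = 0) : e = 0 :=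
  Subtype.ext (HahnSeries.ext (funext he))

omit h in
lemma coeff_ofPowerSeries_of_neg (f : PowerSeries B) {n : ℤ} (hn : n < 0) :
    (HahnSeries.ofPowerSeries ℤ B f).coeff n = 0 := by
  rw [HahnSeries.ofPowerSeries_apply]
  refine HahnSeries.embDomain_of_notMem_range fun ⟨k, hk⟩ ↦ ?_
  have : (k : ℤ) = n := hk
  omega

lemma exists_single_mul_eq {ι : Type} [Fintype ι] (e : ι → h.reesLaurent) :
    ∃ (m : ℕ) (c : ι → h.completedRees), ∀ l,
      HahnSeries.single (m : ℤ) 1 * (e l : HahnSeries ℤ B) =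
        HahnSeries.ofPowerSeries ℤ B (c l) := by
  choose m c hc using fun l ↦ (e l).2
  refine ⟨∑ l, m l, fun l ↦ h.reesX ^ (∑ l, m l - m l) * c l, fun l ↦ ?_⟩
  rw [Subring.coe_mul, coe_reesX_pow, map_mul, HahnSeries.ofPowerSeries_X_pow, ← hc, ← mul_assoc,
    single_one_mul_single_one, ← Nat.cast_add,
    Nat.sub_add_cancel (Finset.single_le_sum (fun _ _ ↦ Nat.zero_le _) (Finset.mem_univ l))]

/-- Membership in `reesLaurent` is a condition on the filtration degrees of the coefficients and on
their vanishing far to the left; a sequence dominated by finitely many members inherits both. -/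
lemma exists_reesCoeff_eq {ι : Type} [Fintype ι] (e : ι → h.reesLaurent) (c : ℤ → B)
    (hc : ∀ n j, (∀ l, h.reesCoeff n (e l) ∈ F j) → c n ∈ F j)
    (hc0 : ∀ n, (∀ l, h.reesCoeff n (e l) = 0) → c n = 0) :
    ∃ e', ∀ n, h.reesCoeff n e' = c n := by
  obtain ⟨m, f, hf⟩ := h.exists_single_mul_eq e
  have h1 : ∀ n l, h.reesCoeff n (e l) = (HahnSeries.ofPowerSeries ℤ B (f l)).coeff (n + m) :=
    fun n l ↦ by
      rw [← hf, HahnSeries.coeff_single_mul, one_mul, add_sub_cancel_right]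
      rfl
  have h2 : ∀ (k : ℕ) l, h.reesCoeff (k - m) (e l) = PowerSeries.coeff k (f l).1 := fun k l ↦ by
    rw [h1, sub_add_cancel]
    exact HahnSeries.ofPowerSeries_apply_coeff _ k
  let g : h.completedRees := ⟨PowerSeries.mk fun k ↦ c (k - m), fun k ↦ by
      rw [PowerSeries.coeff_mk]
      exact hc _ _ fun l ↦ by rw [h2]; exact (f l).2.1 k, fun i ↦ by
      choose N hN using fun l ↦ (f l).2.2 i
      refine ⟨∑ l, N l, fun k hk ↦ ?_⟩
      rw [PowerSeries.coeff_mk]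
      refine hc _ _ fun l ↦ ?_
      rw [h2]
      exact hN l k (le_trans (Finset.single_le_sum (fun _ _ ↦ Nat.zero_le _)
        (Finset.mem_univ l)) hk)⟩
  have hmem : HahnSeries.single (-m : ℤ) 1 * HahnSeries.ofPowerSeries ℤ B g ∈ h.reesLaurent :=
    ⟨m, g, by rw [← mul_assoc, single_one_mul_single_one, add_neg_cancel]; exact one_mul _⟩
  refine ⟨⟨_, hmem⟩, fun n ↦ ?_⟩
  change (HahnSeries.single (-m : ℤ) 1 * HahnSeries.ofPowerSeries ℤ B g).coeff n = c n
  rw [HahnSeries.coeff_single_mul, one_mul, sub_neg_eq_add]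
  by_cases hn : n + m < 0
  · rw [coeff_ofPowerSeries_of_neg _ hn, hc0 n fun l ↦ by rw [h1, coeff_ofPowerSeries_of_neg _ hn]]
  · obtain ⟨k, hk⟩ := Int.eq_ofNat_of_zero_le (not_lt.1 hn)
    rw [hk]
    refine (HahnSeries.ofPowerSeries_apply_coeff g.1 k).trans ?_
    rw [PowerSeries.coeff_mk]
    congr 1
    omega

/-- The constant coefficient is a bimodule retraction, and standard bases over `B` and `Bᵐᵒᵖ` give
the two flatness statements. -/
lemma isFlatRetract [IsNoetherianRing G] : IsFlatRetract h.reesConst (h.reesCoeff 0) where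
  map_mul_left b e := h.reesCoeff_const_mul 0 e b
  map_mul_right b e := h.reesCoeff_mul_const 0 e b
  map_one := HahnSeries.coeff_single_same 0 1
  leftFlat := h.leftFlat_of_coeff h.reesCoeff (fun e he ↦ h.eq_zero_of_reesCoeff he)
    h.reesCoeff_mul_const fun ι _ e c ↦ h.exists_reesCoeff_eq e c
  rightFlat := h.op.leftFlat_of_coeff (fun n ↦ AddMonoidHom.mulOp (h.reesCoeff n))
    (fun e he ↦ MulOpposite.unop_injective (h.eq_zero_of_reesCoeff fun n ↦
      MulOpposite.op_injective (he n)))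
    (fun n e b ↦ MulOpposite.unop_injective (h.reesCoeff_const_mul n e.unop b.unop))
    fun ι _ e c hc hc0 ↦ by
      obtain ⟨e', he'⟩ := h.exists_reesCoeff_eq (fun l ↦ (e l).unop) (fun n ↦ (c n).unop) hc
        fun n hn ↦ congrArg MulOpposite.unop (hc0 n fun l ↦ MulOpposite.unop_injective (hn l))
      exact ⟨.op e', fun n ↦ MulOpposite.unop_injective (he' n)⟩

end Rees

variable (h : IsSymbolMap F σ γ) [IsNoetherianRing G] {d : ℕ} (hd : globalDimension G ≤ d)

include h hd

lemma globalDimension_le : globalDimension B ≤ d := by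
  have := h.isNoetherianRing
  exact h.isFlatRetract.globalDimension_le (h.isCompleteDeformation.globalDimension_le hd)

/-- A filtered ring whose associated graded ring is commutative noetherian of finite global
dimension is Auslander regular. -/
theorem isAuslanderRegular : IsAuslanderRegular B := by
  have := h.isNoetherianRing
  have := h.op.isNoetherianRing
  exact h.isFlatRetract.isAuslanderRegular
    (h.isCompleteDeformation.isAuslanderRegular (isAuslanderRegular_of_comm hd))

end IsSymbolMap

end AuslanderReg

end

noncomputable section

namespace AuslanderReg

/-! ### The completion as a complete deformation -/

section PiCompletion

variable {R : Type*} [CommRing R] {π : R} {C : Type*} [Ring C] [Algebra R C]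

lemma mem_powIdeal_iff {m : ℕ} {c : C} : c ∈ powIdeal π C m ↔ ∃ d : C, c = π ^ m • d := by
  rw [powIdeal, Ideal.mem_span_singleton']
  simp only [Algebra.smul_def, Algebra.commutes, eq_comm]

/-- The components of an element of the completion. -/
def compl (m : ℕ) : piCompletion π C →+* C ⧸ powIdeal π C m :=
  (Pi.evalRingHom (fun m ↦ C ⧸ powIdeal π C m) m).comp (piCompletion π C).subtype

lemma compl_smul (m : ℕ) (r : R) (s : piCompletion π C) : compl m (r • s) = r • compl m s := rfl

lemma compl_algebraMap_mul (m : ℕ) (r : R) (s : piCompletion π C) :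
    compl m (algebraMap R _ r * s) = r • compl m s := by
  rw [← Algebra.smul_def, compl_smul]

lemma compl_ext {s s' : piCompletion π C} (h : ∀ m, compl m s = compl m s') : s = s' :=
  Subtype.ext (funext h)

lemma pow_smul_quotient (m : ℕ) (x : C ⧸ powIdeal π C m) : π ^ m • x = 0 := by
  obtain ⟨c, rfl⟩ := Ideal.Quotient.mk_surjective x
  exact Ideal.Quotient.eq_zero_iff_mem.2 (mem_powIdeal_iff.2 ⟨c, rfl⟩)

lemma exists_lift (s : piCompletion π C) : ∃ c : ℕ → C,
    (∀ m, compl m s = Ideal.Quotient.mk _ (c m)) ∧ ∀ m, ∃ d, c (m + 1) - c m = π ^ m • d := by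
  choose c hc using fun m ↦ Ideal.Quotient.mk_surjective (compl m s)
  refine ⟨c, fun m ↦ (hc m).symm, fun m ↦ mem_powIdeal_iff.1 (Ideal.Quotient.eq.1 ?_)⟩
  have h := s.2 m
  change Ideal.Quotient.factor (powIdeal_succ_le π C m) (compl (m + 1) s) = compl m s at h
  rw [← hc, ← hc, Ideal.Quotient.factor_mk] at h
  exact h

/-- The element of the completion defined by a Cauchy sequence. -/
def ofSeq (c : ℕ → C) (hc : ∀ m, ∃ d, c (m + 1) - c m = π ^ m • d) : piCompletion π C :=
  ⟨fun m ↦ Ideal.Quotient.mk _ (c m), fun m ↦ by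
    change Ideal.Quotient.factor (powIdeal_succ_le π C m) (Ideal.Quotient.mk _ (c (m + 1))) = _
    rw [Ideal.Quotient.factor_mk]
    exact Ideal.Quotient.eq.2 (mem_powIdeal_iff.2 (hc m))⟩

lemma compl_ofSeq (c : ℕ → C) (hc : ∀ m, ∃ d, c (m + 1) - c m = π ^ m • d) (m : ℕ) :
    compl m (ofSeq c hc) = Ideal.Quotient.mk _ (c m) := rfl

/-- The sum of the series `∑ π ^ i a_i`. -/
def complSum (a : ℕ → piCompletion π C) : piCompletion π C :=
  ⟨fun m ↦ ∑ i ∈ Finset.range m, π ^ i • compl m (a i), fun m ↦ by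
    rw [map_sum, Finset.sum_range_succ]
    have h : ∀ i, Ideal.Quotient.factor (powIdeal_succ_le π C m) (π ^ i • compl (m + 1) (a i)) =
        π ^ i • compl m (a i) := fun i ↦ (π ^ i • a i).2 m
    rw [Finset.sum_congr rfl fun i _ ↦ h i, h, pow_smul_quotient, add_zero]⟩

lemma complSum_eq (a : ℕ → piCompletion π C) :
    complSum a = a 0 + algebraMap R _ π * complSum fun i ↦ a (i + 1) := by
  refine compl_ext fun m ↦ ?_
  rw [RingHom.map_add, compl_algebraMap_mul]
  change ∑ i ∈ Finset.range m, π ^ i • compl m (a i) =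
    _ + π • ∑ i ∈ Finset.range m, π ^ i • compl m (a (i + 1))
  have h := Finset.sum_range_succ (fun i ↦ π ^ i • compl m (a i)) m
  rw [pow_smul_quotient, add_zero, Finset.sum_range_succ'] at h
  rw [← h, Finset.smul_sum, pow_zero, one_smul, add_comm]
  simp only [smul_smul, pow_succ']

variable (hπ : ∀ c : C, π • c = 0 → c = 0)

include hπ

/-- Level `m + 1` controls level `m`: `π c_{m+1} ∈ π ^ (m+1) C` gives `c_{m+1} ∈ π ^ m C` by
torsion-freeness. -/
lemma eq_zero_of_smul_completion {s : piCompletion π C} (h : π • s = 0) : s = 0 := by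
  obtain ⟨c, hc, hc'⟩ := exists_lift s
  refine compl_ext fun m ↦ ?_
  obtain ⟨d, hd⟩ := hc' m
  have h1 := congrArg (compl (m + 1)) h
  rw [compl_smul, hc, map_zero] at h1
  obtain ⟨e, he⟩ := mem_powIdeal_iff.1 (Ideal.Quotient.eq_zero_iff_mem.1
    (show Ideal.Quotient.mk _ (π • c (m + 1)) = 0 from h1))
  rw [pow_succ', mul_smul, ← sub_eq_zero, ← smul_sub] at he
  have h2 := sub_eq_zero.1 (hπ _ he)
  rw [hc, map_zero]
  refine Ideal.Quotient.eq_zero_iff_mem.2 (mem_powIdeal_iff.2 ⟨e - d, ?_⟩)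
  rw [smul_sub, ← h2, ← hd, sub_sub_cancel]

/-- Every `c_{m+1}` is divisible by `π`. The quotient is represented by `d_m = c_{m+1} / π`, the
shift by one absorbing the loss of precision. -/
lemma exists_eq_mul_of_compl_one {s : piCompletion π C} (h : compl 1 s = 0) :
    ∃ s', s = algebraMap R _ π * s' := by
  obtain ⟨c, hc, hc'⟩ := exists_lift s
  have h1 : ∀ m, ∃ d, c (m + 1) = π • d := fun m ↦ by
    induction m with
    | zero =>
      rw [hc] at h
      simpa using mem_powIdeal_iff.1 (Ideal.Quotient.eq_zero_iff_mem.1 h)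
    | succ m ih =>
      obtain ⟨d, hd⟩ := ih
      obtain ⟨e, he⟩ := hc' (m + 1)
      refine ⟨d + π ^ m • e, ?_⟩
      rw [smul_add, smul_smul, ← pow_succ', ← hd, ← he]
      abel
  choose d hd using h1
  refine ⟨ofSeq d fun m ↦ ?_, compl_ext fun m ↦ ?_⟩
  · obtain ⟨e, he⟩ := hc' (m + 1)
    refine ⟨e, sub_eq_zero.1 (hπ _ ?_)⟩
    rw [smul_sub, smul_sub, ← hd, ← hd, he, smul_smul, pow_succ', sub_self]
  · obtain ⟨e, he⟩ := hc' m
    rw [compl_algebraMap_mul, compl_ofSeq, hc]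
    change _ = Ideal.Quotient.mk _ (π • d m)
    rw [← hd]
    exact (Ideal.Quotient.eq.2 (mem_powIdeal_iff.2 ⟨e, he⟩)).symm

end PiCompletion

/-! ### Inverting the uniformizer in the completion -/

section Localization

variable {R : Type*} [CommRing R] [IsDomain R] [IsDiscreteValuationRing R] {π : R}
  {K : Type*} [Field K] [Algebra R K] [IsFractionRing R K]

lemma isTorsionFree_of_uniformizer (hirr : Irreducible π) {M : Type*} [AddCommGroup M] [Module R M]
    (h : ∀ x : M, π • x = 0 → x = 0) : Module.IsTorsionFree R M := by
  refine Module.IsTorsionFree.of_smul_eq_zero fun r x hrx ↦ ?_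
  by_cases hr : r = 0
  · exact Or.inl hr
  · obtain ⟨n, u, rfl⟩ := IsDiscreteValuationRing.eq_unit_mul_pow_irreducible hr hirr
    rw [mul_smul] at hrx
    have h1 : π ^ n • x = 0 := by
      have := congrArg ((u⁻¹ : Rˣ) • ·) hrx
      simpa [Units.smul_def, smul_smul] using this
    clear hrx hr
    right
    induction n with
    | zero => simpa using h1
    | succ n ih =>
      rw [pow_succ', mul_smul] at h1
      exact ih (h _ h1)

lemma exists_pow_smul_eq_algebraMap (hirr : Irreducible π) (k : K) :
    ∃ (m : ℕ) (a : R), π ^ m • k = algebraMap R K a := by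
  obtain ⟨a, b, hb, rfl⟩ := IsFractionRing.div_surjective (A := R) k
  have hb0 : b ≠ 0 := nonZeroDivisors.ne_zero hb
  obtain ⟨n, u, rfl⟩ := IsDiscreteValuationRing.eq_unit_mul_pow_irreducible hb0 hirr
  refine ⟨n, a * (u⁻¹ : Rˣ), ?_⟩
  have h1 : algebraMap R K π ≠ 0 := by simpa using hirr.ne_zero
  have h2 : algebraMap R K u ≠ 0 := by simp
  have h3 : algebraMap R K (u⁻¹ : Rˣ) * algebraMap R K u = 1 := by
    rw [← map_mul, Units.inv_mul, map_one]
  rw [Algebra.smul_def, map_mul, map_mul, map_pow, eq_div_of_mul_eq h2 h3]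
  field_simp

/-- Every nonzero element of `R` is a unit times a power of `π`, so tensoring with `K` inverts `π`
and nothing more. Torsion-freeness of the completion makes it embed. -/
lemma isCompleteDeformation_piCompletion (hirr : Irreducible π) (K : Type*) [Field K] [Algebra R K]
    [IsFractionRing R K] {C : Type*} [Ring C] [Algebra R C] (hπ : ∀ c : C, π • c = 0 → c = 0) :
    IsCompleteDeformation (E := piCompletion π C ⊗[R] K) (algebraMap R (piCompletion π C) π)
      (compl 1)
      (Algebra.TensorProduct.includeLeftRingHom :
        piCompletion π C →+* piCompletion π C ⊗[R] K) where
  comm := Algebra.commutes π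
  p_surj x := by
    obtain ⟨c, rfl⟩ := Ideal.Quotient.mk_surjective x
    exact ⟨ofSeq (fun _ ↦ c) fun m ↦ ⟨0, by simp⟩, rfl⟩
  p_t := by
    have := pow_smul_quotient 1 (compl 1 (1 : piCompletion π C))
    rwa [pow_one, ← compl_algebraMap_mul, mul_one] at this
  p_ker _ h := exists_eq_mul_of_compl_one hπ h
  ι_inj := by
    have := isTorsionFree_of_uniformizer (M := piCompletion π C) hirr
      fun _ ↦ eq_zero_of_smul_completion hπ
    exact Algebra.TensorProduct.includeLeft_injective (S := R) (IsFractionRing.injective R K)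
  ι_unit := by
    have h1 : algebraMap R K π ≠ 0 := by simpa using hirr.ne_zero
    have h2 : (Algebra.TensorProduct.includeLeftRingHom (algebraMap R (piCompletion π C) π) :
        piCompletion π C ⊗[R] K) = 1 ⊗ₜ algebraMap R K π := by
      change algebraMap R (piCompletion π C) π ⊗ₜ 1 = _
      rw [Algebra.algebraMap_eq_smul_one, TensorProduct.smul_tmul, Algebra.algebraMap_eq_smul_one]
    rw [h2]
    refine ⟨⟨1 ⊗ₜ algebraMap R K π, 1 ⊗ₜ (algebraMap R K π)⁻¹, ?_, ?_⟩, rfl⟩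
    · rw [Algebra.TensorProduct.tmul_mul_tmul, mul_inv_cancel₀ h1, one_mul]
      rfl
    · rw [Algebra.TensorProduct.tmul_mul_tmul, inv_mul_cancel₀ h1, one_mul]
      rfl
  ι_surj e := by
    have hpow : ∀ (m : ℕ) (e : piCompletion π C ⊗[R] K),
        (Algebra.TensorProduct.includeLeftRingHom (algebraMap R (piCompletion π C) π) :
          piCompletion π C ⊗[R] K) ^ m * e = π ^ m • e := fun m e ↦ by
      rw [← map_pow, ← map_pow]
      exact (Algebra.smul_def (π ^ m) e).symm
    simp only [hpow]
    induction e with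
    | zero => exact ⟨0, 0, by simp⟩
    | add x y hx hy =>
      obtain ⟨m, s, hs⟩ := hx
      obtain ⟨m', s', hs'⟩ := hy
      refine ⟨m + m', π ^ m' • s + π ^ m • s', ?_⟩
      have h1 : ∀ (r : R) (s : piCompletion π C),
          (Algebra.TensorProduct.includeLeftRingHom (r • s) : piCompletion π C ⊗[R] K) =
            r • Algebra.TensorProduct.includeLeftRingHom s := fun r s ↦ rfl
      rw [RingHom.map_add, h1, h1, ← hs, ← hs', smul_smul, smul_smul, smul_add, ← pow_add,
        ← pow_add,
        add_comm m' m]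
    | tmul s k =>
      obtain ⟨m, a, ha⟩ := exists_pow_smul_eq_algebraMap hirr k
      refine ⟨m, a • s, ?_⟩
      rw [← TensorProduct.tmul_smul, ha, Algebra.algebraMap_eq_smul_one, ← TensorProduct.smul_tmul]
      rfl
  sep s h := compl_ext fun m ↦ by
    obtain ⟨s', rfl⟩ := h m
    rw [← map_pow, compl_algebraMap_mul, pow_smul_quotient, map_zero]
  complete a := by
    refine ⟨complSum a, fun n ↦ ⟨complSum fun i ↦ a (i + n), ?_⟩⟩
    rw [sub_eq_iff_eq_add]
    induction n with
    | zero => simp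
    | succ n ih =>
      rw [ih, complSum_eq fun i ↦ a (i + n), Finset.sum_range_succ, mul_add, pow_succ, mul_assoc,
        zero_add]
      simp only [add_assoc, add_comm 1 n]
      abel

end Localization

end AuslanderReg

end

noncomputable section

namespace AuslanderReg

/-! ### Symbols on deformations and on special fibres -/

namespace IsSymbolMap

section Quotient

variable {R : Type*} [CommRing R] {π : R} {A : Type*} [Ring A] [Algebra R A]
  {G : Type*} [CommRing G]
  {F : ℕ → AddSubgroup A} {σ : ℕ → A → G} {γ : ℕ → G →+ G} (h : IsSymbolMap F σ γ) {ϖ : G}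
  (hϖ : ∀ g, ϖ * g = 0 → g = 0) (hF : ∀ i, ∀ x ∈ F i, π • x ∈ F i)
  (hσ : ∀ i, ∀ x ∈ F i, σ i (π • x) = ϖ * σ i x)

include h hF hσ in
lemma comp_uniformizer_mul (i : ℕ) (g : G) : γ i (ϖ * g) = ϖ * γ i g := by
  have h1 : σ 0 (π • 1) = ϖ := by rw [hσ 0 1 h.one_mem, h.map_one, mul_one]
  have h2 := h.comp_mul (hF 0 1 h.one_mem) i g
  rwa [h1, if_pos (Nat.zero_le i), Nat.sub_zero, mul_comm, mul_comm (γ i g)] at h2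

include h hϖ hσ in
-- Strictness of multiplication by `π`: if `z` had degree above `i`, its symbol would be nonzero and
-- killed by the regular element `ϖ`.
lemma mem_of_smul_mem {i : ℕ} {z : A} (hz : π • z ∈ F i) : z ∈ F i := by
  obtain ⟨j, hj⟩ := h.exh z
  induction j with
  | zero => exact h.mono (Nat.zero_le i) hj
  | succ k ih =>
    by_cases hik : k + 1 ≤ i
    · exact h.mono hik hj
    · refine ih ((h.succ_iff hj).1 (hϖ _ ?_))
      rw [← hσ _ _ hj, h.succ_iff]
      · exact h.mono (by omega) hz
      · exact h.mono (by omega) hz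

variable {H : Type*} [CommRing H] (q : G →+* H)

/-- The image of a filtration in the quotient by `π`. -/
def quotFiltration (π : R) (F : ℕ → AddSubgroup A) (i : ℕ) : AddSubgroup (A ⧸ powIdeal π A 1) :=
  (F i).map (Ideal.Quotient.mk (powIdeal π A 1)).toAddMonoidHom

lemma mk_mem_quotFiltration {i : ℕ} {x : A} (hx : x ∈ F i) :
    Ideal.Quotient.mk (powIdeal π A 1) x ∈ quotFiltration π F i := ⟨x, hx, rfl⟩

open Classical in
/-- The symbols on the quotient by `π`. -/
def quotSymbol (π : R) (F : ℕ → AddSubgroup A) (σ : ℕ → A → G) (q : G →+* H) (i : ℕ)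
    (b : A ⧸ powIdeal π A 1) : H :=
  if hb : b ∈ quotFiltration π F i then q (σ i hb.choose) else 0

include h hϖ hσ in
-- Two representatives in `F i` differ by some `π • z` with `z ∈ F i` by strictness, and its symbol
-- is a multiple of `ϖ`, killed by `q`.
lemma quotSymbol_mk (hq : q ϖ = 0) {i : ℕ} {x : A} (hx : x ∈ F i) :
    quotSymbol π F σ q i (Ideal.Quotient.mk _ x) = q (σ i x) := by
  have hb := mk_mem_quotFiltration (π := π) hx
  rw [quotSymbol, dif_pos hb]
  obtain ⟨hy, hyx⟩ := hb.choose_spec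
  set y := hb.choose
  obtain ⟨z, hz⟩ := mem_powIdeal_iff.1 (Ideal.Quotient.eq.1 hyx)
  rw [pow_one] at hz
  have hzF : π • z ∈ F i := hz ▸ sub_mem hy hx
  rw [← sub_eq_zero, ← map_sub, ← h.map_sub hy hx, hz, hσ _ _ (h.mem_of_smul_mem hϖ hσ hzF),
    map_mul, hq, zero_mul]

include h hϖ hF hσ in
/-- Symbols on a filtered algebra induce symbols on its reduction modulo `π`. -/
lemma quotient (hq : Function.Surjective q) (hq0 : ∀ g, q g = 0 ↔ ∃ g', g = ϖ * g')
    {γ' : ℕ → H →+ H} (hγ : ∀ i g, γ' i (q g) = q (γ i g)) :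
    IsSymbolMap (quotFiltration π F) (quotSymbol π F σ q) γ' := by
  have hqϖ : q ϖ = 0 := (hq0 _).2 ⟨1, (mul_one ϖ).symm⟩
  have hmk := fun {i : ℕ} {x : A} (hx : x ∈ F i) ↦ h.quotSymbol_mk hϖ hσ q hqϖ hx
  -- A symbol divisible by `ϖ` is the symbol of some `π • y`, so the class of `x` modulo `π` has a
  -- representative with zero symbol.
  have hdiv : ∀ {i : ℕ} {x : A}, x ∈ F i → q (σ i x) = 0 →
      ∃ y ∈ F i, σ i (x - π • y) = 0 := by
    intro i x hx h0
    obtain ⟨g, hg⟩ := (hq0 _).1 h0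
    obtain ⟨y, hy, hyg⟩ := h.exists_symbol i g
    refine ⟨y, hy, ?_⟩
    have h1 := h.comp_symbol i hx
    rw [if_pos rfl, hg, h.comp_uniformizer_mul hF hσ] at h1
    rw [h.map_sub hx (hF _ _ hy), hσ _ _ hy, hyg, hg, h1, sub_self]
  have hzero : ∀ y : A, Ideal.Quotient.mk (powIdeal π A 1) (π • y) = 0 := fun y ↦
    Ideal.Quotient.eq_zero_iff_mem.2 (mem_powIdeal_iff.2 ⟨y, by rw [pow_one]⟩)
  constructor
  · rintro i j hij _ ⟨x, hx, rfl⟩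
    exact mk_mem_quotFiltration (h.mono hij hx)
  · exact mk_mem_quotFiltration h.one_mem
  · rintro i j _ _ ⟨x, hx, rfl⟩ ⟨y, hy, rfl⟩
    exact mk_mem_quotFiltration (h.mul_mem hx hy)
  · intro b
    obtain ⟨x, rfl⟩ := Ideal.Quotient.mk_surjective b
    obtain ⟨i, hi⟩ := h.exh x
    exact ⟨i, mk_mem_quotFiltration hi⟩
  · rintro i _ _ ⟨x, hx, rfl⟩ ⟨y, hy, rfl⟩
    refine (hmk (add_mem hx hy)).trans ?_
    rw [h.map_add hx hy, map_add]
    exact congrArg₂ _ (hmk hx).symm (hmk hy).symm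
  · rintro i j _ _ ⟨x, hx, rfl⟩ ⟨y, hy, rfl⟩
    refine (hmk (h.mul_mem hx hy)).trans ?_
    rw [h.map_mul hx hy, map_mul]
    exact congrArg₂ _ (hmk hx).symm (hmk hy).symm
  · refine (hmk h.one_mem).trans ?_
    rw [h.map_one, map_one]
  · rintro _ ⟨x, hx, rfl⟩
    change quotSymbol π F σ q 0 (Ideal.Quotient.mk _ x) = 0 ↔ Ideal.Quotient.mk _ x = 0
    rw [hmk hx]
    refine ⟨fun h0 ↦ ?_, fun h0 ↦ ?_⟩
    · obtain ⟨y, hy, hxy⟩ := hdiv hx h0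
      rw [h.zero_iff (sub_mem hx (hF _ _ hy)), sub_eq_zero] at hxy
      rw [hxy, hzero]
    · rw [← hmk hx, h0, ← map_zero (Ideal.Quotient.mk _), hmk (zero_mem _), h.map_zero, map_zero]
  · rintro i _ ⟨x, hx, rfl⟩
    change quotSymbol π F σ q (i + 1) (Ideal.Quotient.mk _ x) = 0 ↔
      Ideal.Quotient.mk _ x ∈ quotFiltration π F i
    refine ⟨fun h0 ↦ ?_, ?_⟩
    · rw [hmk hx] at h0
      obtain ⟨y, hy, hxy⟩ := hdiv hx h0
      rw [h.succ_iff (sub_mem hx (hF _ _ hy))] at hxy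
      refine ⟨_, hxy, ?_⟩
      change Ideal.Quotient.mk _ (x - π • y) = _
      rw [map_sub, hzero, sub_zero]
    · rintro ⟨y, hy, hyx⟩
      change Ideal.Quotient.mk _ y = _ at hyx
      rw [← hyx, hmk (h.mono (Nat.le_succ i) hy),
        (h.succ_iff (h.mono (Nat.le_succ i) hy)).2 hy, map_zero]
  · rintro i _ j ⟨x, hx, rfl⟩
    change γ' j (quotSymbol π F σ q i (Ideal.Quotient.mk _ x)) =
      if i = j then quotSymbol π F σ q i (Ideal.Quotient.mk _ x) else 0
    rw [hmk hx, hγ, h.comp_symbol j hx]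
    split_ifs <;> simp
  · intro i g
    obtain ⟨g, rfl⟩ := hq g
    obtain ⟨x, hx, hg⟩ := h.exists_symbol i g
    exact ⟨_, mk_mem_quotFiltration hx, by rw [hmk hx, hg, hγ]⟩
  · intro g
    obtain ⟨g, rfl⟩ := hq g
    obtain ⟨N, hN⟩ := h.sum_comp g
    refine ⟨N, fun n hn ↦ ?_⟩
    conv_lhs => rw [hN n hn, map_sum]
    simp only [hγ]

end Quotient

/-! ### Symbols on the deformations `A_n` -/

section Deformation

variable {R : Type*} [CommRing R] (π : R) {A : Type*} [Ring A] [Algebra R A] {G : Type*}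
  [CommRing G] (F : ℕ → Submodule R A) (n : ℕ)

/-- The lattice `∑_{k ≤ i} π^{nk} F_k`. -/
def lattice (i : ℕ) : AddSubgroup A :=
  AddSubgroup.closure {z | ∃ k ≤ i, ∃ a ∈ F k, z = π ^ (n * k) • a}

variable {π F n}

lemma smul_mem_lattice {i k : ℕ} (hk : k ≤ i) {a : A} (ha : a ∈ F k) :
    π ^ (n * k) • a ∈ lattice π F n i := AddSubgroup.subset_closure ⟨k, hk, a, ha, rfl⟩

lemma lattice_mono : Monotone (lattice π F n) := fun i j hij ↦ by
  refine (AddSubgroup.closure_le _).2 ?_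
  rintro _ ⟨k, hk, a, ha, rfl⟩
  exact smul_mem_lattice (hk.trans hij) ha

lemma uniformizer_smul_mem_lattice {i : ℕ} {x : A} (hx : x ∈ lattice π F n i) :
    π • x ∈ lattice π F n i := by
  induction hx using AddSubgroup.closure_induction with
  | mem x hx =>
    obtain ⟨k, hk, a, ha, rfl⟩ := hx
    rw [smul_comm]
    exact smul_mem_lattice hk ((F k).smul_mem _ ha)
  | zero => rw [smul_zero]; exact zero_mem _
  | add x y _ _ hx hy => rw [smul_add]; exact add_mem hx hy
  | neg x _ hx => rw [smul_neg]; exact neg_mem hx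

variable {σ : ℕ → A → G} {γ : ℕ → G →+ G}
  (h : IsSymbolMap (fun i ↦ (F i).toAddSubgroup) σ γ) {ϖ : G}
  (hϖ : ∀ g, ϖ * g = 0 → g = 0) (hσ : ∀ i, ∀ x ∈ F i, σ i (π • x) = ϖ * σ i x)

include h in
lemma lattice_le (i : ℕ) : lattice π F n i ≤ (F i).toAddSubgroup := by
  refine (AddSubgroup.closure_le _).2 ?_
  rintro _ ⟨k, hk, a, ha, rfl⟩
  exact h.mono hk ((F k).smul_mem _ ha)

lemma lattice_zero : lattice π F n 0 = (F 0).toAddSubgroup := by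
  refine le_antisymm ((AddSubgroup.closure_le _).2 ?_) fun x hx ↦ ?_
  · rintro _ ⟨k, hk, a, ha, rfl⟩
    obtain rfl : k = 0 := by omega
    exact (F 0).smul_mem _ ha
  · have := smul_mem_lattice (π := π) (n := n) le_rfl (show x ∈ F 0 from hx)
    rwa [mul_zero, pow_zero, one_smul] at this

include h in
lemma mul_mem_lattice {i j : ℕ} {x y : A} (hx : x ∈ lattice π F n i) (hy : y ∈ lattice π F n j) :
    x * y ∈ lattice π F n (i + j) := by
  induction hx using AddSubgroup.closure_induction with
  | mem x hx =>
    obtain ⟨k, hk, a, ha, rfl⟩ := hx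
    induction hy using AddSubgroup.closure_induction with
    | mem y hy =>
      obtain ⟨l, hl, b, hb, rfl⟩ := hy
      rw [smul_mul_smul_comm, ← pow_add, ← mul_add]
      exact smul_mem_lattice (by omega) (h.mul_mem ha hb)
    | zero => rw [mul_zero]; exact zero_mem _
    | add y z _ _ hy hz => rw [mul_add]; exact add_mem hy hz
    | neg y _ hy => rw [mul_neg]; exact neg_mem hy
  | zero => rw [zero_mul]; exact zero_mem _
  | add x z _ _ hx hz => rw [add_mul]; exact add_mem hx hz
  | neg x _ hx => rw [neg_mul]; exact neg_mem hx

lemma exists_sub_mem_lattice {i : ℕ} {x : A} (hx : x ∈ lattice π F n (i + 1)) :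
    ∃ a ∈ F (i + 1), x - π ^ (n * (i + 1)) • a ∈ lattice π F n i := by
  induction hx using AddSubgroup.closure_induction with
  | mem x hx =>
    obtain ⟨k, hk, a, ha, rfl⟩ := hx
    rcases Nat.lt_or_ge k (i + 1) with hki | hki
    · exact ⟨0, zero_mem _, by rw [smul_zero, sub_zero]; exact smul_mem_lattice (by omega) ha⟩
    · obtain rfl : k = i + 1 := by omega
      exact ⟨a, ha, by rw [sub_self]; exact zero_mem _⟩
  | zero => exact ⟨0, zero_mem _, by rw [smul_zero, sub_zero]; exact zero_mem _⟩
  | add x y _ _ hx hy =>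
    obtain ⟨a, ha, hx⟩ := hx
    obtain ⟨b, hb, hy⟩ := hy
    exact ⟨a + b, add_mem ha hb, by rw [smul_add, add_sub_add_comm]; exact add_mem hx hy⟩
  | neg x _ hx =>
    obtain ⟨a, ha, hx⟩ := hx
    exact ⟨-a, neg_mem ha, by rw [smul_neg, ← neg_sub']; exact neg_mem hx⟩

open Classical in
/-- The symbol of an element of the lattice, divided by `ϖ ^ (n * i)`. -/
def latticeSymbol (σ : ℕ → A → G) (ϖ : G) (n i : ℕ) (x : A) : G :=
  if hx : ∃ g, σ i x = ϖ ^ (n * i) * g then hx.choose else 0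

include hϖ in
lemma pow_mul_cancel (m : ℕ) {g g' : G} (hg : ϖ ^ m * g = ϖ ^ m * g') : g = g' := by
  induction m with
  | zero => simpa using hg
  | succ m ih =>
    rw [pow_succ', mul_assoc, mul_assoc] at hg
    refine ih (sub_eq_zero.1 (hϖ _ ?_))
    rw [mul_sub, hg, sub_self]

include hϖ in
omit [Ring A] in
lemma latticeSymbol_eq {i : ℕ} {x : A} {g : G} (hg : σ i x = ϖ ^ (n * i) * g) :
    latticeSymbol σ ϖ n i x = g := by
  have hx : ∃ g, σ i x = ϖ ^ (n * i) * g := ⟨g, hg⟩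
  rw [latticeSymbol, dif_pos hx]
  exact pow_mul_cancel hϖ _ (hx.choose_spec.symm.trans hg)

include hσ in
lemma symbol_pow_smul (m : ℕ) {i : ℕ} {a : A} (ha : a ∈ F i) :
    σ i (π ^ m • a) = ϖ ^ m * σ i a := by
  induction m with
  | zero => simp
  | succ m ih =>
    rw [pow_succ', mul_smul, hσ _ _ ((F i).smul_mem _ ha), ih, pow_succ', mul_assoc]

include h hσ in
-- Only the top summand `π ^ (n * i) • a` contributes to the symbol of degree `i`, which is why that
-- symbol is divisible by `ϖ ^ (n * i)`.
lemma exists_symbol_eq {i : ℕ} {x : A} (hx : x ∈ lattice π F n i) :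
    ∃ a ∈ F i, σ i x = ϖ ^ (n * i) * σ i a := by
  cases i with
  | zero =>
    rw [lattice_zero] at hx
    exact ⟨x, hx, by simp⟩
  | succ i =>
    obtain ⟨a, ha, hxa⟩ := exists_sub_mem_lattice hx
    refine ⟨a, ha, ?_⟩
    have h1 := lattice_le h i hxa
    have h2 := (h.succ_iff (h.mono (Nat.le_succ i) h1)).2 h1
    have h3 : π ^ (n * (i + 1)) • a ∈ F (i + 1) := (F _).smul_mem _ ha
    rw [h.map_sub (lattice_le h _ hx) h3, sub_eq_zero] at h2
    rw [h2, symbol_pow_smul hσ _ ha]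

include h hϖ hσ in
lemma latticeSymbol_spec {i : ℕ} {x : A} (hx : x ∈ lattice π F n i) :
    σ i x = ϖ ^ (n * i) * latticeSymbol σ ϖ n i x := by
  obtain ⟨a, ha, hxa⟩ := exists_symbol_eq h hσ hx
  rw [latticeSymbol_eq hϖ hxa, hxa]

include h hϖ hσ in
lemma exists_latticeSymbol_eq {i : ℕ} {x : A} (hx : x ∈ lattice π F n i) :
    ∃ a ∈ F i, latticeSymbol σ ϖ n i x = σ i a := by
  obtain ⟨a, ha, hxa⟩ := exists_symbol_eq h hσ hx
  exact ⟨a, ha, latticeSymbol_eq hϖ hxa⟩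

include h hϖ hσ in
/-- Symbols on the deformations of a filtered algebra. -/
lemma deformation (C : Subalgebra R A) (hC : ∀ x, x ∈ C ↔ ∃ i, x ∈ lattice π F n i) :
    IsSymbolMap (fun i ↦ (lattice π F n i).comap C.val.toLinearMap.toAddMonoidHom)
      (fun i x ↦ latticeSymbol σ ϖ n i (x : A)) γ where
  mono i j hij x hx := lattice_mono hij hx
  one_mem := by
    change (1 : A) ∈ lattice π F n 0
    rw [lattice_zero]
    exact h.one_mem
  mul_mem hx hy := mul_mem_lattice h hx hy
  exh x := (hC x).1 x.2
  map_add {i x y} hx hy := latticeSymbol_eq hϖ (by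
    replace hx : (x : A) ∈ lattice π F n i := hx
    replace hy : (y : A) ∈ lattice π F n i := hy
    change σ i ((x : A) + y) = _
    rw [h.map_add (lattice_le h i hx) (lattice_le h i hy), latticeSymbol_spec h hϖ hσ hx,
      latticeSymbol_spec h hϖ hσ hy, mul_add])
  map_mul {i j x y} hx hy := latticeSymbol_eq hϖ (by
    replace hx : (x : A) ∈ lattice π F n i := hx
    replace hy : (y : A) ∈ lattice π F n j := hy
    change σ (i + j) ((x : A) * y) = _
    rw [h.map_mul (lattice_le h i hx) (lattice_le h j hy), latticeSymbol_spec h hϖ hσ hx,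
      latticeSymbol_spec h hϖ hσ hy, mul_add n, pow_add, mul_mul_mul_comm])
  map_one := latticeSymbol_eq hϖ (by
    change σ 0 (1 : A) = _
    rw [h.map_one, mul_one, mul_zero, pow_zero])
  zero_iff {x} hx := by
    replace hx : (x : A) ∈ lattice π F n 0 := hx
    have h1 := latticeSymbol_spec h hϖ hσ hx
    rw [mul_zero, pow_zero, one_mul] at h1
    rw [← h1]
    exact (h.zero_iff (lattice_le h 0 hx)).trans (ZeroMemClass.coe_eq_zero)
  succ_iff {i x} hx := by
    replace hx : (x : A) ∈ lattice π F n (i + 1) := hx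
    refine ⟨fun h0 ↦ ?_, fun hxi ↦ ?_⟩
    -- If the divided symbol vanishes, the top coefficient `a` lies in `F i`; then `π ^ (n * (i +
    -- 1)) • a` lies in the lattice of degree `i`, with a factor `π ^ n` to spare.
    · obtain ⟨a, ha, hxa⟩ := exists_sub_mem_lattice hx
      have h2 := lattice_le h i hxa
      have h3 := (h.succ_iff (h.mono (Nat.le_succ i) h2)).2 h2
      have h4 : π ^ (n * (i + 1)) • a ∈ F (i + 1) := (F _).smul_mem _ ha
      rw [h.map_sub (lattice_le h _ hx) h4, sub_eq_zero] at h3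
      have h6 : σ (i + 1) a = 0 := by
        rw [← latticeSymbol_eq hϖ (h3.trans (symbol_pow_smul hσ _ ha))]
        exact h0
      have h7 : a ∈ F i := (h.succ_iff ha).1 h6
      have h8 : π ^ (n * (i + 1)) • a ∈ lattice π F n i := by
        rw [mul_add, mul_one, pow_add, mul_smul]
        exact smul_mem_lattice le_rfl ((F i).smul_mem _ h7)
      have := add_mem hxa h8
      rwa [sub_add_cancel] at this
    · refine latticeSymbol_eq hϖ ?_
      rw [mul_zero]
      exact (h.succ_iff (lattice_le h _ hx)).2 (lattice_le h _ hxi)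
  comp_symbol {i x} j hx := by
    replace hx : (x : A) ∈ lattice π F n i := hx
    obtain ⟨a, ha, hxa⟩ := exists_latticeSymbol_eq h hϖ hσ hx
    rw [hxa, h.comp_symbol j ha]
  exists_symbol i g := by
    obtain ⟨a, ha, hg⟩ := h.exists_symbol i g
    have h1 := smul_mem_lattice (π := π) (n := n) le_rfl (show a ∈ F i from ha)
    exact ⟨⟨_, (hC _).2 ⟨i, h1⟩⟩, h1, (latticeSymbol_eq hϖ (symbol_pow_smul hσ _ ha)).trans hg⟩
  sum_comp := h.sum_comp

include h hϖ hσ in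
lemma latticeSymbol_smul {i : ℕ} {x : A} (hx : x ∈ lattice π F n i) :
    latticeSymbol σ ϖ n i (π • x) = ϖ * latticeSymbol σ ϖ n i x :=
  latticeSymbol_eq hϖ (by
    rw [hσ _ _ (lattice_le h i hx), latticeSymbol_spec h hϖ hσ hx, mul_left_comm])

end Deformation

end IsSymbolMap

end AuslanderReg

end

noncomputable section

namespace AuslanderReg

/-! ### The symbols of a filtered algebra with polynomial associated graded ring -/

section Polynomial

variable {R A : Type*} [CommRing R] [Ring A] [Algebra R A] {F : ℕ → Submodule R A}
  [IsRingFiltration F (pred F)]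

omit [IsRingFiltration F (pred F)] in
lemma symb_eq_zero_iff {i : ℕ} {x : A} (hx : x ∈ F i) : symb i x hx = 0 ↔ x ∈ pred F i := by
  have h := symb_eq_iff hx (zero_mem (F i))
  rwa [sub_zero] at h

omit [IsRingFiltration F (pred F)] in
lemma symb_add {i : ℕ} {x y : A} (hx : x ∈ F i) (hy : y ∈ F i) :
    symb i (x + y) (add_mem hx hy) = symb i x hx + symb i y hy := rfl

lemma of_symb_mul {i j : ℕ} {x y : A} (hx : x ∈ F i) (hy : y ∈ F j) :
    DirectSum.of (GrPiece F) i (symb i x hx) * DirectSum.of (GrPiece F) j (symb j y hy) =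
      DirectSum.of (GrPiece F) (i + j)
        (symb (i + j) (x * y) (SetLike.GradedMul.mul_mem (A := F) hx hy)) :=
  DirectSum.of_mul_of _ _

variable (F) in
/-- The inclusion of the degree zero part into the associated graded ring. -/
def zeroSymbol : degZero F →+* Gr F where
  toFun z := DirectSum.of (GrPiece F) 0 (symb 0 (z : A) z.2)
  map_one' := rfl
  map_zero' := (DirectSum.of (GrPiece F) 0).map_zero
  map_add' x y :=
    (DirectSum.of (GrPiece F) 0).map_add (symb 0 (x : A) x.2) (symb 0 (y : A) y.2)
  map_mul' x y := (of_symb_mul x.2 y.2).symm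

variable [IsMulCommutative (degZero F)] {r : ℕ} (e : Gr F ≃+* MvPolynomial (Fin r) (degZero F))

/-- The isomorphism commutes with projection to each degree, so its inverse also preserves
homogeneity. -/
lemma homogeneousComponent_apply_gr
    (he : ∀ i x, (e (DirectSum.of (GrPiece F) i x)).IsHomogeneous i) (i : ℕ) (y : Gr F) :
    MvPolynomial.homogeneousComponent i (e y) = e (DirectSum.of (GrPiece F) i (y i)) := by
  induction y using DirectSum.induction_on with
  | zero => simp
  | add x y hx hy => rw [map_add, map_add, hx, hy, DirectSum.add_apply, map_add, map_add]
  | of j x =>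
    rw [MvPolynomial.homogeneousComponent_of_mem (he j x)]
    split_ifs with hij
    · subst hij
      rw [DirectSum.of_eq_same]
    · rw [DirectSum.of_eq_of_ne _ _ _ hij, map_zero, map_zero]

lemma exists_of_isHomogeneous
    (he : ∀ i x, (e (DirectSum.of (GrPiece F) i x)).IsHomogeneous i) {i : ℕ}
    {g : MvPolynomial (Fin r) (degZero F)} (hg : g.IsHomogeneous i) :
    ∃ (x : A) (hx : x ∈ F i), e (DirectSum.of (GrPiece F) i (symb i x hx)) = g := by
  obtain ⟨x, hx, hxy⟩ := symb_surj (e.symm g i)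
  refine ⟨x, hx, ?_⟩
  rw [hxy, ← homogeneousComponent_apply_gr e he, RingEquiv.apply_symm_apply,
    MvPolynomial.homogeneousComponent_of_mem hg, if_pos rfl]

/-- The graded isomorphism can be chosen to be the identity in degree zero. -/
lemma exists_normalized (hgr : IsGrPolynomial F r) :
    ∃ e : Gr F ≃+* MvPolynomial (Fin r) (degZero F),
      (∀ i x, (e (DirectSum.of (GrPiece F) i x)).IsHomogeneous i) ∧
        ∀ z, e (zeroSymbol F z) = MvPolynomial.C z := by
  obtain ⟨e, he⟩ := hgr
  -- In degree zero the isomorphism induces an automorphism `τ` of `F_0 A`; applying `τ⁻¹` to the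
  -- coefficients removes it.
  let τ : degZero F →+* degZero F :=
    (MvPolynomial.constantCoeff.comp (e : Gr F →+* MvPolynomial (Fin r) (degZero F))).comp
      (zeroSymbol F)
  have hτ : ∀ z, e (zeroSymbol F z) = MvPolynomial.C (τ z) := fun z ↦ by
    have h1 := MvPolynomial.homogeneousComponent_of_mem (m := 0) (n := 0)
      (he 0 (symb 0 (z : A) z.2))
    rw [if_pos rfl, MvPolynomial.homogeneousComponent_zero] at h1
    exact h1.symm
  have hbij : Function.Bijective τ := by
    refine ⟨(injective_iff_map_eq_zero τ).2 fun z hz ↦ ?_, fun z ↦ ?_⟩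
    · have h1 := hτ z
      rw [hz, map_zero, map_eq_zero_iff e e.injective] at h1
      have h2 := (symb_eq_zero_iff z.2).1 (DirectSum.of_injective (β := GrPiece F) 0
        (h1.trans (map_zero _).symm))
      exact Subtype.ext h2
    · obtain ⟨x, hx, hxz⟩ := exists_of_isHomogeneous e he (MvPolynomial.isHomogeneous_C (Fin r) z)
      exact ⟨⟨x, hx⟩, MvPolynomial.C_injective (Fin r) _ ((hτ ⟨x, hx⟩).symm.trans hxz)⟩
  let τ' := RingEquiv.ofBijective τ hbij
  refine ⟨e.trans (MvPolynomial.mapEquiv (Fin r) τ'.symm), fun i x ↦ ?_, fun z ↦ ?_⟩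
  · exact (he i x).map _
  · change MvPolynomial.map _ (e (zeroSymbol F z)) = _
    rw [hτ, MvPolynomial.map_C]
    exact congrArg _ (τ'.symm_apply_apply z)

open Classical in
/-- The symbol of degree `i`, as an element of a polynomial ring. -/
def polySymbol (i : ℕ) (x : A) : MvPolynomial (Fin r) (degZero F) :=
  if hx : x ∈ F i then e (DirectSum.of (GrPiece F) i (symb i x hx)) else 0

lemma polySymbol_of_mem {i : ℕ} {x : A} (hx : x ∈ F i) :
    polySymbol e i x = e (DirectSum.of (GrPiece F) i (symb i x hx)) := dif_pos hx

lemma polySymbol_eq_zero_iff {i : ℕ} {x : A} (hx : x ∈ F i) :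
    polySymbol e i x = 0 ↔ x ∈ pred F i := by
  rw [polySymbol_of_mem e hx, map_eq_zero_iff e e.injective,
    map_eq_zero_iff _ (DirectSum.of_injective (β := GrPiece F) i), symb_eq_zero_iff]

lemma isSymbolMap_polySymbol (hexh : ⨆ i, F i = ⊤)
    (he : ∀ i x, (e (DirectSum.of (GrPiece F) i x)).IsHomogeneous i) :
    IsSymbolMap (fun i ↦ (F i).toAddSubgroup) (polySymbol e)
      (fun i ↦ (MvPolynomial.homogeneousComponent i).toAddMonoidHom) where
  mono i j hij := IsFiltration.mono (F := F) (F_lt := pred F) hij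
  one_mem := SetLike.GradedOne.one_mem (A := F)
  mul_mem hx hy := SetLike.GradedMul.mul_mem (A := F) hx hy
  exh x := (Submodule.mem_iSup_of_directed F (IsFiltration.mono (F := F)
    (F_lt := pred F)).directed_le).1 (hexh ▸ Submodule.mem_top)
  map_add {i x y} hx hy := by
    replace hx : x ∈ F i := hx
    replace hy : y ∈ F i := hy
    rw [polySymbol_of_mem e hx, polySymbol_of_mem e hy, polySymbol_of_mem e (add_mem hx hy),
      symb_add hx hy, map_add, map_add]
  map_mul {i j x y} hx hy := by
    replace hx : x ∈ F i := hx
    replace hy : y ∈ F j := hy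
    rw [polySymbol_of_mem e hx, polySymbol_of_mem e hy,
      polySymbol_of_mem e (SetLike.GradedMul.mul_mem (A := F) hx hy), ← of_symb_mul, map_mul]
  map_one := by
    rw [polySymbol_of_mem e (SetLike.GradedOne.one_mem (A := F))]
    exact map_one e
  zero_iff hx := polySymbol_eq_zero_iff e hx
  succ_iff hx := polySymbol_eq_zero_iff e hx
  comp_symbol {i x} j hx := by
    replace hx : x ∈ F i := hx
    rw [polySymbol_of_mem e hx]
    refine (MvPolynomial.homogeneousComponent_of_mem (he i _)).trans ?_
    simp only [eq_comm]
  exists_symbol i g := by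
    obtain ⟨x, hx, hg⟩ := exists_of_isHomogeneous e he
      (MvPolynomial.homogeneousComponent_isHomogeneous i g)
    exact ⟨x, hx, (polySymbol_of_mem e hx).trans hg⟩
  sum_comp g := by
    refine ⟨g.totalDegree + 1, fun n hn ↦ ?_⟩
    conv_lhs => rw [← MvPolynomial.sum_homogeneousComponent g]
    refine Finset.sum_subset (Finset.range_mono hn) fun i _ hi ↦
      MvPolynomial.homogeneousComponent_eq_zero i g ?_
    simpa using hi

/-- Scalars act through `F_0 A`, and the normalization makes `π` act on symbols as the constant `π`,
so that reduction modulo `π` gives polynomials over the special fibre. -/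
lemma polySymbol_smul (hexh : ⨆ i, F i = ⊤)
    (he : ∀ i x, (e (DirectSum.of (GrPiece F) i x)).IsHomogeneous i)
    (he0 : ∀ z, e (zeroSymbol F z) = MvPolynomial.C z) (c : R) {i : ℕ} {x : A} (hx : x ∈ F i) :
    polySymbol e i (c • x) = MvPolynomial.C (algebraMap R (degZero F) c) * polySymbol e i x := by
  have h1 : algebraMap R A c ∈ F 0 := SetLike.algebraMap_mem_graded F c
  have h2 := (isSymbolMap_polySymbol e hexh he).map_mul h1 hx
  rw [zero_add, ← Algebra.smul_def, polySymbol_of_mem e h1] at h2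
  rw [h2, ← he0]
  rfl

end Polynomial

section Deformation

variable {R A : Type*} [CommRing R] [Ring A] [Algebra R A] {F : ℕ → Submodule R A}
  [IsRingFiltration F (pred F)]

lemma evalScalar_eq_sum (c : R) (p : A[X]) :
    evalScalar A c p = ∑ i ∈ Finset.range (p.natDegree + 1), c ^ i • p.coeff i := by
  change Polynomial.eval₂ _ _ p = _
  rw [Polynomial.eval₂_eq_sum_range]
  refine Finset.sum_congr rfl fun i _ ↦ ?_
  rw [Algebra.smul_def, ← map_pow]
  exact (Algebra.commutes _ _).symm

lemma mem_deformation_iff (π : R) (n : ℕ) (x : A) :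
    x ∈ deformation F π n ↔ ∃ i, x ∈ IsSymbolMap.lattice π F n i := by
  constructor
  · rintro ⟨p, hp, rfl⟩
    refine ⟨p.natDegree, ?_⟩
    change evalScalar A (π ^ n) p ∈ _
    rw [evalScalar_eq_sum]
    refine sum_mem fun i hi ↦ ?_
    rw [← pow_mul]
    exact IsSymbolMap.smul_mem_lattice (by simpa [Nat.lt_succ_iff] using hi) (hp i)
  · rintro ⟨i, hx⟩
    refine (AddSubgroup.closure_le (deformation F π n).toSubmodule.toAddSubgroup).2 ?_ hx
    rintro _ ⟨k, -, a, ha, rfl⟩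
    refine ⟨Polynomial.monomial k a, fun j ↦ ?_, ?_⟩
    · rw [Polynomial.coeff_monomial]
      split_ifs with hj
      · subst hj
        exact ha
      · exact zero_mem _
    · change Polynomial.eval₂ _ _ (Polynomial.monomial k a) = _
      rw [Polynomial.eval₂_monomial, pow_mul, Algebra.smul_def, ← map_pow, Algebra.commutes]
      rfl

end Deformation

/-! ### The associated graded ring of `A_n / π A_n`, and the theorem -/

section Final

lemma exists_globalDimension_eq {S : Type*} [Ring S] [Nontrivial S] (h : globalDimension S < ⊤) :
    ∃ d : ℕ, globalDimension S = d := by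
  have hbot : globalDimension S ≠ ⊥ := fun h0 ↦ by
    have h1 : projectiveDimension (ModuleCat.of S S) ≤ ⊥ := h0 ▸ le_iSup projectiveDimension _
    have h2 := (projectiveDimension_eq_bot_iff _).1 (le_bot_iff.1 h1)
    rw [ModuleCat.isZero_iff_subsingleton] at h2
    exact not_subsingleton S h2
  generalize globalDimension S = x at h hbot
  induction x with
  | bot => exact absurd rfl hbot
  | coe x =>
    induction x with
    | top => exact absurd h (lt_irrefl _)
    | coe d => exact ⟨d, rfl⟩

variable {R A : Type*} [CommRing R] [IsDomain R] {π : R}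
  [Ring A] [Algebra R A] [Module.Flat R A] {F : ℕ → Submodule R A} [IsRingFiltration F (pred F)]
  [IsMulCommutative (degZero F)] [IsDomain (degZero F)]

lemma map_mk_eq_zero_iff {Z : Type*} [CommRing Z] (a : Z) {r : ℕ} (g : MvPolynomial (Fin r) Z) :
    MvPolynomial.map (Ideal.Quotient.mk (Ideal.span {a})) g = 0 ↔
      ∃ g', g = MvPolynomial.C a * g' := by
  have h : (∃ g', g = MvPolynomial.C a * g') ↔
      g ∈ Ideal.map (MvPolynomial.C (σ := Fin r)) (Ideal.span {a}) := by
    rw [Ideal.map_span, Set.image_singleton, Ideal.mem_span_singleton]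
    rfl
  rw [h, MvPolynomial.mem_map_C_iff, MvPolynomial.ext_iff]
  simp only [MvPolynomial.coeff_map, MvPolynomial.coeff_zero, Ideal.Quotient.eq_zero_iff_mem]

lemma homogeneousComponent_map {Z Z' : Type*} [CommRing Z] [CommRing Z'] (f : Z →+* Z') {r : ℕ}
    (i : ℕ) (g : MvPolynomial (Fin r) Z) :
    MvPolynomial.homogeneousComponent i (MvPolynomial.map f g) =
      MvPolynomial.map f (MvPolynomial.homogeneousComponent i g) := by
  ext m
  simp only [MvPolynomial.coeff_homogeneousComponent, MvPolynomial.coeff_map]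
  split_ifs <;> simp

omit [IsMulCommutative (degZero F)] in
lemma algebraMap_degZero_ne_zero (hπ : Irreducible π) : algebraMap R (degZero F) π ≠ 0 := fun h ↦ by
  have h1 : π • (1 : A) = 0 := by
    rw [← Algebra.algebraMap_eq_smul_one]
    exact congrArg Subtype.val h
  have := Module.Flat.isTorsionFree (R := R) (M := A)
  have h2 : (1 : A) = 0 := (smul_eq_zero.1 h1).resolve_left hπ.ne_zero
  exact one_ne_zero (α := degZero F) (Subtype.ext h2)

omit [IsDomain R] [Module.Flat R A] in
/-- Symbols on the reductions modulo `π` of the deformations of a filtered algebra. -/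
lemma IsSymbolMap.exists_reduction {G G' : Type*} [CommRing G] [CommRing G']
    {F : ℕ → Submodule R A} {σ : ℕ → A → G} {γ : ℕ → G →+ G} {γ' : ℕ → G' →+ G'} {ϖ : G}
    (h : IsSymbolMap (fun i ↦ (F i).toAddSubgroup) σ γ) (hϖ : ∀ g : G, ϖ * g = 0 → g = 0)
    (hσ : ∀ i, ∀ x ∈ F i, σ i (π • x) = ϖ * σ i x) {n : ℕ} (D : Subalgebra R A)
    (hD : ∀ x, x ∈ D ↔ ∃ i, x ∈ IsSymbolMap.lattice π F n i) (q : G →+* G')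
    (hq : Function.Surjective q) (hq0 : ∀ g, q g = 0 ↔ ∃ g', g = ϖ * g')
    (hγ : ∀ i g, γ' i (q g) = q (γ i g)) :
    ∃ (F' : ℕ → AddSubgroup (D ⧸ powIdeal π D 1)) (σ' : ℕ → (D ⧸ powIdeal π D 1) → G'),
      IsSymbolMap F' σ' γ' := by
  have h1 := h.deformation hϖ hσ D hD
  have h2 : ∀ i, ∀ x ∈ (IsSymbolMap.lattice π F n i).comap D.val.toLinearMap.toAddMonoidHom,
      π • x ∈ (IsSymbolMap.lattice π F n i).comap D.val.toLinearMap.toAddMonoidHom :=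
    fun i x hx ↦ IsSymbolMap.uniformizer_smul_mem_lattice (x := (x : A)) hx
  have h3 : ∀ i, ∀ x ∈ (IsSymbolMap.lattice π F n i).comap D.val.toLinearMap.toAddMonoidHom,
      latticeSymbol σ ϖ n i ((π • x : D) : A) = ϖ * latticeSymbol σ ϖ n i (x : A) :=
    fun i x hx ↦ IsSymbolMap.latticeSymbol_smul h hϖ hσ (x := (x : A)) hx
  exact ⟨_, _, h1.quotient hϖ h2 h3 q hq hq0 hγ⟩

/-- The associated graded ring of `A_n / π A_n` is the polynomial ring over the special fibre, for
every `n`: the domain `F_0 A` makes `π` regular on symbols, which permits dividing by its powers and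
reducing modulo it. -/
lemma exists_isSymbolMap_specialFibre (hπ : Irreducible π) (hexh : ⨆ i, F i = ⊤) {r : ℕ}
    (hgr : IsGrPolynomial F r) (n : ℕ) :
    ∃ (F' : ℕ → AddSubgroup (deformation F π n ⧸ powIdeal π (deformation F π n) 1))
      (σ : ℕ → (deformation F π n ⧸ powIdeal π (deformation F π n) 1) →
        MvPolynomial (Fin r) (SpecialFibre F π)),
      IsSymbolMap F' σ (fun i ↦ (MvPolynomial.homogeneousComponent i).toAddMonoidHom) := by
  obtain ⟨e, he, he0⟩ := exists_normalized hgr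
  have hne : algebraMap R (degZero F) π ≠ 0 := algebraMap_degZero_ne_zero hπ
  exact (isSymbolMap_polySymbol e hexh he).exists_reduction
    (fun g hg ↦ (mul_eq_zero.1 hg).resolve_left fun h ↦ hne (MvPolynomial.C_eq_zero.1 h))
    (fun i x hx ↦ polySymbol_smul e hexh he he0 π hx) _ (mem_deformation_iff π n)
    (MvPolynomial.map (Ideal.Quotient.mk _))
    (MvPolynomial.map_surjective _ Ideal.Quotient.mk_surjective)
    (map_mk_eq_zero_iff _) fun i g ↦ homogeneousComponent_map _ i g

end Final

end AuslanderReg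

end

open AuslanderReg in
theorem mainTheorem9 {R K A : Type*}
    [CommRing R] [IsDomain R] [IsDiscreteValuationRing R]
    [IsAdicComplete (IsLocalRing.maximalIdeal R) R]
    [Field K] [Algebra R K] [IsFractionRing R K]
    (π : R) (hπ : Irreducible π)
    [Ring A] [Algebra R A] [Module.Flat R A]
    (F : ℕ → Submodule R A) [IsRingFiltration F (pred F)]
    (hexh : ⨆ i, F i = ⊤)
    (hmul : ∀ i j, F i * F j = F j * F i)
    [IsMulCommutative (degZero F)] [IsNoetherianRing (degZero F)] [IsDomain (degZero F)]
    [IsDomain (SpecialFibre F π)]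
    [IsRegularRing (SpecialFibre F π)]
    (hfin : globalDimension (SpecialFibre F π) < ⊤)
    (r : ℕ) (hgr : IsGrPolynomial F r)
    (n : ℕ) :
    IsAuslanderRegular (CompletedDeformation K π F n) ∧
      globalDimension (CompletedDeformation K π F n) ≤
        globalDimension (SpecialFibre F π) + r ∧
      globalDimension (CompletedDeformation K π F n)ᵐᵒᵖ ≤
        globalDimension (SpecialFibre F π) + r := by
  -- The exact value is needed, not just a bound, since the global dimension of the special fibre
  -- occurs in the conclusion.
  obtain ⟨d, hd⟩ := exists_globalDimension_eq hfin
  have hG : globalDimension (MvPolynomial (Fin r) (SpecialFibre F π)) ≤ (d + r : ℕ) :=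
    globalDimension_mvPolynomial_le hd.le r
  obtain ⟨F', σ, h⟩ := exists_isSymbolMap_specialFibre hπ hexh hgr n
  have htf := Module.Flat.isTorsionFree (R := R) (M := A)
  have hD := isCompleteDeformation_piCompletion hπ K (C := deformation F π n) fun c hc ↦
    Subtype.ext ((smul_eq_zero.1 (congrArg Subtype.val hc)).resolve_left hπ.ne_zero)
  have := h.isNoetherianRing
  have := h.op.isNoetherianRing
  have hbound : globalDimension (SpecialFibre F π) + r = ((d + r : ℕ) : WithBot ℕ∞) := by
    rw [hd]
    push_cast
    rfl
  rw [hbound]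
  -- `h` passes from the polynomial ring to `A_n / π A_n`, and `hD` from there to the completion
  -- with `π` inverted; the opposite filtration has the same commutative graded ring, which gives
  -- the right-hand bound.
  exact ⟨hD.isAuslanderRegular (h.isAuslanderRegular hG),
    hD.globalDimension_le (h.globalDimension_le hG),
    hD.op.globalDimension_le (h.op.globalDimension_le hG)⟩
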